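/- Let $d\ge 2$, let $\mathbb B\subset\mathbb R^d$ be the open unit ball, $\mathbb S=\partial\mathbb B$ the unit sphere with surface measure $dS$ and $|\mathbb S|=\int_{\mathbb S}dS$, and let $V$ denote volume. Let $R:\mathbb S\to(0,\infty)$ be Lipschitz continuous and let $$\Omega=\{r\xi:\ \xi\in\mathbb S,\ 0\le r<R(\xi)\}$$ be the corresponding Lipschitz-starlike domain. Let $H:\mathbb S\to\mathbb S$ be any bi-Lipschitz homeomorphism whose (absolute) Jacobian satisfies $$\mathrm{Jac}_H(\xi)=\frac{V(\mathbb B)}{V(\Omega)}\,R(\xi)^d\qquad\text{for almost every }\xi\in\mathbb S .$$ Extend $R$ and $H$ to $\mathbb R^d\setminus\{0\}$ by $R(r\xi)=R(\xi)$, $H(r\xi)=H(\xi)$ for $r>0$, and put $$G_0=\frac{\frac1{|\mathbb S|}\int_{\mathbb S}\big[R^{d-2}+|\nabla R|^2R^{d-4}\big]\,dS}{\big(\frac1{|\mathbb S|}\int_{\mathbb S}R^d\,dS\big)^{(d-2)/d}},\qquad G_1=\frac{\frac1{|\mathbb S|}\int_{\mathbb S}\frac{\|DH\|_{HS}^2}{d-1}R^{d-2}\,dS}{\big(\frac1{|\mathbb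 S|}\int_{\mathbb S}R^d\,dS\big)^{(d-2)/d}},$$ where $\|\cdot\|_{HS}$ is the Hilbert--Schmidt norm, and $G(\alpha;\Omega)=(1-\alpha)G_0+\alpha G_1$. Let $\lambda_1\le\lambda_2\le\cdots$ and $\mu_1\le\mu_2\le\cdots$ be the Dirichlet and the Neumann eigenvalues of $-\Delta$, counted with multiplicity (in the weak sense, on $H^1_0$ and $H^1$ respectively). Let $u_1^D,u_2^D,\dots$ be $L^2(\mathbb B)$-orthonormal Dirichlet eigenfunctions of $\mathbb B$ corresponding to $\lambda_1(\mathbb B),\lambda_2(\mathbb B),\dots$, let $u_1^N,u_2^N,\dots$ be $L^2(\mathbb B)$-orthonormal Neumann eigenfunctions of $\mathbb B$ corresponding to $\mu_1(\mathbb B),\mu_2(\mathbb B),\dots$, and let $$\alpha_j^{D}=1-\frac{\int_{\mathbb B}(\partial u_j^{D}/\partial s)^2\,dx}{\int_{\mathbb B}|\nabla u_j^{D}|^2\,dx}\quad(j\ge1),\qquad \alpha_j^{N}=1-\frac{\int_{\mathbb B}(\partial u_j^{N}/\partial s)^2\,dx}{\int_{\mathbb B}|\nabla u_j^{N}|^2\,dx}\quad(j\ge2)$$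 be their angular energy fractions, where $s=|x|$ is the radial variable. Then $$\sum_{j=1}^n\lambda_j(\Omega)V(\Omega)^{2/d}\le\sum_{j=1}^n\lambda_j(\mathbb B)V(\mathbb B)^{2/d}\,G(\alpha_j^D;\Omega)\qquad(n\ge1),$$ $$\sum_{j=2}^n\mu_j(\Omega)V(\Omega)^{2/d}\le\sum_{j=2}^n\mu_j(\mathbb B)V(\mathbb B)^{2/d}\,G(\alpha_j^N;\Omega)\qquad(n\ge2).$$ -/

import Mathlib

open MeasureTheory
open scoped ContDiff

noncomputable section

namespace StarEig

/-- Euclidean space `ℝ^d`. -/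
abbrev Euc (d : ℕ) := EuclideanSpace ℝ (Fin d)

/-- The unit sphere of `ℝ^d`. -/
abbrev Sph (d : ℕ) := Metric.sphere (0 : Euc d) 1

/-- Surface measure on the unit sphere. -/
abbrev surf (d : ℕ) : Measure (Sph d) := (volume : Measure (Euc d)).toSphere

/-- The open unit ball of `ℝ^d`. -/
abbrev unitBall (d : ℕ) : Set (Euc d) := Metric.ball 0 1

/-! ### Starlike domains and boundary homeomorphisms -/

/-- The starlike domain `{r ξ : ξ ∈ S, 0 ≤ r < R(ξ)}` with radius function `R`. -/
def starDomain {d : ℕ} (R : Sph d → ℝ) : Set (Euc d) :=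
  {x | ∃ ξ : Sph d, ∃ r : ℝ, 0 ≤ r ∧ r < R ξ ∧ x = r • (ξ : Euc d)}

/-- Extension of a function on the sphere to `ℝ^d ∖ {0}`, constant along rays
(with the dummy value `0` at the origin). -/
def homExt {d : ℕ} {F : Type*} [Zero F] (f : Sph d → F) (x : Euc d) : F :=
  if hx : x = 0 then 0
  else f ⟨‖x‖⁻¹ • x, by
    rw [mem_sphere_zero_iff_norm, norm_smul, norm_inv, norm_norm,
      inv_mul_cancel₀ (norm_ne_zero_iff.mpr hx)]⟩

/-- The gradient `∇R(ξ)` of the extended radius function. -/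
def gradR {d : ℕ} (R : Sph d → ℝ) (ξ : Sph d) : Euc d :=
  gradient (homExt R) (ξ : Euc d)

/-- The derivative `DH(ξ)` of the extended self-map `H` of the sphere. -/
def derivH {d : ℕ} (H : Sph d → Sph d) (ξ : Sph d) : Euc d →L[ℝ] Euc d :=
  fderiv ℝ (homExt (fun η => (H η : Euc d))) (ξ : Euc d)

/-- `‖DH(ξ)‖²_HS`, the sum of the squares of the entries of the derivative matrix. -/
def hsNormSq {d : ℕ} (H : Sph d → Sph d) (ξ : Sph d) : ℝ :=
  ∑ i : Fin d, ∑ k : Fin d, (derivH H ξ (EuclideanSpace.single k 1) i) ^ 2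

/-- The (absolute) Jacobian of `H : S → S` at `ξ`. The map `DH(ξ)` kills `ξ` and sends the
tangent space `ξ^⊥` into the tangent space `H(ξ)^⊥`; adding the rank-one map `y ↦ ⟨ξ, y⟩ H(ξ)`,
which sends the unit normal `ξ` to the unit normal `H(ξ)`, gives an endomorphism of `ℝ^d` whose
absolute determinant is that of the tangential derivative `ξ^⊥ → H(ξ)^⊥`. -/
def sphereJac {d : ℕ} (H : Sph d → Sph d) (ξ : Sph d) : ℝ :=
  |(derivH H ξ + (innerSL ℝ (ξ : Euc d)).smulRight (H ξ : Euc d)).det|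

/-- `H` is a bi-Lipschitz homeomorphism of the sphere with
`Jac_H(ξ) = (V(B) / V(Ω)) R(ξ)^d` for almost every `ξ`. -/
structure IsBoundaryHomeo {d : ℕ} (R : Sph d → ℝ) (H : Sph d ≃ₜ Sph d) : Prop where
  lipschitz : ∃ K, LipschitzWith K H
  lipschitz_symm : ∃ K, LipschitzWith K H.symm
  jac : ∀ᵐ ξ ∂(surf d), sphereJac H ξ =
    volume.real (unitBall d) / volume.real (starDomain R) * R ξ ^ d

/-! ### Geometric factors -/

/-- The common denominator of the geometric factors. -/
def denomG {d : ℕ} (R : Sph d → ℝ) : ℝ :=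
  (⨍ ξ, R ξ ^ d ∂(surf d)) ^ (((d : ℝ) - 2) / (d : ℝ))

/-- The geometric factor `G₀(Ω)`. -/
def G0 {d : ℕ} (R : Sph d → ℝ) : ℝ :=
  (⨍ ξ, (R ξ ^ ((d : ℤ) - 2) + ‖gradR R ξ‖ ^ 2 * R ξ ^ ((d : ℤ) - 4)) ∂(surf d)) / denomG R

/-- The geometric factor `G₁(Ω)`, which depends on the choice of `H`. -/
def G1 {d : ℕ} (R : Sph d → ℝ) (H : Sph d → Sph d) : ℝ :=
  (⨍ ξ, (hsNormSq H ξ / ((d : ℝ) - 1) * R ξ ^ ((d : ℤ) - 2)) ∂(surf d)) / denomG R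

/-- `G(α; Ω) = (1 - α) G₀(Ω) + α G₁(Ω)`. -/
def Gmix {d : ℕ} (R : Sph d → ℝ) (H : Sph d → Sph d) (α : ℝ) : ℝ :=
  (1 - α) * G0 R + α * G1 R H

/-! ### Sobolev spaces and eigenvalues -/

/-- Real-valued `L²(Ω)`. -/
abbrev L2 {d : ℕ} (Ω : Set (Euc d)) := Lp ℝ 2 (volume.restrict Ω)

/-- Vector fields in `L²(Ω; ℝ^d)`. -/
abbrev L2vec {d : ℕ} (Ω : Set (Euc d)) := Lp (Euc d) 2 (volume.restrict Ω)

/-- Test functions `φ ∈ C_c^∞(Ω)`. -/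
def IsTest {d : ℕ} (Ω : Set (Euc d)) (φ : Euc d → ℝ) : Prop :=
  ContDiff ℝ ∞ φ ∧ HasCompactSupport φ ∧ tsupport φ ⊆ Ω

/-- `H¹(Ω)`: the pairs `(u, g)` of `u ∈ L²(Ω)` with its weak gradient `g ∈ L²(Ω; ℝ^d)`. -/
def H1 {d : ℕ} (Ω : Set (Euc d)) : Set (L2 Ω × L2vec Ω) :=
  {p | ∀ φ, IsTest Ω φ → ∀ e : Euc d,
    ∫ x in Ω, p.1 x * fderiv ℝ φ x e = - ∫ x in Ω, inner ℝ (p.2 x) e * φ x}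

/-- `H¹₀(Ω)`: the closure of `C_c^∞(Ω)` in the `H¹`-norm, again as pairs `(u, ∇u)`. -/
def H10 {d : ℕ} (Ω : Set (Euc d)) : Set (L2 Ω × L2vec Ω) :=
  closure {p | ∃ φ, IsTest Ω φ ∧ p.1 =ᵐ[volume.restrict Ω] φ ∧
    p.2 =ᵐ[volume.restrict Ω] gradient φ}

/-- `u`, with weak gradient `g`, satisfies `-Δu = c u` weakly, with the boundary condition encoded
by the form domain `D` (`H10 Ω` for Dirichlet, `H1 Ω` for Neumann):
`(u, ∇u) ∈ D` and `∫ ∇u · ∇v = c ∫ u v` for all `(v, ∇v) ∈ D`. -/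
def IsWeakEigen {d : ℕ} {Ω : Set (Euc d)} (D : Set (L2 Ω × L2vec Ω)) (c : ℝ)
    (u : L2 Ω) (g : L2vec Ω) : Prop :=
  (u, g) ∈ D ∧ ∀ p ∈ D, inner ℝ g p.2 = c * inner ℝ u p.1

/-- The `j`-th eigenvalue (`j ≥ 1`) in increasing order, counted with multiplicity: the least `t`
such that there are `j` orthonormal eigenfunctions with eigenvalues at most `t`. -/
def eigenvalue {d : ℕ} {Ω : Set (Euc d)} (D : Set (L2 Ω × L2vec Ω)) (j : ℕ) : ℝ :=
  sInf {t | ∃ w : Fin j → L2 Ω, Orthonormal ℝ w ∧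
    ∀ i, ∃ c ≤ t, ∃ g : L2vec Ω, IsWeakEigen D c (w i) g}

/-- The Dirichlet eigenvalues `λ₁(Ω) ≤ λ₂(Ω) ≤ …`. -/
def dirichletEigenvalue {d : ℕ} (Ω : Set (Euc d)) (j : ℕ) : ℝ := eigenvalue (H10 Ω) j

/-- The Neumann eigenvalues `μ₁(Ω) ≤ μ₂(Ω) ≤ …`. -/
def neumannEigenvalue {d : ℕ} (Ω : Set (Euc d)) (j : ℕ) : ℝ := eigenvalue (H1 Ω) j

/-- `u₁, u₂, …` (with weak gradients `g₁, g₂, …`) are orthonormal eigenfunctions corresponding to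
the eigenvalues number `1, 2, …`; the index `0` is not used. -/
structure IsEigenSeq {d : ℕ} {Ω : Set (Euc d)} (D : Set (L2 Ω × L2vec Ω))
    (u : ℕ → L2 Ω) (g : ℕ → L2vec Ω) : Prop where
  orthonormal : Orthonormal ℝ (fun j : Set.Ici 1 => u j)
  eigen : ∀ j, 1 ≤ j → IsWeakEigen D (eigenvalue D j) (u j) (g j)

/-- The radial energy fraction `∫ (∂u/∂s)² / ∫ |∇u|²` of a function with gradient `g`, where
`∂u/∂s = ∇u · x/|x|`. -/
def radialFraction {d : ℕ} {Ω : Set (Euc d)} (g : L2vec Ω) : ℝ :=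
  (∫ x in Ω, (inner ℝ (g x) (‖x‖⁻¹ • x)) ^ 2) / ∫ x in Ω, ‖g x‖ ^ 2

/-- The angular energy fraction `α = 1 - ε`, where `ε` is the radial energy fraction. -/
def angularFraction {d : ℕ} {Ω : Set (Euc d)} (g : L2vec Ω) : ℝ := 1 - radialFraction g

end StarEig

end

/-! The domain Ω is sent to the ball by the homogeneous map F(rξ) = (r / R(ξ)) H(ξ) (`starMap`).
Almost everywhere its derivative is 1/R times the derivative of H, completed by ξ ↦ H(ξ) on normals,
composed with a shear coming from ∇R. The shear has determinant one, so |det DF| = Jac_H / R^d, and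
the condition on H says exactly that this is the constant V(B)/V(Ω) (`abs_det_starDeriv`,
`isBiLip_starMap`). Hence for every orthogonal U the transplants u_j ∘ U⁻¹ ∘ F are orthogonal in
L²(Ω) with common squared norm q = V(Ω)/V(B). They lie in the form domain of Ω, so Rayleigh's
principle for sums gives q ∑ λ_j(Ω) ≤ ∑ ∫_Ω |∇(u_j ∘ U⁻¹ ∘ F)|² (`sum_eigenvalue_le`).

The right side is averaged over U with respect to Haar measure. At a point of radius s in direction
η, the mean of ⟨U g(U⁻¹ ·), z⟩² is a quadratic form in z invariant under the stabilizer of η; it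
therefore has one radial and one tangential coefficient, both depending only on s (`rotQuad_eq`,
`lintegral_rotField`). The adjoint of DF multiplies the radial part by (1 + |∇R|²/R²)/R² and the
tangential part by a multiple of ‖DH‖²/R². Polar integration supplies a further R^d and separates
angle from radius (`lintegral_starDomain_ball`), so the mean energy of the j-th transplant is λ_j(B)
G(α_j) q^((d-2)/d) (`lintegral_energy_eq`). A single U does at least as well as the mean for the
whole sum. Dividing by q^((d-2)/d) leaves q^(2/d), which is the volume normalization.

Eigenvalues are infima over families of actual eigenfunctions, so enough eigenfunctions of Ω must be
shown to exist. They come from successive minimization of the Rayleigh quotient (`exists_isMinSeq`),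
which needs the compactness of H¹(Ω) → L²(Ω). That is proved on the ball by Poincaré inequalities on
a fine convex grid (`compactFst_H1_ball`) and carried to Ω by F (`IsBiLip.compactFst_H1`). For the
Neumann sum the comparison is run from j = 1; the first term vanishes for the ball and is
nonnegative for Ω. -/

open MeasureTheory
open scoped ContDiff

noncomputable section

namespace StarEig

open Filter Topology
open scoped ENNReal NNReal Convolution

/-! ### Abstract Rayleigh quotients on a product of Hilbert spaces: minimizers and sums -/

section Variational

variable {E F : Type*} [NormedAddCommGroup E] [NormedAddCommGroup F]

/-- Bounded sequences in `D` have subsequences whose first components converge. -/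
def CompactFst (D : Set (E × F)) : Prop :=
  ∀ (C : ℝ) (p : ℕ → E × F), (∀ k, p k ∈ D) → (∀ k, ‖p k‖ ≤ C) →
    ∃ φ : ℕ → ℕ, StrictMono φ ∧ ∃ w, Tendsto (fun k => (p (φ k)).1) atTop (𝓝 w)

theorem CompactFst.mono {D D' : Set (E × F)} (h : CompactFst D') (hD : D ⊆ D') : CompactFst D :=
  fun C p hp hb => h C p (fun k => hD (hp k)) hb

variable [InnerProductSpace ℝ E] [InnerProductSpace ℝ F]

/-- The Rayleigh quotient `‖p.2‖² / ‖p.1‖²` attains its minimum on a closed subspace with compact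
first projection. -/
theorem exists_minimizer [CompleteSpace F] (M : Submodule ℝ (E × F))
    (hM : IsClosed (M : Set (E × F))) (hc : CompactFst (M : Set (E × F)))
    (hne : ∃ p ∈ M, p.1 ≠ 0) :
    ∃ p ∈ M, ‖p.1‖ = 1 ∧ ∀ q ∈ M, ‖p.2‖ ^ 2 * ‖q.1‖ ^ 2 ≤ ‖q.2‖ ^ 2 := by
  set S : Set ℝ := {x | ∃ q ∈ M, ‖q.1‖ = 1 ∧ x = ‖q.2‖ ^ 2} with hS
  have hbdd : BddBelow S := ⟨0, by rintro x ⟨q, -, -, rfl⟩; positivity⟩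
  have hscale : ∀ q ∈ M, q.1 ≠ 0 →
      ‖q.1‖⁻¹ • q ∈ M ∧ ‖(‖q.1‖⁻¹ • q).1‖ = 1 := by
    intro q hq h0
    refine ⟨M.smul_mem _ hq, ?_⟩
    simp [norm_smul, inv_mul_cancel₀ (norm_ne_zero_iff.mpr h0)]
  have hSne : S.Nonempty := by
    obtain ⟨p, hp, hp0⟩ := hne
    exact ⟨_, _, (hscale p hp hp0).1, (hscale p hp hp0).2, rfl⟩
  set c := sInf S with hcdef
  have hc0 : 0 ≤ c := Real.sInf_nonneg (by rintro x ⟨q, -, -, rfl⟩; positivity)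
  have hmin : ∀ q ∈ M, c * ‖q.1‖ ^ 2 ≤ ‖q.2‖ ^ 2 := by
    intro q hq
    by_cases h0 : q.1 = 0
    · simp [h0]
    · have h1 : c ≤ ‖(‖q.1‖⁻¹ • q).2‖ ^ 2 :=
        csInf_le hbdd ⟨_, (hscale q hq h0).1, (hscale q hq h0).2, rfl⟩
      have hpos : 0 < ‖q.1‖ := norm_pos_iff.mpr h0
      rw [Prod.smul_snd, norm_smul, norm_inv, norm_norm, mul_pow, inv_pow,
        inv_mul_eq_div, le_div_iff₀ (by positivity)] at h1
      exact h1
  obtain ⟨x, -, hxlim, hxS⟩ := exists_seq_tendsto_sInf hSne hbdd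
  choose p hpM hp1 hp2 using hxS
  obtain ⟨B, hB⟩ := hxlim.bddAbove_range
  have hB' : ∀ k, x k ≤ B := fun k => hB ⟨k, rfl⟩
  have hbound : ∀ k, ‖p k‖ ≤ B + 1 := by
    intro k
    have h1 := hB' k
    rw [hp2 k] at h1
    rw [Prod.norm_def, hp1 k]
    refine max_le ?_ ?_
    · nlinarith [sq_nonneg ‖(p k).2‖]
    · nlinarith [sq_nonneg (‖(p k).2‖ - 1), sq_nonneg ‖(p k).2‖]
  obtain ⟨φ, hφ, w, hw⟩ := hc (B + 1) p hpM hbound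
  have hxφ : Tendsto (fun k => x (φ k)) atTop (𝓝 c) := hxlim.comp hφ.tendsto_atTop
  -- Compactness controls only the first components. The parallelogram law, with the lower bound
  -- `hmin` applied to the sum of two members of the minimizing sequence, upgrades this to the
  -- Cauchy property of the second components.
  have hkey : ∀ m k, ‖(p (φ m)).2 - (p (φ k)).2‖ ^ 2 ≤
      2 * (x (φ m) - c) + 2 * (x (φ k) - c) + c * ‖(p (φ m)).1 - (p (φ k)).1‖ ^ 2 := by
    intro m k
    have h1 := hmin (p (φ m) + p (φ k)) (M.add_mem (hpM _) (hpM _))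
    have h2 := parallelogram_law_with_norm ℝ (p (φ m)).2 (p (φ k)).2
    have h3 := parallelogram_law_with_norm ℝ (p (φ m)).1 (p (φ k)).1
    rw [hp1, hp1] at h3
    rw [Prod.fst_add, Prod.snd_add] at h1
    rw [hp2 (φ m), hp2 (φ k)]
    nlinarith
  have hcau : CauchySeq (fun k => (p (φ k)).2) := by
    rw [Metric.cauchySeq_iff]
    intro ε hε
    -- The tolerance uses `c + 1` because `c` may be zero. Together with `ε ^ 2 / 16` below, the
    -- three terms of `hkey` add up to at most `ε ^ 2 / 2`.
    have hu := Metric.cauchySeq_iff.mp hw.cauchySeq (ε / (2 * (c + 1))) (by positivity)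
    obtain ⟨N1, hN1⟩ := hu
    obtain ⟨N2, hN2⟩ := Metric.tendsto_atTop.mp hxφ (ε ^ 2 / 16) (by positivity)
    refine ⟨max N1 N2, fun m hm k hk => ?_⟩
    have h1 := hN1 m (le_trans (le_max_left _ _) hm) k (le_trans (le_max_left _ _) hk)
    have h2 := (abs_lt.mp (hN2 m (le_trans (le_max_right _ _) hm))).2
    have h3 := (abs_lt.mp (hN2 k (le_trans (le_max_right _ _) hk))).2
    rw [dist_eq_norm] at h1 ⊢
    have h4 := hkey m k
    have h5 : c * ‖(p (φ m)).1 - (p (φ k)).1‖ ^ 2 ≤ ε ^ 2 / 4 := by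
      have h6 : ‖(p (φ m)).1 - (p (φ k)).1‖ ^ 2 ≤ (ε / (2 * (c + 1))) ^ 2 := by gcongr
      calc c * ‖(p (φ m)).1 - (p (φ k)).1‖ ^ 2 ≤ c * (ε / (2 * (c + 1))) ^ 2 := by gcongr
        _ = ε ^ 2 / 4 * (c / (c + 1) ^ 2) := by field_simp; ring
        _ ≤ ε ^ 2 / 4 * 1 := by
            gcongr
            rw [div_le_one (by positivity)]
            nlinarith
        _ = _ := by ring
    refine lt_of_pow_lt_pow_left₀ 2 hε.le ?_
    nlinarith
  obtain ⟨h, hh⟩ := cauchySeq_tendsto_of_complete hcau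
  have hlim : Tendsto (fun k => p (φ k)) atTop (𝓝 (w, h)) := hw.prodMk_nhds hh
  have hwh : (w, h) ∈ M := hM.mem_of_tendsto hlim (Eventually.of_forall fun k => hpM _)
  have hw1 : ‖w‖ = 1 := by
    refine tendsto_nhds_unique hw.norm ?_
    simp [hp1]
  have hh2 : ‖h‖ ^ 2 = c := by
    refine tendsto_nhds_unique (hh.norm.pow 2) ?_
    simpa only [← hp2] using hxφ
  exact ⟨(w, h), hwh, hw1, fun q hq => by rw [hh2]; exact hmin q hq⟩

/-- Abstract weak eigenpair of the form `⟨p.2, q.2⟩` relative to `⟨p.1, q.1⟩`. -/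
def IsFormEigen (D : Set (E × F)) (c : ℝ) (p : E × F) : Prop :=
  p ∈ D ∧ ∀ q ∈ D, inner ℝ p.2 q.2 = c * inner ℝ p.1 q.1

/-- A minimizer of the Rayleigh quotient is stationary. -/
theorem stationary_of_minimizer (M : Submodule ℝ (E × F)) {p : E × F} (hp : p ∈ M)
    (hp1 : ‖p.1‖ = 1) (hmin : ∀ q ∈ M, ‖p.2‖ ^ 2 * ‖q.1‖ ^ 2 ≤ ‖q.2‖ ^ 2) {q : E × F}
    (hq : q ∈ M) : inner ℝ p.2 q.2 = ‖p.2‖ ^ 2 * inner ℝ p.1 q.1 := by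
  set c := ‖p.2‖ ^ 2
  set b := inner ℝ p.2 q.2 - c * inner ℝ p.1 q.1
  set a := ‖q.2‖ ^ 2 - c * ‖q.1‖ ^ 2
  have ha : 0 ≤ a := sub_nonneg.mpr (hmin q hq)
  -- Minimality along the line `p + t • q`; the constant term cancels since `‖p.1‖ = 1`.
  have hpoly : ∀ t : ℝ, 0 ≤ 2 * t * b + t ^ 2 * a := by
    intro t
    have h := hmin (p + t • q) (M.add_mem hp (M.smul_mem t hq))
    rw [Prod.fst_add, Prod.snd_add, Prod.smul_fst, Prod.smul_snd, norm_add_sq_real,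
      norm_add_sq_real, inner_smul_right, inner_smul_right, norm_smul, norm_smul, hp1,
      mul_pow, mul_pow, Real.norm_eq_abs, sq_abs] at h
    have hcc : ‖p.2‖ ^ 2 = c := rfl
    simp only [hcc] at h
    simp only [a, b]
    nlinarith
  suffices hb : b = 0 from sub_eq_zero.mp hb
  by_contra hb
  -- Nearly the minimum of the quadratic; `a + 1` keeps the denominator positive when `a = 0`.
  have h := hpoly (-b / (a + 1))
  have h2 : 2 * (-b / (a + 1)) * b + (-b / (a + 1)) ^ 2 * a =
      -(b ^ 2 * (a + 2) / (a + 1) ^ 2) := by field_simp; ring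
  rw [h2] at h
  have : 0 < b ^ 2 * (a + 2) / (a + 1) ^ 2 := by positivity
  linarith

/-- The elements of `D` whose first components are orthogonal to `w 0, …, w (m - 1)`. -/
def orthSub (D : Submodule ℝ (E × F)) (w : ℕ → E × F) (m : ℕ) : Submodule ℝ (E × F) where
  carrier := {p | p ∈ D ∧ ∀ j < m, inner ℝ (w j).1 p.1 = 0}
  add_mem' := by
    rintro a b ⟨ha, ha'⟩ ⟨hb, hb'⟩
    exact ⟨D.add_mem ha hb, fun j hj => by simp [inner_add_right, ha' j hj, hb' j hj]⟩
  zero_mem' := ⟨D.zero_mem, fun j _ => by simp⟩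
  smul_mem' := by
    rintro t a ⟨ha, ha'⟩
    exact ⟨D.smul_mem t ha, fun j hj => by simp [inner_smul_right, ha' j hj]⟩

theorem mem_orthSub {D : Submodule ℝ (E × F)} {w : ℕ → E × F} {m : ℕ} {p : E × F} :
    p ∈ orthSub D w m ↔ p ∈ D ∧ ∀ j < m, inner ℝ (w j).1 p.1 = 0 := Iff.rfl

theorem isClosed_orthSub {D : Submodule ℝ (E × F)} (hD : IsClosed (D : Set (E × F)))
    (w : ℕ → E × F) (m : ℕ) : IsClosed (orthSub D w m : Set (E × F)) := by
  have : (orthSub D w m : Set (E × F)) =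
      (D : Set (E × F)) ∩ ⋂ j, ⋂ (_ : j < m), {p | inner ℝ (w j).1 p.1 = 0} := by
    ext p; simp [mem_orthSub]
  rw [this]
  refine hD.inter (isClosed_iInter fun j => isClosed_iInter fun _ => ?_)
  exact isClosed_eq (by fun_prop) continuous_const

/-- The removal of the components along the first `m` members of an orthonormal family. -/
def orthPart (w : ℕ → E × F) (m : ℕ) (q : E × F) : E × F :=
  q - ∑ j ∈ Finset.range m, (inner ℝ (w j).1 q.1 : ℝ) • w j

/-- The first `m` steps of successive minimization of the Rayleigh quotient. -/
structure IsMinSeq (D : Submodule ℝ (E × F)) (w : ℕ → E × F) (m : ℕ) : Prop where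
  mem : ∀ i < m, w i ∈ orthSub D w i
  norm : ∀ i < m, ‖(w i).1‖ = 1
  le : ∀ i < m, ∀ q ∈ orthSub D w i, ‖(w i).2‖ ^ 2 * ‖q.1‖ ^ 2 ≤ ‖q.2‖ ^ 2
  eigen : ∀ i < m, IsFormEigen (D : Set (E × F)) (‖(w i).2‖ ^ 2) (w i)

theorem IsMinSeq.inner_eq {D : Submodule ℝ (E × F)} {w : ℕ → E × F} {m : ℕ}
    (h : IsMinSeq D w m) {i j : ℕ} (hi : i < m) (hj : j < m) :
    inner ℝ (w i).1 (w j).1 = if i = j then (1 : ℝ) else 0 := by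
  rcases lt_trichotomy i j with hij | rfl | hij
  · rw [if_neg hij.ne]; exact (h.mem j hj).2 i hij
  · rw [if_pos rfl, real_inner_self_eq_norm_sq, h.norm i hi, one_pow]
  · rw [if_neg hij.ne', real_inner_comm]; exact (h.mem i hi).2 j hij

theorem IsMinSeq.orthPart_mem {D : Submodule ℝ (E × F)} {w : ℕ → E × F} {m : ℕ}
    (h : IsMinSeq D w m) {q : E × F} (hq : q ∈ D) : orthPart w m q ∈ orthSub D w m := by
  refine ⟨D.sub_mem hq (D.sum_mem fun j hj => D.smul_mem _ (h.mem j (Finset.mem_range.mp hj)).1),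
    fun i hi => ?_⟩
  rw [orthPart, Prod.fst_sub, Prod.fst_sum, inner_sub_right, inner_sum]
  have : ∀ j ∈ Finset.range m, inner ℝ (w i).1 ((inner ℝ (w j).1 q.1 : ℝ) • w j).1 =
      if i = j then (inner ℝ (w i).1 q.1 : ℝ) else 0 := by
    intro j hj
    rw [Prod.smul_fst, inner_smul_right, h.inner_eq hi (Finset.mem_range.mp hj)]
    split_ifs with hij
    · rw [hij, mul_one]
    · rw [mul_zero]
  rw [Finset.sum_congr rfl this]
  simp [hi]

/-- Successive minimization can be continued as long as there are enough linearly independent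
first components. -/
theorem exists_isMinSeq [CompleteSpace F] (D : Submodule ℝ (E × F))
    (hD : IsClosed (D : Set (E × F))) (hc : CompactFst (D : Set (E × F))) {N : ℕ}
    (f : Fin N → E × F) (hf : ∀ i, f i ∈ D) (hon : Orthonormal ℝ fun i => (f i).1) :
    ∀ m ≤ N, ∃ w, IsMinSeq D w m := by
  intro m
  induction m with
  | zero =>
    intro _
    exact ⟨fun _ => 0, ⟨fun i hi => absurd hi (by simp), fun i hi => absurd hi (by simp),
      fun i hi => absurd hi (by simp), fun i hi => absurd hi (by simp)⟩⟩
  | succ m ih =>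
    intro hm
    obtain ⟨w, hw⟩ := ih (by omega)
    have hne : ∃ p ∈ orthSub D w m, p.1 ≠ 0 := by
      -- The `m` orthogonality conditions on `N > m` coefficients have a nonzero solution. The trial
      -- family thus supplies a nonzero competitor, and no infinite-dimensionality of `D` is needed.
      let T : (Fin N → ℝ) →ₗ[ℝ] (Fin m → ℝ) :=
        LinearMap.pi fun j => (innerSL ℝ (w j).1).toLinearMap ∘ₗ
          Fintype.linearCombination ℝ (fun i => (f i).1)
      have hker : LinearMap.ker T ≠ ⊥ := LinearMap.ker_ne_bot_of_finrank_lt (by simpa using hm)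
      obtain ⟨a, ha, ha0⟩ := Submodule.exists_mem_ne_zero_of_ne_bot hker
      refine ⟨∑ i, a i • f i, ⟨D.sum_mem fun i _ => D.smul_mem _ (hf i), fun j hj => ?_⟩, ?_⟩
      · have := congrFun (LinearMap.mem_ker.mp ha) ⟨j, hj⟩
        simpa [T, Fintype.linearCombination_apply, Prod.fst_sum] using this
      · intro h0
        apply ha0
        have := Fintype.linearIndependent_iff.mp hon.linearIndependent a
          (by simpa [Prod.fst_sum] using h0)
        exact funext this
    obtain ⟨p, hpM, hp1, hmin⟩ := exists_minimizer (orthSub D w m) (isClosed_orthSub hD w m)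
      (hc.mono fun q hq => hq.1) hne
    -- Stationarity is known only against vectors orthogonal to the earlier minimizers. It extends
    -- to all of `D` because each earlier `w j` is itself an eigenvector, so its form product with
    -- `p` is a multiple of the vanishing inner product of first components.
    have heig : IsFormEigen (D : Set (E × F)) (‖p.2‖ ^ 2) p := by
      refine ⟨hpM.1, fun q hq => ?_⟩
      have h1 := stationary_of_minimizer _ hpM hp1 hmin (hw.orthPart_mem hq)
      have h2 : ∀ j ∈ Finset.range m, inner ℝ p.1 ((inner ℝ (w j).1 q.1 : ℝ) • w j).1 = 0 := by
        intro j hj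
        rw [Prod.smul_fst, inner_smul_right, real_inner_comm (w j).1,
          hpM.2 j (Finset.mem_range.mp hj), mul_zero]
      have h3 : ∀ j ∈ Finset.range m, inner ℝ p.2 ((inner ℝ (w j).1 q.1 : ℝ) • w j).2 = 0 := by
        intro j hj
        have hj' := Finset.mem_range.mp hj
        rw [Prod.smul_snd, inner_smul_right, real_inner_comm (w j).2,
          (hw.eigen j hj').2 p hpM.1, hpM.2 j hj', mul_zero, mul_zero]
      rw [orthPart, Prod.fst_sub, Prod.fst_sum, Prod.snd_sub, Prod.snd_sum, inner_sub_right,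
        inner_sub_right, inner_sum, inner_sum, Finset.sum_eq_zero h2, Finset.sum_eq_zero h3,
        sub_zero, sub_zero] at h1
      exact h1
    have hupd : ∀ i < m, Function.update w m p i = w i := fun i hi =>
      Function.update_of_ne hi.ne _ _
    have hself : Function.update w m p m = p := Function.update_self _ _ _
    -- Only entries with index below `i` enter `orthSub D w i`, so changing entry `m` is harmless
    -- for `i ≤ m`.
    have horth : ∀ i ≤ m, orthSub D (Function.update w m p) i = orthSub D w i := by
      intro i hi
      ext q
      simp only [mem_orthSub]
      refine and_congr_right fun _ => forall₂_congr fun j hj => ?_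
      rw [hupd j (by omega)]
    refine ⟨Function.update w m p, ⟨fun i hi => ?_, fun i hi => ?_, fun i hi => ?_,
      fun i hi => ?_⟩⟩ <;> rcases Nat.lt_succ_iff_lt_or_eq.mp hi with hi' | rfl
    · rw [horth i hi'.le, hupd i hi']; exact hw.mem i hi'
    · rw [horth i le_rfl, hself]; exact hpM
    · rw [hupd i hi']; exact hw.norm i hi'
    · rw [hself]; exact hp1
    · rw [horth i hi'.le, hupd i hi']; exact hw.le i hi'
    · rw [horth i le_rfl, hself]; exact hmin
    · rw [hupd i hi']; exact hw.eigen i hi'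
    · rw [hself]; exact heig

/-- The sum of the first minimization values is at most the sum of the energies of any orthonormal
trial family. -/
theorem IsMinSeq.sum_le {D : Submodule ℝ (E × F)} {w : ℕ → E × F} {n : ℕ}
    (h : IsMinSeq D w n) (f : Fin n → E × F) (hf : ∀ i, f i ∈ D)
    (hon : Orthonormal ℝ fun i => (f i).1) :
    ∑ i ∈ Finset.range n, ‖(w i).2‖ ^ 2 ≤ ∑ i, ‖(f i).2‖ ^ 2 := by
  -- From here the family has `n + 1` members. Only the first `n` minimizers are split off, so that
  -- the last minimum `c n` bounds the energy of every remainder from below.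
  rcases n with _ | n
  · simp
  have h' : IsMinSeq D w n := ⟨fun i hi => h.mem i (by omega), fun i hi => h.norm i (by omega),
    fun i hi => h.le i (by omega), fun i hi => h.eigen i (by omega)⟩
  set c : ℕ → ℝ := fun i => ‖(w i).2‖ ^ 2
  have hmono : ∀ k < n, c k ≤ c n := by
    intro k hk
    have hmem : w n ∈ orthSub D w k :=
      ⟨(h.mem n (by omega)).1, fun j hj => (h.mem n (by omega)).2 j (by omega)⟩
    have := h.le k (by omega) _ hmem
    rwa [h.norm n (by omega), one_pow, mul_one] at this
  set a : ℕ → Fin (n + 1) → ℝ := fun k j => inner ℝ (w k).1 (f j).1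
  -- Split `f j` into its part `s` in the span of the first `n` minimizers and the remainder `r`.
  -- The eigenvalue equations make the two orthogonal for both forms, so energies add.
  have hone : ∀ j, ∑ k ∈ Finset.range n, c k * a k j ^ 2 +
      c n * (1 - ∑ k ∈ Finset.range n, a k j ^ 2) ≤ ‖(f j).2‖ ^ 2 := by
    intro j
    set r := orthPart w n (f j) with hr
    have hrm : r ∈ orthSub D w n := h'.orthPart_mem (hf j)
    have hf1 : f j = r + ∑ k ∈ Finset.range n, a k j • w k := by simp [hr, orthPart, a]
    set s := ∑ k ∈ Finset.range n, a k j • w k with hs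
    have hsm : s ∈ D := D.sum_mem fun k hk =>
      D.smul_mem _ (h'.mem k (Finset.mem_range.mp hk)).1
    have hs1 : ∀ q ∈ D, inner ℝ s.2 q.2 = ∑ k ∈ Finset.range n, a k j * (c k *
        inner ℝ (w k).1 q.1) := by
      intro q hq
      rw [hs, Prod.snd_sum, sum_inner]
      refine Finset.sum_congr rfl fun k hk => ?_
      rw [Prod.smul_snd, real_inner_smul_left, (h'.eigen k (Finset.mem_range.mp hk)).2 q hq]
    have hs2 : ∀ q : E × F, inner ℝ s.1 q.1 = ∑ k ∈ Finset.range n, a k j *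
        inner ℝ (w k).1 q.1 := by
      intro q
      rw [hs, Prod.fst_sum, sum_inner]
      refine Finset.sum_congr rfl fun k hk => ?_
      rw [Prod.smul_fst, real_inner_smul_left]
    have hws : ∀ k ∈ Finset.range n, inner ℝ (w k).1 s.1 = a k j := by
      intro k hk
      have hk' := Finset.mem_range.mp hk
      have h1 : inner ℝ (w k).1 (f j).1 = a k j := rfl
      rw [hf1, Prod.fst_add, inner_add_right, hrm.2 k hk', zero_add] at h1
      exact h1
    have hsr1 : inner ℝ s.1 r.1 = 0 := by
      rw [hs2]
      exact Finset.sum_eq_zero fun k hk => by rw [hrm.2 k (Finset.mem_range.mp hk), mul_zero]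
    have hsr2 : inner ℝ s.2 r.2 = 0 := by
      rw [hs1 r hrm.1]
      exact Finset.sum_eq_zero fun k hk => by
        rw [hrm.2 k (Finset.mem_range.mp hk), mul_zero, mul_zero]
    have hss1 : ‖s.1‖ ^ 2 = ∑ k ∈ Finset.range n, a k j ^ 2 := by
      rw [← real_inner_self_eq_norm_sq, hs2]
      exact Finset.sum_congr rfl fun k hk => by rw [hws k hk, sq]
    have hss2 : ‖s.2‖ ^ 2 = ∑ k ∈ Finset.range n, c k * a k j ^ 2 := by
      rw [← real_inner_self_eq_norm_sq, hs1 s hsm]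
      exact Finset.sum_congr rfl fun k hk => by rw [hws k hk]; ring
    have hn1 : ‖(f j).1‖ ^ 2 = ‖r.1‖ ^ 2 + ‖s.1‖ ^ 2 := by
      rw [hf1, Prod.fst_add, norm_add_sq_real, real_inner_comm, hsr1]; ring
    have hn2 : ‖(f j).2‖ ^ 2 = ‖r.2‖ ^ 2 + ‖s.2‖ ^ 2 := by
      rw [hf1, Prod.snd_add, norm_add_sq_real, real_inner_comm, hsr2]; ring
    have hfj : ‖(f j).1‖ = 1 := hon.1 j
    rw [hfj, one_pow, hss1] at hn1
    have hmin := h.le n (by omega) r hrm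
    rw [hn2, hss2]
    have : ‖r.1‖ ^ 2 = 1 - ∑ k ∈ Finset.range n, a k j ^ 2 := by linarith
    rw [this] at hmin
    simp only [c] at hmin ⊢
    linarith
  -- Bessel is used with the roles exchanged: `f` is the orthonormal family and `w k` the vector. As
  -- `c k ≤ c n`, lowering the column sums from 1 can only increase the total.
  have hbessel : ∀ k ∈ Finset.range n, ∑ j, a k j ^ 2 ≤ 1 := by
    intro k hk
    have := hon.sum_inner_products_le (x := (w k).1) (s := Finset.univ)
    rw [h'.norm k (Finset.mem_range.mp hk), one_pow] at this
    refine le_trans (le_of_eq (Finset.sum_congr rfl fun j _ => ?_)) this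
    rw [Real.norm_eq_abs, sq_abs, real_inner_comm]
  calc ∑ i ∈ Finset.range (n + 1), c i
      = ∑ k ∈ Finset.range n, c k + c n := Finset.sum_range_succ _ _
    _ ≤ ∑ k ∈ Finset.range n, (c k * ∑ j, a k j ^ 2 + c n * (1 - ∑ j, a k j ^ 2)) + c n := by
        gcongr with k hk
        nlinarith [hbessel k hk, hmono k (Finset.mem_range.mp hk)]
    _ = ∑ j, (∑ k ∈ Finset.range n, c k * a k j ^ 2 +
          c n * (1 - ∑ k ∈ Finset.range n, a k j ^ 2)) := by
        rw [Finset.sum_add_distrib, Finset.sum_add_distrib, ← Finset.mul_sum, ← Finset.mul_sum,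
          Finset.sum_sub_distrib, Finset.sum_sub_distrib, Finset.sum_comm (s := Finset.univ),
          Finset.sum_comm (s := Finset.univ)]
        simp only [Finset.mul_sum, Finset.sum_const, Finset.card_range, Finset.card_univ,
          Fintype.card_fin, nsmul_eq_mul, mul_one]
        push_cast
        ring
    _ ≤ _ := Finset.sum_le_sum fun j _ => hone j

end Variational

/-! ### Eigenvalues of a form domain and Rayleigh's principle for their sums -/

section Eigenvalues

variable {d : ℕ} {Ω : Set (Euc d)}

theorem IsWeakEigen.energy {D : Set (L2 Ω × L2vec Ω)} {c : ℝ} {u : L2 Ω} {g : L2vec Ω}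
    (h : IsWeakEigen D c u g) : ‖g‖ ^ 2 = c * ‖u‖ ^ 2 := by
  have := h.2 _ h.1
  rwa [real_inner_self_eq_norm_sq, real_inner_self_eq_norm_sq] at this

/-- Testing an eigenfunction of unit norm with itself gives `c = ‖g‖ ^ 2`. This bounds below the set
whose infimum is `eigenvalue D j`; for `j = 0` the condition is empty and the set is all of ℝ. -/
theorem eigenvalue_lower_bound {D : Set (L2 Ω × L2vec Ω)} {j : ℕ} (hj : 1 ≤ j) {t : ℝ}
    (ht : ∃ w : Fin j → L2 Ω, Orthonormal ℝ w ∧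
      ∀ i, ∃ c ≤ t, ∃ g : L2vec Ω, IsWeakEigen D c (w i) g) : 0 ≤ t := by
  obtain ⟨w, hw, h⟩ := ht
  obtain ⟨c, hct, g, hg⟩ := h ⟨0, hj⟩
  have h1 := hg.energy
  rw [hw.1, one_pow, mul_one] at h1
  nlinarith [sq_nonneg ‖g‖]

theorem eigenvalue_nonneg {D : Set (L2 Ω × L2vec Ω)} {j : ℕ} (hj : 1 ≤ j) :
    0 ≤ eigenvalue D j :=
  Real.sInf_nonneg fun _ ht => eigenvalue_lower_bound hj ht

theorem eigenvalue_le {D : Set (L2 Ω × L2vec Ω)} {j : ℕ} (hj : 1 ≤ j) {t : ℝ}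
    (ht : ∃ w : Fin j → L2 Ω, Orthonormal ℝ w ∧
      ∀ i, ∃ c ≤ t, ∃ g : L2vec Ω, IsWeakEigen D c (w i) g) : eigenvalue D j ≤ t :=
  csInf_le ⟨0, fun _ hs => eigenvalue_lower_bound hj hs⟩ ht

/-- Rayleigh's principle for sums of eigenvalues. -/
theorem sum_eigenvalue_le (D : Submodule ℝ (L2 Ω × L2vec Ω))
    (hD : IsClosed (D : Set (L2 Ω × L2vec Ω))) (hc : CompactFst (D : Set (L2 Ω × L2vec Ω)))
    (f : ℕ → L2 Ω × L2vec Ω) (hf : ∀ i, 1 ≤ i → f i ∈ D) {m : ℝ} (hm : 0 < m)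
    (hon : ∀ i j, 1 ≤ i → 1 ≤ j → inner ℝ (f i).1 (f j).1 = if i = j then m else 0) (n : ℕ) :
    m * ∑ j ∈ Finset.Icc 1 n, eigenvalue (D : Set (L2 Ω × L2vec Ω)) j ≤
      ∑ j ∈ Finset.Icc 1 n, ‖(f j).2‖ ^ 2 := by
  -- Normalization by `√m`, and passage from indices starting at 1 to indices starting at 0.
  set f' : Fin n → L2 Ω × L2vec Ω := fun i => (√m)⁻¹ • f (i + 1)
  have hf' : ∀ i, f' i ∈ D := fun i => D.smul_mem _ (hf _ (by omega))
  have hon' : Orthonormal ℝ fun i => (f' i).1 := by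
    rw [orthonormal_iff_ite]
    intro i j
    simp only [f', Prod.smul_fst, inner_smul_left, inner_smul_right, Fin.ext_iff]
    rw [hon _ _ (by omega) (by omega)]
    by_cases hij : (i : ℕ) = j
    · simp only [hij, if_true]
      have := Real.mul_self_sqrt hm.le
      have h0 : √m ≠ 0 := (Real.sqrt_pos.mpr hm).ne'
      simp only [conj_trivial]
      field_simp
      nlinarith
    · simp [hij]
  obtain ⟨w, hw⟩ := exists_isMinSeq D hD hc f' hf' hon' n le_rfl
  have hmono : ∀ i j, i ≤ j → j < n → ‖(w i).2‖ ^ 2 ≤ ‖(w j).2‖ ^ 2 := by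
    intro i j hij hj
    have hmem : w j ∈ orthSub D w i :=
      ⟨(hw.mem j hj).1, fun k hk => (hw.mem j hj).2 k (by omega)⟩
    have := hw.le i (by omega) _ hmem
    rwa [hw.norm j hj, one_pow, mul_one] at this
  -- The first `i + 1` minimizers are orthonormal eigenfunctions whose eigenvalues do not exceed the
  -- last of them, which is what the definition of `eigenvalue` asks for.
  have hle : ∀ i < n, eigenvalue (D : Set (L2 Ω × L2vec Ω)) (i + 1) ≤ ‖(w i).2‖ ^ 2 := by
    intro i hi
    refine eigenvalue_le (by omega) ⟨fun k => (w k).1, ?_, fun k =>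
      ⟨_, hmono k i (by omega) hi, (w k).2, hw.eigen k (by omega)⟩⟩
    rw [orthonormal_iff_ite]
    intro k l
    rw [hw.inner_eq (by omega) (by omega)]
    simp [Fin.ext_iff]
  have hsum := hw.sum_le f' hf' hon'
  have hshift : ∀ G : ℕ → ℝ, ∑ j ∈ Finset.Icc 1 n, G j = ∑ i ∈ Finset.range n, G (i + 1) := by
    intro G
    rw [Finset.sum_bij (fun j _ => j - 1)] <;> simp only [Finset.mem_Icc, Finset.mem_range]
    · intros; omega
    · intros; omega
    · intro b hb; exact ⟨b + 1, by omega, by omega⟩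
    · intro j hj; congr 1; omega
  rw [hshift, hshift]
  calc m * ∑ i ∈ Finset.range n, eigenvalue (D : Set (L2 Ω × L2vec Ω)) (i + 1)
      ≤ m * ∑ i ∈ Finset.range n, ‖(w i).2‖ ^ 2 := by
        gcongr with i hi
        exact hle i (Finset.mem_range.mp hi)
    _ ≤ m * ∑ i, ‖(f' i).2‖ ^ 2 := by gcongr
    _ = _ := by
        rw [Finset.mul_sum, ← Fin.sum_univ_eq_sum_range fun i => ‖(f (i + 1)).2‖ ^ 2]
        refine Finset.sum_congr rfl fun i _ => ?_
        simp only [f', Prod.smul_snd, norm_smul, mul_pow, norm_inv, inv_pow]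
        rw [Real.norm_eq_abs, sq_abs, Real.sq_sqrt hm.le]
        field_simp

end Eigenvalues

/-! ### Convergence of mollifications in L² -/

section Mollification

variable {d : ℕ} {V : Type*} [NormedAddCommGroup V]

/-- Jensen's inequality for the square: on a probability space the L¹ norm is at most the L² norm.
-/
theorem sq_lintegral_le {α : Type*} [MeasurableSpace α] (ν : Measure α) [IsProbabilityMeasure ν]
    {h : α → ℝ≥0∞} (hh : AEMeasurable h ν) : (∫⁻ t, h t ∂ν) ^ 2 ≤ ∫⁻ t, h t ^ 2 ∂ν := by
  have := eLpNorm_le_eLpNorm_of_exponent_le (p := 1) (q := 2) (μ := ν) (f := h) (by norm_num)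
    hh.aestronglyMeasurable
  rw [eLpNorm_one_eq_lintegral_enorm,
    eLpNorm_eq_lintegral_rpow_enorm_toReal (by norm_num) (by norm_num)] at this
  simp only [enorm_eq_self, ENNReal.toReal_ofNat, one_div] at this
  calc (∫⁻ t, h t ∂ν) ^ 2 ≤ ((∫⁻ t, h t ^ (2 : ℝ) ∂ν) ^ (2⁻¹ : ℝ)) ^ 2 := by gcongr
    _ = _ := by
      rw [← ENNReal.rpow_natCast, ← ENNReal.rpow_mul]
      simp

theorem eLpNorm_two_sq {α : Type*} [MeasurableSpace α] (μ : Measure α) (f : α → V) :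
    eLpNorm f 2 μ ^ 2 = ∫⁻ x, ‖f x‖ₑ ^ 2 ∂μ := by
  rw [eLpNorm_eq_lintegral_rpow_enorm_toReal (by norm_num) (by norm_num),
    ← ENNReal.rpow_natCast, ← ENNReal.rpow_mul]
  simp

/-- Translation is continuous in `L²`. -/
theorem exists_translate_sub_le {f : Euc d → V} (hf : MemLp f 2 volume) {ε : ℝ≥0∞}
    (hε : ε ≠ 0) :
    ∃ δ > 0, ∀ y : Euc d, ‖y‖ < δ → eLpNorm (fun x => f (x - y) - f x) 2 volume ≤ ε := by
  have : Fact ((2 : ℝ≥0∞) ≠ ⊤) := ⟨by norm_num⟩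
  have hcont : Continuous fun y : Euc d => (DomAddAct.mk (-y)) +ᵥ hf.toLp f :=
    (DomAddAct.continuous_mk.comp continuous_neg).vadd continuous_const
  have h0 := hcont.tendsto 0
  have hball : Metric.eball ((DomAddAct.mk (-(0 : Euc d))) +ᵥ hf.toLp f) ε ∈
      𝓝 ((DomAddAct.mk (-(0 : Euc d))) +ᵥ hf.toLp f) := Metric.eball_mem_nhds _ (pos_iff_ne_zero.mpr hε)
  obtain ⟨δ, hδ, hsub⟩ := Metric.mem_nhds_iff.mp (h0 hball)
  refine ⟨δ, hδ, fun y hy => ?_⟩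
  have h1 := hsub (show y ∈ Metric.ball 0 δ by simpa using hy)
  simp only [Set.mem_preimage, Metric.mem_eball, DomAddAct.mk_vadd_toLp, Lp.edist_toLp_toLp] at h1
  refine le_trans (le_of_eq (congrArg (fun k => eLpNorm k 2 volume) ?_)) h1.le
  funext x
  simp [sub_eq_neg_add]

variable [NormedSpace ℝ V]

/-- Convolution with a normalized bump function. -/
def mollify (ψ : ContDiffBump (0 : Euc d)) (f : Euc d → V) : Euc d → V :=
  ψ.normed volume ⋆[ContinuousLinearMap.lsmul ℝ ℝ, volume] f

theorem convolutionExists_mollify (ψ : ContDiffBump (0 : Euc d)) {f : Euc d → V}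
    (hf : LocallyIntegrable f volume) :
    ConvolutionExists (ψ.normed volume) f (ContinuousLinearMap.lsmul ℝ ℝ) volume :=
  ψ.hasCompactSupport_normed.convolutionExists_left _ ψ.continuous_normed hf

theorem mollify_sub_eq [CompleteSpace V] (ψ : ContDiffBump (0 : Euc d)) {f : Euc d → V}
    (hf : LocallyIntegrable f volume) (x : Euc d) :
    mollify ψ f x - f x = ∫ t, ψ.normed volume t • (f (x - t) - f x) := by
  have h1 : Integrable (fun t => ψ.normed volume t • f (x - t)) volume :=
    convolutionExists_mollify ψ hf x
  have h2 : Integrable (fun t => ψ.normed volume t • f x) volume :=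
    ψ.integrable_normed.smul_const _
  simp only [smul_sub]
  rw [integral_sub h1 h2, ψ.integral_normed_smul]
  rfl

/-- Mollification converges in `L²`. -/
theorem exists_mollify_sub_le [CompleteSpace V] {f : Euc d → V} (hf : MemLp f 2 volume) {ε : ℝ≥0∞}
    (hε : ε ≠ 0) :
    ∃ δ > 0, ∀ ψ : ContDiffBump (0 : Euc d), ψ.rOut ≤ δ →
      eLpNorm (fun x => mollify ψ f x - f x) 2 volume ≤ ε := by
  obtain ⟨δ, hδ, h⟩ := exists_translate_sub_le hf hε
  refine ⟨δ, hδ, fun ψ hψ => ?_⟩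
  set ρ : Euc d → ℝ≥0∞ := fun t => ENNReal.ofReal (ψ.normed volume t)
  have hρm : Measurable ρ := (ψ.continuous_normed.measurable).ennreal_ofReal
  have hρ1 : ∫⁻ t, ρ t = 1 := by
    rw [← ofReal_integral_eq_lintegral_ofReal ψ.integrable_normed
      (Eventually.of_forall ψ.nonneg_normed), ψ.integral_normed, ENNReal.ofReal_one]
  -- The bump is the density of a probability measure, so Jensen bounds the squared error by an
  -- average of squared translation errors; Tonelli then reduces the claim to continuity of
  -- translations.
  set ν := volume.withDensity ρ
  have : IsProbabilityMeasure ν := ⟨by simp [ν, hρ1]⟩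
  have hloc : LocallyIntegrable f volume := hf.locallyIntegrable (by norm_num)
  have hjm : AEStronglyMeasurable (fun p : Euc d × Euc d => f (p.1 - p.2) - f p.1)
      (volume.prod volume) := by
    refine AEStronglyMeasurable.sub ?_ hf.1.comp_fst
    exact hf.1.comp_quasiMeasurePreserving (quasiMeasurePreserving_sub_of_right_invariant _ _)
  have hjm' : AEMeasurable (fun p : Euc d × Euc d => ρ p.2 * ‖f (p.1 - p.2) - f p.1‖ₑ ^ 2)
      (volume.prod volume) :=
    (hρm.comp measurable_snd).aemeasurable.mul (hjm.enorm.pow_const 2)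
  have hpt : ∀ᵐ x, ‖mollify ψ f x - f x‖ₑ ^ 2 ≤
      ∫⁻ t, ρ t * ‖f (x - t) - f x‖ₑ ^ 2 := by
    filter_upwards with x
    have hmx : AEStronglyMeasurable (fun t => f (x - t) - f x) volume := by
      refine AEStronglyMeasurable.sub ?_ aestronglyMeasurable_const
      exact hf.1.comp_quasiMeasurePreserving
        (quasiMeasurePreserving_sub_left_of_right_invariant _ _)
    have hmν : AEMeasurable (fun t => ‖f (x - t) - f x‖ₑ) ν :=
      hmx.enorm.mono_ac (withDensity_absolutelyContinuous _ _)
    rw [mollify_sub_eq ψ hloc]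
    calc ‖∫ t, ψ.normed volume t • (f (x - t) - f x)‖ₑ ^ 2
        ≤ (∫⁻ t, ρ t * ‖f (x - t) - f x‖ₑ) ^ 2 := by
          gcongr
          refine (enorm_integral_le_lintegral_enorm _).trans (le_of_eq ?_)
          refine lintegral_congr fun t => ?_
          rw [enorm_smul, Real.enorm_of_nonneg (ψ.nonneg_normed t)]
      _ = (∫⁻ t, ‖f (x - t) - f x‖ₑ ∂ν) ^ 2 := by
          rw [lintegral_withDensity_eq_lintegral_mul₀ hρm.aemeasurable hmx.enorm]; rfl
      _ ≤ ∫⁻ t, ‖f (x - t) - f x‖ₑ ^ 2 ∂ν := sq_lintegral_le ν hmν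
      _ = _ := by
          rw [lintegral_withDensity_eq_lintegral_mul₀ hρm.aemeasurable (hmx.enorm.pow_const 2)]; rfl
  have hfin : eLpNorm (fun x => mollify ψ f x - f x) 2 volume ^ 2 ≤ ε ^ 2 := by
    rw [eLpNorm_two_sq]
    calc ∫⁻ x, ‖mollify ψ f x - f x‖ₑ ^ 2
        ≤ ∫⁻ x, ∫⁻ t, ρ t * ‖f (x - t) - f x‖ₑ ^ 2 := lintegral_mono_ae hpt
      _ = ∫⁻ t, ∫⁻ x, ρ t * ‖f (x - t) - f x‖ₑ ^ 2 := lintegral_lintegral_swap hjm'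
      _ ≤ ∫⁻ t, ρ t * ε ^ 2 := by
          refine lintegral_mono fun t => ?_
          by_cases ht : t ∈ Metric.ball (0 : Euc d) ψ.rOut
          · have hm : AEStronglyMeasurable (fun x => f (x - t) - f x) volume := by
              refine AEStronglyMeasurable.sub ?_ hf.1
              exact hf.1.comp_quasiMeasurePreserving
                (measurePreserving_sub_right volume t).quasiMeasurePreserving
            rw [lintegral_const_mul'' _ (hm.enorm.pow_const 2), ← eLpNorm_two_sq]
            gcongr
            exact h t (lt_of_lt_of_le (by simpa using ht) hψ)
          · have : ψ.normed volume t = 0 := by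
              rw [← Function.notMem_support, ψ.support_normed_eq]; exact ht
            simp [ρ, this]
      _ = ε ^ 2 := by rw [lintegral_mul_const _ hρm, hρ1, one_mul]
  rw [← ENNReal.rpow_natCast, ← ENNReal.rpow_natCast (n := 2) (x := ε)] at hfin
  exact (ENNReal.rpow_le_rpow_iff (by norm_num)).mp hfin

end Mollification

/-! ### Weak gradients and approximation by smooth functions -/

section WeakGradient

variable {d : ℕ} {Ω : Set (Euc d)}

/-- `g` is a weak gradient of `u` on `Ω`. -/
def HasWeakGrad (Ω : Set (Euc d)) (u : Euc d → ℝ) (g : Euc d → Euc d) : Prop :=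
  ∀ φ, IsTest Ω φ → ∀ e : Euc d,
    ∫ x in Ω, u x * fderiv ℝ φ x e = - ∫ x in Ω, inner ℝ (g x) e * φ x

theorem inner_gradient (f : Euc d → ℝ) (x e : Euc d) :
    inner ℝ (gradient f x) e = fderiv ℝ f x e := by
  rw [gradient, InnerProductSpace.toDual_symm_apply]

theorem contDiff_mollify (ψ : ContDiffBump (0 : Euc d)) {f : Euc d → ℝ}
    (hf : LocallyIntegrable f volume) : ContDiff ℝ ∞ (mollify ψ f) :=
  ψ.hasCompactSupport_normed.contDiff_convolution_left _ ψ.contDiff_normed hf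

/-- The gradient of a mollified function is the mollified weak gradient. -/
theorem gradient_mollify (hΩ : MeasurableSet Ω) {u : Euc d → ℝ} {g : Euc d → Euc d}
    (hu : MemLp u 2 (volume.restrict Ω)) (hg : MemLp g 2 (volume.restrict Ω))
    (h : HasWeakGrad Ω u g) (ψ : ContDiffBump (0 : Euc d)) {x : Euc d}
    (hx : Metric.closedBall x ψ.rOut ⊆ Ω) :
    gradient (mollify ψ (Ω.indicator u)) x = mollify ψ (Ω.indicator g) x := by
  have hu' : LocallyIntegrable (Ω.indicator u) volume :=
    ((memLp_indicator_iff_restrict hΩ).mpr hu).locallyIntegrable (by norm_num)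
  have hg' : LocallyIntegrable (Ω.indicator g) volume :=
    ((memLp_indicator_iff_restrict hΩ).mpr hg).locallyIntegrable (by norm_num)
  -- The mollification at `x` is an integral against this function, which is admissible since the
  -- closed ball around `x` lies in `Ω`. The reflection in `x - t` changes the sign of the
  -- derivative and cancels the sign in the integration by parts.
  set φ : Euc d → ℝ := fun t => ψ.normed volume (x - t)
  have hφ : IsTest Ω φ := by
    have hsupp : tsupport φ ⊆ Metric.closedBall x ψ.rOut := by
      refine closure_minimal (fun t ht => ?_) Metric.isClosed_closedBall
      have : x - t ∈ Function.support (ψ.normed volume) := ht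
      rw [ψ.support_normed_eq] at this
      rw [Metric.mem_closedBall, dist_comm, dist_eq_norm]
      exact (by simpa using this : ‖x - t‖ < ψ.rOut).le
    refine ⟨?_, ?_, hsupp.trans hx⟩
    · exact (ψ.contDiff_normed (n := ⊤)).comp (contDiff_const.sub contDiff_id)
    · exact (isCompact_closedBall x ψ.rOut).of_isClosed_subset (isClosed_tsupport _) hsupp
  have hφ' : ∀ t e, fderiv ℝ φ t e = - fderiv ℝ (ψ.normed volume) (x - t) e := by
    intro t e
    have h1 : HasFDerivAt (ψ.normed volume) (fderiv ℝ (ψ.normed volume) (x - t)) (x - t) :=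
      ((ψ.contDiff_normed (n := 1)).differentiable (by norm_num) _).hasFDerivAt
    have h2 : HasFDerivAt (fun t : Euc d => x - t) (-ContinuousLinearMap.id ℝ (Euc d)) t :=
      (hasFDerivAt_id t).const_sub x
    have h3 : HasFDerivAt φ ((fderiv ℝ (ψ.normed volume) (x - t)).comp
        (-ContinuousLinearMap.id ℝ (Euc d))) t := h1.comp t h2
    rw [h3.fderiv]
    simp
  refine ext_inner_right ℝ fun e => ?_
  rw [inner_gradient]
  have hD := (ψ.hasCompactSupport_normed (μ := volume)).hasFDerivAt_convolution_left
    (ContinuousLinearMap.lsmul ℝ ℝ) (ψ.contDiff_normed (n := 1)) hu' x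
  rw [mollify, hD.fderiv, convolution_eq_swap]
  have hint : Integrable (fun t => ((ContinuousLinearMap.lsmul ℝ ℝ).precompL (Euc d)
      (fderiv ℝ (ψ.normed volume) (x - t))) (Ω.indicator u t)) volume := by
    have := ((ψ.hasCompactSupport_normed (μ := volume)).fderiv ℝ).convolutionExists_left
      ((ContinuousLinearMap.lsmul ℝ ℝ).precompL (Euc d))
      ((ψ.contDiff_normed (μ := volume) (n := 1)).continuous_fderiv (by norm_num)) hu' x
    exact this.integrable_swap
  rw [ContinuousLinearMap.integral_apply hint]
  have hint2 : Integrable (fun t => ψ.normed volume (x - t) • Ω.indicator g t) volume :=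
    (convolutionExists_mollify ψ hg' x).integrable_swap
  rw [mollify, convolution_eq_swap]
  simp only [ContinuousLinearMap.lsmul_apply]
  rw [real_inner_comm, ← integral_inner hint2]
  have e1 : ∀ t, ((ContinuousLinearMap.lsmul ℝ ℝ).precompL (Euc d)
      (fderiv ℝ (ψ.normed volume) (x - t))) (Ω.indicator u t) e =
      Ω.indicator (fun t => -(u t * fderiv ℝ φ t e)) t := by
    intro t
    rw [ContinuousLinearMap.precompL_apply, ContinuousLinearMap.lsmul_apply, smul_eq_mul]
    by_cases ht : t ∈ Ω
    · rw [Set.indicator_of_mem ht, Set.indicator_of_mem ht, hφ']; ring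
    · rw [Set.indicator_of_notMem ht, Set.indicator_of_notMem ht, mul_zero]
  have e2 : ∀ t, inner ℝ e (ψ.normed volume (x - t) • Ω.indicator g t) =
      Ω.indicator (fun t => inner ℝ (g t) e * φ t) t := by
    intro t
    rw [inner_smul_right]
    by_cases ht : t ∈ Ω
    · rw [Set.indicator_of_mem ht, Set.indicator_of_mem ht, real_inner_comm]; ring
    · rw [Set.indicator_of_notMem ht, Set.indicator_of_notMem ht, inner_zero_right, mul_zero]
  simp only [e1, e2]
  rw [integral_indicator hΩ, integral_indicator hΩ, integral_neg, h φ hφ e, neg_neg]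

/-- Bump functions with arbitrarily small supports. -/
def smallBump (d : ℕ) (δ : ℝ) (hδ : 0 < δ) : ContDiffBump (0 : Euc d) :=
  ⟨δ / 2, δ, by linarith, by linarith⟩

/-- Functions with weak gradients are approximated by smooth ones on compact subsets. -/
theorem exists_smooth_approx (hΩ : IsOpen Ω) (hb : Bornology.IsBounded Ω) {u : Euc d → ℝ}
    {g : Euc d → Euc d}
    (hu : MemLp u 2 (volume.restrict Ω)) (hg : MemLp g 2 (volume.restrict Ω))
    (h : HasWeakGrad Ω u g) {K : Set (Euc d)} (hK : IsCompact K) (hKΩ : K ⊆ Ω) {ε : ℝ≥0∞}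
    (hε : ε ≠ 0) :
    ∃ v : Euc d → ℝ, ContDiff ℝ ∞ v ∧ HasCompactSupport v ∧
      eLpNorm (fun x => v x - u x) 2 (volume.restrict K) ≤ ε ∧
      eLpNorm (fun x => gradient v x - g x) 2 (volume.restrict K) ≤ ε := by
  have hu' := (memLp_indicator_iff_restrict hΩ.measurableSet).mpr hu
  have hg' := (memLp_indicator_iff_restrict hΩ.measurableSet).mpr hg
  obtain ⟨δ1, hδ1, h1⟩ := exists_mollify_sub_le hu' hε
  obtain ⟨δ2, hδ2, h2⟩ := exists_mollify_sub_le hg' hε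
  obtain ⟨δ3, hδ3, h3⟩ := hK.exists_cthickening_subset_open hΩ hKΩ
  -- Two radii come from L² convergence of the function and of its gradient; the third keeps the
  -- balls around points of `K` inside `Ω`, where `gradient_mollify` applies.
  set ψ := smallBump d (min δ1 (min δ2 δ3)) (lt_min hδ1 (lt_min hδ2 hδ3))
  have hr1 : ψ.rOut ≤ δ1 := min_le_left _ _
  have hr2 : ψ.rOut ≤ δ2 := (min_le_right _ _).trans (min_le_left _ _)
  have hr3 : ψ.rOut ≤ δ3 := (min_le_right _ _).trans (min_le_right _ _)
  refine ⟨mollify ψ (Ω.indicator u), contDiff_mollify ψ (hu'.locallyIntegrable (by norm_num)),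
    ?_, ?_, ?_⟩
  · refine HasCompactSupport.convolution _ ψ.hasCompactSupport_normed ?_
    refine hb.isCompact_closure.of_isClosed_subset (isClosed_tsupport _) ?_
    exact closure_mono (Set.support_indicator_subset)
  · calc _ = eLpNorm (fun x => mollify ψ (Ω.indicator u) x - Ω.indicator u x) 2
          (volume.restrict K) := by
          refine eLpNorm_congr_ae ?_
          filter_upwards [ae_restrict_mem hK.measurableSet] with x hx
          rw [Set.indicator_of_mem (hKΩ hx)]
      _ ≤ _ := eLpNorm_mono_measure _ Measure.restrict_le_self
      _ ≤ ε := h1 ψ hr1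
  · calc _ = eLpNorm (fun x => mollify ψ (Ω.indicator g) x - Ω.indicator g x) 2
          (volume.restrict K) := by
          refine eLpNorm_congr_ae ?_
          filter_upwards [ae_restrict_mem hK.measurableSet] with x hx
          rw [Set.indicator_of_mem (hKΩ hx), gradient_mollify hΩ.measurableSet hu hg h]
          refine subset_trans ?_ h3
          exact (Metric.closedBall_subset_closedBall hr3).trans
            (Metric.closedBall_subset_cthickening hx _)
      _ ≤ _ := eLpNorm_mono_measure _ Measure.restrict_le_self
      _ ≤ ε := h2 ψ hr2

/-- Compactly supported functions with a weak gradient on the whole space are approximated by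
test functions. -/
theorem exists_test_approx (hΩ : IsOpen Ω) {u : Euc d → ℝ} {g : Euc d → Euc d}
    (hu : MemLp u 2 volume) (hg : MemLp g 2 volume) (h : HasWeakGrad Set.univ u g)
    (hc : HasCompactSupport u) (hs : tsupport u ⊆ Ω) {ε : ℝ≥0∞} (hε : ε ≠ 0) :
    ∃ v : Euc d → ℝ, IsTest Ω v ∧ eLpNorm (fun x => v x - u x) 2 volume ≤ ε ∧
      eLpNorm (fun x => gradient v x - g x) 2 volume ≤ ε := by
  obtain ⟨δ1, hδ1, h1⟩ := exists_mollify_sub_le hu hε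
  obtain ⟨δ2, hδ2, h2⟩ := exists_mollify_sub_le hg hε
  obtain ⟨δ3, hδ3, h3⟩ := hc.isCompact.exists_cthickening_subset_open hΩ hs
  set ψ := smallBump d (min δ1 (min δ2 δ3)) (lt_min hδ1 (lt_min hδ2 hδ3))
  have hr1 : ψ.rOut ≤ δ1 := min_le_left _ _
  have hr2 : ψ.rOut ≤ δ2 := (min_le_right _ _).trans (min_le_left _ _)
  have hr3 : ψ.rOut ≤ δ3 := (min_le_right _ _).trans (min_le_right _ _)
  have hgrad : ∀ x, gradient (mollify ψ u) x = mollify ψ g x := by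
    intro x
    have := gradient_mollify (Ω := Set.univ) (u := u) (g := g) MeasurableSet.univ
      (by simpa using hu) (by simpa using hg) h ψ (Set.subset_univ (Metric.closedBall x ψ.rOut))
    simpa only [Set.indicator_univ] using this
  refine ⟨mollify ψ u, ⟨contDiff_mollify ψ (hu.locallyIntegrable (by norm_num)),
    HasCompactSupport.convolution _ ψ.hasCompactSupport_normed hc, ?_⟩, h1 ψ hr1, ?_⟩
  · refine subset_trans (closure_minimal ?_ Metric.isClosed_cthickening) h3
    refine (support_convolution_subset _).trans ?_
    rintro _ ⟨a, ha, b, hb, rfl⟩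
    rw [ψ.support_normed_eq] at ha
    refine Metric.mem_cthickening_of_dist_le _ b _ _ (subset_tsupport _ hb) ?_
    have : ‖a‖ < ψ.rOut := by simpa using ha
    simpa using (this.trans_le hr3).le
  · simpa only [hgrad] using h2 ψ hr2

end WeakGradient

/-! ### A compactness criterion by finitely many functionals -/

section Abstract

variable {E F : Type*} [NormedAddCommGroup E] [InnerProductSpace ℝ E] [NormedAddCommGroup F]
  [InnerProductSpace ℝ F]

/-- If the first component is controlled, up to a small multiple of the second one, by finitely
many functionals, then the first projection is compact. -/
theorem compactFst_of_functionals [CompleteSpace E] (D : Submodule ℝ (E × F))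
    (h : ∀ ε > 0, ∃ (ι : Type) (_ : Fintype ι) (e : ι → E), ∀ p ∈ D,
      ‖p.1‖ ^ 2 ≤ ε * ‖p.2‖ ^ 2 + ∑ i, (inner ℝ (e i) p.1) ^ 2) :
    CompactFst (D : Set (E × F)) := by
  intro C p hp hC
  have htb : TotallyBounded (Set.range fun k => (p k).1) := by
    refine Metric.totallyBounded_of_finite_discretization fun ε hε => ?_
    -- Differences of members of the sequence have second component of norm at most `2 * C`, so with
    -- this tolerance the gradient term costs at most `ε ^ 2 / 2`. The mesh `η` below limits the
    -- functionals to `ε ^ 2 / 4`.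
    obtain ⟨ι, _, e, he⟩ := h (ε ^ 2 / (8 * (C + 1) ^ 2 + 8)) (by positivity)
    let T : E → ι → ℝ := fun u i => inner ℝ (e i) u
    have hTb : Bornology.IsBounded (T '' Set.range fun k => (p k).1) := by
      rw [isBounded_iff_forall_norm_le]
      refine ⟨∑ i, ‖e i‖ * C, ?_⟩
      rintro _ ⟨_, ⟨k, rfl⟩, rfl⟩
      have hC0 : 0 ≤ C := (norm_nonneg _).trans (hC k)
      rw [pi_norm_le_iff_of_nonneg (by positivity)]
      intro i
      calc ‖T (p k).1 i‖ ≤ ‖e i‖ * ‖(p k).1‖ := norm_inner_le_norm _ _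
        _ ≤ ‖e i‖ * C := by gcongr; exact (norm_fst_le _).trans (hC k)
        _ ≤ ∑ i, ‖e i‖ * C := Finset.single_le_sum (f := fun i => ‖e i‖ * C)
            (fun i _ => by positivity) (Finset.mem_univ i)
    set η : ℝ := ε / (4 * (Fintype.card ι + 1)) with hη
    have hη0 : 0 < η := by positivity
    obtain ⟨t, htf, ht⟩ := Metric.totallyBounded_iff.mp
      (hTb.isCompact_closure.totallyBounded.subset subset_closure) η hη0
    -- Each member is labelled by a nearby point of a finite net for the values of the functionals;
    -- equal labels force the first components to be within `ε`.
    have hex : ∀ x : Set.range (fun k => (p k).1), ∃ y : t, T x ∈ Metric.ball (y : ι → ℝ) η := by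
      intro x
      have := ht ⟨x, x.2, rfl⟩
      simpa using this
    choose Fc hFc using hex
    have := htf.fintype
    refine ⟨ULift t, inferInstance, ULift.up ∘ Fc, ?_⟩
    rintro ⟨_, ⟨k, rfl⟩⟩ ⟨_, ⟨l, rfl⟩⟩ hkl'
    have hkl := ULift.up_injective hkl'
    have h1 := hFc ⟨_, ⟨k, rfl⟩⟩
    have h2 := hFc ⟨_, ⟨l, rfl⟩⟩
    rw [← hkl] at h2
    have hd : dist (T (p k).1) (T (p l).1) < 2 * η := by
      have := dist_triangle_right (T (p k).1) (T (p l).1) (Fc ⟨_, ⟨k, rfl⟩⟩ : ι → ℝ)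
      rw [Metric.mem_ball] at h1 h2
      simp only at h1 h2
      linarith
    have hsum : ∑ i, (inner ℝ (e i) (p k - p l).1) ^ 2 ≤ ε ^ 2 / 4 := by
      have : ∀ i, (inner ℝ (e i) (p k - p l).1) ^ 2 ≤ (2 * η) ^ 2 := by
        intro i
        have h3 : |inner ℝ (e i) (p k - p l).1| ≤ 2 * η := by
          have := (dist_le_pi_dist (T (p k).1) (T (p l).1) i).trans hd.le
          rw [Real.dist_eq] at this
          simpa [T, inner_sub_right] using this
        rw [← sq_abs]
        gcongr
      calc ∑ i, (inner ℝ (e i) (p k - p l).1) ^ 2 ≤ ∑ _i : ι, (2 * η) ^ 2 :=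
            Finset.sum_le_sum fun i _ => this i
        _ = Fintype.card ι * (2 * η) ^ 2 := by simp
        _ ≤ ε ^ 2 / 4 := by
            rw [hη]
            have hc : (0 : ℝ) ≤ Fintype.card ι := by positivity
            have : (Fintype.card ι : ℝ) * (2 * (ε / (4 * (Fintype.card ι + 1)))) ^ 2 =
              ε ^ 2 / 4 * (Fintype.card ι / (Fintype.card ι + 1) ^ 2) := by field_simp; ring
            rw [this]
            have h4 : (Fintype.card ι : ℝ) / (Fintype.card ι + 1) ^ 2 ≤ 1 := by
              rw [div_le_one (by positivity)]; nlinarith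
            nlinarith [sq_nonneg ε]
    have hg : ‖(p k - p l).2‖ ^ 2 ≤ 4 * C ^ 2 := by
      have h3 : ‖(p k - p l).2‖ ≤ 2 * C :=
        (norm_snd_le _).trans ((norm_sub_le _ _).trans (by linarith [hC k, hC l]))
      calc _ ≤ (2 * C) ^ 2 := by gcongr
        _ = _ := by ring
    have hfin := he (p k - p l) (D.sub_mem (hp k) (hp l))
    have hC0 : 0 ≤ C := (norm_nonneg _).trans (hC k)
    have hsmall : ε ^ 2 / (8 * (C + 1) ^ 2 + 8) * ‖(p k - p l).2‖ ^ 2 ≤ ε ^ 2 / 2 := by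
      rw [div_mul_eq_mul_div, div_le_iff₀ (by positivity)]
      nlinarith [sq_nonneg ε, mul_nonneg (sq_nonneg ε) hC0]
    change dist (p k).1 (p l).1 < ε
    rw [dist_eq_norm]
    refine lt_of_pow_lt_pow_left₀ 2 hε.le ?_
    rw [Prod.fst_sub] at hfin hsum
    nlinarith [sq_pos_of_pos hε]
  have hcomp : IsCompact (closure (Set.range fun k => (p k).1)) :=
    (htb.closure).isCompact_of_isClosed isClosed_closure
  obtain ⟨w, -, φ, hφ, hw⟩ := hcomp.tendsto_subseq fun k => subset_closure ⟨k, rfl⟩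
  exact ⟨φ, hφ, w, hw⟩

end Abstract

/-! ### Mean oscillation of smooth functions over convex sets -/

section Poincare

variable {d : ℕ}

theorem norm_gradient (v : Euc d → ℝ) (x : Euc d) : ‖gradient v x‖ₑ = ‖fderiv ℝ v x‖ₑ := by
  rw [gradient, ← ofReal_norm, ← ofReal_norm, LinearIsometryEquiv.norm_map]

/-- The fundamental theorem of calculus along the segment from `x` to `y`, followed by Jensen on the
unit interval. -/
theorem enorm_sub_sq_le {v : Euc d → ℝ} (hv : ContDiff ℝ ∞ v) (x y : Euc d) :
    ‖v x - v y‖ₑ ^ 2 ≤ ‖x - y‖ₑ ^ 2 *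
      ∫⁻ t in Set.Ioc (0 : ℝ) 1, ‖gradient v ((1 - t) • x + t • y)‖ₑ ^ 2 := by
  have hv1 : Continuous (fderiv ℝ v) := hv.continuous_fderiv (by simp)
  have hderiv : ∀ t : ℝ, HasDerivAt (fun t : ℝ => v ((1 - t) • x + t • y))
      (fderiv ℝ v ((1 - t) • x + t • y) (y - x)) t := by
    intro t
    have h1 : HasDerivAt (fun t : ℝ => (1 - t) • x + t • y) (y - x) t := by
      have h2 := (((hasDerivAt_id t).const_sub 1).smul_const x).add
        ((hasDerivAt_id t).smul_const y)
      exact h2.congr_deriv (by rw [neg_one_smul, one_smul, sub_eq_neg_add])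
    exact ((hv.differentiable (by simp)) _).hasFDerivAt.comp_hasDerivAt t h1
  have hint := intervalIntegral.integral_eq_sub_of_hasDerivAt (a := 0) (b := 1)
    (fun t _ => hderiv t) (Continuous.intervalIntegrable (by fun_prop) _ _)
  have hprob : IsProbabilityMeasure (volume.restrict (Set.Ioc (0 : ℝ) 1)) := ⟨by simp⟩
  have hG : Measurable fun t : ℝ => ‖gradient v ((1 - t) • x + t • y)‖ₑ := by
    simp only [norm_gradient]
    exact (by fun_prop : Continuous fun t : ℝ => fderiv ℝ v ((1 - t) • x + t • y)).measurable.enorm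
  have h1 : ‖v x - v y‖ₑ ≤
      ‖x - y‖ₑ * ∫⁻ t in Set.Ioc (0 : ℝ) 1, ‖gradient v ((1 - t) • x + t • y)‖ₑ := by
    have h2 : v x - v y = -∫ t in Set.Ioc (0 : ℝ) 1,
        fderiv ℝ v ((1 - t) • x + t • y) (y - x) := by
      rw [← intervalIntegral.integral_of_le zero_le_one, hint]
      simp
    rw [h2, enorm_neg, ← lintegral_const_mul _ hG]
    refine (enorm_integral_le_lintegral_enorm _).trans (lintegral_mono fun t => ?_)
    rw [norm_gradient, mul_comm, ← enorm_neg (x - y), neg_sub]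
    exact ContinuousLinearMap.le_opENorm _ _
  calc ‖v x - v y‖ₑ ^ 2 ≤ (‖x - y‖ₑ *
        ∫⁻ t in Set.Ioc (0 : ℝ) 1, ‖gradient v ((1 - t) • x + t • y)‖ₑ) ^ 2 := by gcongr
    _ ≤ _ := by
        rw [mul_pow]
        gcongr
        exact sq_lintegral_le _ hG.aemeasurable

/-- The substitution `z = (1 - t) • x + t • y` keeps `y` inside `C` by convexity, and its Jacobian
`t ^ d` is at least `2 ^ (-d)` when `t ≥ 1 / 2`. -/
theorem lintegral_convex_comb_le {G : Euc d → ℝ≥0∞} (hG : Measurable G) {C : Set (Euc d)}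
    (hC : Convex ℝ C) (hCm : MeasurableSet C) {t : ℝ} (ht : 1 / 2 ≤ t) (ht1 : t ≤ 1) {x : Euc d}
    (hx : x ∈ C) :
    ∫⁻ y in C, G ((1 - t) • x + t • y) ≤ 2 ^ d * ∫⁻ y in C, G y := by
  have ht0 : t ≠ 0 := by linarith
  have hGi : Measurable (C.indicator G) := hG.indicator hCm
  calc ∫⁻ y in C, G ((1 - t) • x + t • y)
      ≤ ∫⁻ y in C, C.indicator G ((1 - t) • x + t • y) := by
        refine setLIntegral_mono (by fun_prop) fun y hy => ?_
        rw [Set.indicator_of_mem (hC hx hy (by linarith) (by linarith) (by ring))]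
    _ ≤ ∫⁻ y, C.indicator G ((1 - t) • x + t • y) := setLIntegral_le_lintegral _ _
    _ = ∫⁻ z, C.indicator G ((1 - t) • x + z) ∂(Measure.map (t • ·) volume) := by
        rw [lintegral_map (by fun_prop) (by fun_prop)]
    _ = ENNReal.ofReal |(t ^ d)⁻¹| * ∫⁻ z, C.indicator G ((1 - t) • x + z) := by
        rw [Measure.map_addHaar_smul _ ht0, lintegral_smul_measure]
        simp
    _ = ENNReal.ofReal |(t ^ d)⁻¹| * ∫⁻ y in C, G y := by
        rw [lintegral_add_left_eq_self, lintegral_indicator hCm]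
    _ ≤ _ := by
        gcongr
        rw [abs_of_nonneg (by positivity), ← inv_pow]
        calc ENNReal.ofReal (t⁻¹ ^ d) ≤ ENNReal.ofReal (2 ^ d) := by
              gcongr
              rw [inv_le_comm₀ (by linarith) (by norm_num)]
              linarith
          _ = 2 ^ d := by rw [ENNReal.ofReal_pow (by norm_num)]; simp

/-- One of `t` and `1 - t` is at least `1 / 2`. Integrating first in the endpoint with the larger
weight keeps the Jacobian bounded uniformly in `t`. -/
theorem lintegral_segment_le {G : Euc d → ℝ≥0∞} (hG : Measurable G) {C : Set (Euc d)}
    (hC : Convex ℝ C) (hCm : MeasurableSet C) {t : ℝ} (ht : t ∈ Set.Ioc (0 : ℝ) 1) :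
    ∫⁻ z, G ((1 - t) • z.1 + t • z.2) ∂((volume.restrict C).prod (volume.restrict C)) ≤
      2 ^ d * volume C * ∫⁻ x in C, G x := by
  have hhalf : ∀ t : ℝ, 1 / 2 ≤ t → t ≤ 1 →
      ∫⁻ x in C, ∫⁻ y in C, G ((1 - t) • x + t • y) ≤ 2 ^ d * volume C * ∫⁻ x in C, G x := by
    intro t ht ht1
    calc ∫⁻ x in C, ∫⁻ y in C, G ((1 - t) • x + t • y)
        ≤ ∫⁻ _x in C, 2 ^ d * ∫⁻ y in C, G y :=
          setLIntegral_mono measurable_const fun x hx =>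
            lintegral_convex_comb_le hG hC hCm ht ht1 hx
      _ = _ := by rw [setLIntegral_const]; ring
  have hsec : ∀ t : ℝ, Measurable fun p : Euc d × Euc d => G ((1 - t) • p.1 + t • p.2) :=
    fun t => hG.comp (by fun_prop)
  rw [lintegral_prod _ (hsec t).aemeasurable]
  by_cases h2 : 1 / 2 ≤ t
  · exact hhalf t h2 ht.2
  · rw [lintegral_lintegral_swap (hsec t).aemeasurable]
    have := hhalf (1 - t) (by linarith) (by linarith [ht.1])
    simp only [sub_sub_cancel] at this
    refine le_trans (le_of_eq ?_) this
    refine lintegral_congr fun x => lintegral_congr fun y => ?_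
    rw [add_comm]

/-- The mean square oscillation of a smooth function over a convex set. -/
theorem oscillation_le_of_contDiff {v : Euc d → ℝ} (hv : ContDiff ℝ ∞ v) {C : Set (Euc d)}
    (hC : Convex ℝ C) (hCm : MeasurableSet C) {h : ℝ≥0∞}
    (hdiam : ∀ x ∈ C, ∀ y ∈ C, ‖x - y‖ₑ ≤ h) :
    ∫⁻ z, ‖v z.1 - v z.2‖ₑ ^ 2 ∂((volume.restrict C).prod (volume.restrict C)) ≤
      h ^ 2 * (2 ^ d * volume C * ∫⁻ x in C, ‖gradient v x‖ₑ ^ 2) := by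
  obtain ⟨G, hGdef⟩ : ∃ G : Euc d → ℝ≥0∞, G = fun x => ‖gradient v x‖ₑ ^ 2 := ⟨_, rfl⟩
  have hG : Measurable G := by
    simp only [hGdef, norm_gradient]
    exact (hv.continuous_fderiv (by simp)).measurable.enorm.pow_const 2
  have hjoint : Measurable fun q : (Euc d × Euc d) × ℝ => G ((1 - q.2) • q.1.1 + q.2 • q.1.2) :=
    hG.comp (by fun_prop)
  have hI : Measurable fun p : Euc d × Euc d =>
      ∫⁻ t in Set.Ioc (0 : ℝ) 1, G ((1 - t) • p.1 + t • p.2) :=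
    Measurable.lintegral_prod_right' hjoint
  have hmem : ∀ᵐ z ∂((volume.restrict C).prod (volume.restrict C)), z.1 ∈ C ∧ z.2 ∈ C := by
    rw [Measure.prod_restrict]
    filter_upwards [ae_restrict_mem (hCm.prod hCm)] with z hz using hz
  have h1 : ∫⁻ z, ‖v z.1 - v z.2‖ₑ ^ 2 ∂((volume.restrict C).prod (volume.restrict C)) ≤
      ∫⁻ z : Euc d × Euc d, h ^ 2 * (∫⁻ t in Set.Ioc (0 : ℝ) 1, G ((1 - t) • z.1 + t • z.2))
        ∂((volume.restrict C).prod (volume.restrict C)) := by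
    refine lintegral_mono_ae ?_
    filter_upwards [hmem] with z hz
    refine (enorm_sub_sq_le hv z.1 z.2).trans ?_
    rw [hGdef]
    gcongr
    exact hdiam _ hz.1 _ hz.2
  refine h1.trans ?_
  rw [lintegral_const_mul _ hI]
  gcongr 1
  rw [lintegral_lintegral_swap hjoint.aemeasurable]
  calc _ ≤ ∫⁻ _t in Set.Ioc (0 : ℝ) 1, 2 ^ d * volume C * ∫⁻ x in C, G x :=
        setLIntegral_mono measurable_const fun t ht => lintegral_segment_le hG hC hCm ht
    _ = _ := by rw [setLIntegral_const, hGdef]; simp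

end Poincare

/-! ### H¹ and H¹₀ as closed subspaces -/

section SobolevSpaces

variable {d : ℕ} {Ω : Set (Euc d)}

theorem IsTest.memLp_fderiv {φ : Euc d → ℝ} (hφ : IsTest Ω φ) (e : Euc d) (μ : Measure (Euc d))
    [IsFiniteMeasureOnCompacts μ] : MemLp (fun x => fderiv ℝ φ x e) 2 μ :=
  Continuous.memLp_of_hasCompactSupport
    ((hφ.1.continuous_fderiv (by simp)).clm_apply continuous_const)
    (hφ.2.1.fderiv_apply (𝕜 := ℝ) e)

theorem IsTest.memLp_smul {φ : Euc d → ℝ} (hφ : IsTest Ω φ) (e : Euc d) (μ : Measure (Euc d))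
    [IsFiniteMeasureOnCompacts μ] : MemLp (fun x => φ x • e) 2 μ :=
  Continuous.memLp_of_hasCompactSupport (hφ.1.continuous.smul continuous_const)
    (hφ.2.1.smul_right (f' := fun _ => e))

/-- Rewrites the weak gradient identities as the vanishing of continuous linear functionals on L² ×
L²; linearity and closedness of H¹ are then immediate. -/
theorem mem_H1_iff {p : L2 Ω × L2vec Ω} :
    p ∈ H1 Ω ↔ ∀ φ (hφ : IsTest Ω φ) (e : Euc d),
      inner ℝ p.1 ((hφ.memLp_fderiv e (volume.restrict Ω)).toLp _) +
        inner ℝ p.2 ((hφ.memLp_smul e (volume.restrict Ω)).toLp _) = 0 := by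
  refine forall_congr' fun φ => forall_congr' fun hφ => forall_congr' fun e => ?_
  rw [L2.inner_def, L2.inner_def]
  have h1 : ∫ x in Ω, inner ℝ (p.1 x) ((hφ.memLp_fderiv e (volume.restrict Ω)).toLp _ x) =
      ∫ x in Ω, p.1 x * fderiv ℝ φ x e := by
    refine integral_congr_ae ?_
    filter_upwards [(hφ.memLp_fderiv e (volume.restrict Ω)).coeFn_toLp] with x hx
    rw [hx, real_inner_eq_re_inner, RCLike.inner_apply]
    simp [mul_comm]
  have h2 : ∫ x in Ω, inner ℝ (p.2 x) ((hφ.memLp_smul e (volume.restrict Ω)).toLp _ x) =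
      ∫ x in Ω, inner ℝ (p.2 x) e * φ x := by
    refine integral_congr_ae ?_
    filter_upwards [(hφ.memLp_smul e (volume.restrict Ω)).coeFn_toLp] with x hx
    rw [hx, inner_smul_right, mul_comm]
  rw [h1, h2, eq_neg_iff_add_eq_zero]

/-- `H¹(Ω)` as a subspace. -/
def H1Sub (Ω : Set (Euc d)) : Submodule ℝ (L2 Ω × L2vec Ω) where
  carrier := H1 Ω
  add_mem' := by
    intro a b ha hb
    rw [mem_H1_iff] at ha hb ⊢
    intro φ hφ e
    rw [Prod.fst_add, Prod.snd_add, inner_add_left, inner_add_left]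
    linarith [ha φ hφ e, hb φ hφ e]
  zero_mem' := by
    rw [mem_H1_iff]
    intro φ hφ e
    simp
  smul_mem' := by
    intro t a ha
    rw [mem_H1_iff] at ha ⊢
    intro φ hφ e
    rw [Prod.smul_fst, Prod.smul_snd, real_inner_smul_left, real_inner_smul_left, ← mul_add,
      ha φ hφ e, mul_zero]

theorem coe_H1Sub (Ω : Set (Euc d)) : (H1Sub Ω : Set (L2 Ω × L2vec Ω)) = H1 Ω := rfl

theorem isClosed_H1 (Ω : Set (Euc d)) : IsClosed (H1 Ω) := by
  have : H1 Ω = ⋂ φ, ⋂ (hφ : IsTest Ω φ), ⋂ e : Euc d, {p : L2 Ω × L2vec Ω |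
      inner ℝ p.1 ((hφ.memLp_fderiv e (volume.restrict Ω)).toLp _) +
        inner ℝ p.2 ((hφ.memLp_smul e (volume.restrict Ω)).toLp _) = 0} := by
    ext p
    simp only [mem_H1_iff, Set.mem_iInter, Set.mem_ofPred_eq]
  rw [this]
  refine isClosed_iInter fun φ => isClosed_iInter fun hφ => isClosed_iInter fun e => ?_
  exact isClosed_eq (by fun_prop) continuous_const

theorem IsTest.setIntegral_eq {φ : Euc d → ℝ} (hφ : IsTest Ω φ) {F : Euc d → ℝ}
    (hF : ∀ x, x ∉ tsupport φ → F x = 0) : ∫ x in Ω, F x = ∫ x, F x :=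
  setIntegral_eq_integral_of_forall_compl_eq_zero fun x hx => hF x fun h => hx (hφ.2.2 h)

theorem fderiv_eq_zero_of_notMem_tsupport {φ : Euc d → ℝ} {x : Euc d} (hx : x ∉ tsupport φ) :
    fderiv ℝ φ x = 0 := by
  by_contra h
  exact hx (support_fderiv_subset ℝ h)

/-- A Lipschitz function is weakly differentiable. -/
theorem hasWeakGrad_of_lipschitz {f : Euc d → ℝ} {K : ℝ≥0} (hf : LipschitzWith K f) :
    HasWeakGrad Ω f (gradient f) := by
  intro φ hφ e
  obtain ⟨C, hC⟩ := ContDiff.lipschitzWith_of_hasCompactSupport hφ.2.1 hφ.1 (by simp)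
  rw [hφ.setIntegral_eq (fun x hx => by rw [fderiv_eq_zero_of_notMem_tsupport hx]; simp),
    hφ.setIntegral_eq (fun x hx => by rw [image_eq_zero_of_notMem_tsupport hx, mul_zero])]
  -- Integration by parts for Lipschitz functions is available with directional derivatives;
  -- Rademacher's theorem identifies these with the gradient almost everywhere.
  have h := hf.integral_lineDeriv_mul_eq (μ := volume) hC hφ.2.1 e
  have h1 : ∫ x, lineDeriv ℝ f x e * φ x = ∫ x, inner ℝ (gradient f x) e * φ x := by
    refine integral_congr_ae ?_
    filter_upwards [hf.ae_differentiableAt (μ := volume)] with x hx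
    rw [hx.lineDeriv_eq_fderiv, inner_gradient]
  have h2 : ∫ x, lineDeriv ℝ φ x (-e) * f x = -∫ x, f x * fderiv ℝ φ x e := by
    rw [← integral_neg]
    refine integral_congr_ae (Eventually.of_forall fun x => ?_)
    change lineDeriv ℝ φ x (-e) * f x = -(f x * fderiv ℝ φ x e)
    rw [(hφ.1.differentiable (by simp) x).lineDeriv_eq_fderiv, map_neg]
    ring
  rw [h1, h2] at h
  linarith

/-- The pairs `(φ, ∇φ)` of test functions. -/
def testSub (Ω : Set (Euc d)) : Submodule ℝ (L2 Ω × L2vec Ω) where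
  carrier := {p | ∃ φ, IsTest Ω φ ∧ p.1 =ᵐ[volume.restrict Ω] φ ∧
    p.2 =ᵐ[volume.restrict Ω] gradient φ}
  add_mem' := by
    rintro a b ⟨φ, hφ, ha1, ha2⟩ ⟨ψ, hψ, hb1, hb2⟩
    refine ⟨φ + ψ, ⟨hφ.1.add hψ.1, hφ.2.1.add hψ.2.1,
      (tsupport_add φ ψ).trans (Set.union_subset hφ.2.2 hψ.2.2)⟩, ?_, ?_⟩
    · filter_upwards [Lp.coeFn_add a.1 b.1, ha1, hb1] with x h1 h2 h3
      rw [Prod.fst_add, h1, Pi.add_apply, Pi.add_apply, h2, h3]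
    · filter_upwards [Lp.coeFn_add a.2 b.2, ha2, hb2] with x h1 h2 h3
      rw [Prod.snd_add, h1, Pi.add_apply, h2, h3]
      simp only [gradient]
      rw [fderiv_add (hφ.1.differentiable (by simp) x) (hψ.1.differentiable (by simp) x), map_add]
  zero_mem' := by
    refine ⟨0, ⟨contDiff_const, HasCompactSupport.zero, by simp⟩, Lp.coeFn_zero _ _ _, ?_⟩
    filter_upwards [Lp.coeFn_zero (Euc d) 2 (volume.restrict Ω)] with x h1
    rw [Prod.snd_zero, h1]
    simp [gradient]
  smul_mem' := by
    rintro t a ⟨φ, hφ, ha1, ha2⟩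
    refine ⟨t • φ, ⟨hφ.1.const_smul t, hφ.2.1.smul_left (f := fun _ => t), ?_⟩, ?_, ?_⟩
    · exact (closure_mono (Function.support_const_smul_subset t φ)).trans hφ.2.2
    · filter_upwards [Lp.coeFn_smul t a.1, ha1] with x h1 h2
      rw [Prod.smul_fst, h1, Pi.smul_apply, Pi.smul_apply, h2]
    · filter_upwards [Lp.coeFn_smul t a.2, ha2] with x h1 h2
      rw [Prod.smul_snd, h1, Pi.smul_apply, h2]
      simp only [gradient]
      rw [fderiv_const_smul (hφ.1.differentiable (by simp) x), map_smul]

/-- `H¹₀(Ω)` as a subspace. -/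
def H10Sub (Ω : Set (Euc d)) : Submodule ℝ (L2 Ω × L2vec Ω) := (testSub Ω).topologicalClosure

theorem coe_H10Sub (Ω : Set (Euc d)) : (H10Sub Ω : Set (L2 Ω × L2vec Ω)) = H10 Ω :=
  Submodule.topologicalClosure_coe _

/-- Test functions are Lipschitz, so their gradients are weak gradients, and H¹ is closed. The
compactness proved for H¹ thereby serves the Dirichlet case too. -/
theorem H10_subset_H1 (Ω : Set (Euc d)) : H10 Ω ⊆ H1 Ω := by
  refine closure_minimal ?_ (isClosed_H1 Ω)
  rintro p ⟨φ, hφ, h1, h2⟩ ψ hψ e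
  obtain ⟨K, hK⟩ := ContDiff.lipschitzWith_of_hasCompactSupport hφ.2.1 hφ.1 (by simp)
  have h := hasWeakGrad_of_lipschitz (Ω := Ω) hK ψ hψ e
  calc _ = ∫ x in Ω, φ x * fderiv ℝ ψ x e := by
        refine integral_congr_ae ?_
        filter_upwards [h1] with x hx
        rw [hx]
    _ = _ := h
    _ = _ := by
        congr 1
        refine integral_congr_ae ?_
        filter_upwards [h2] with x hx
        rw [hx]

theorem norm_sq_Lp {α V : Type*} [MeasurableSpace α] {μ : Measure α} [NormedAddCommGroup V]
    [InnerProductSpace ℝ V] (f : Lp V 2 μ) : ‖f‖ ^ 2 = ∫ x, ‖f x‖ ^ 2 ∂μ := by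
  rw [← real_inner_self_eq_norm_sq, L2.inner_def]
  simp only [real_inner_self_eq_norm_sq]

end SobolevSpaces

/-! ### Mean oscillation of Sobolev functions over convex sets -/

section Oscillation

variable {d : ℕ} {Ω : Set (Euc d)}

theorem enorm_sq_eq_ofReal {V : Type*} [NormedAddCommGroup V] (p : V) :
    ‖p‖ₑ ^ 2 = ENNReal.ofReal (‖p‖ ^ 2) := by
  rw [ENNReal.ofReal_pow (norm_nonneg _), ofReal_norm]

theorem enorm_sq_le_two {V : Type*} [NormedAddCommGroup V] (p q : V) :
    ‖p‖ₑ ^ 2 ≤ 2 * (‖p - q‖ₑ ^ 2 + ‖q‖ₑ ^ 2) := by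
  simp only [enorm_sq_eq_ofReal]
  rw [← ENNReal.ofReal_add (by positivity) (by positivity),
    show (2 : ℝ≥0∞) = ENNReal.ofReal 2 by simp, ← ENNReal.ofReal_mul (by norm_num)]
  refine ENNReal.ofReal_le_ofReal ?_
  have h : ‖p‖ ≤ ‖p - q‖ + ‖q‖ := by simpa using norm_add_le (p - q) q
  nlinarith [sq_nonneg (‖p - q‖ - ‖q‖), norm_nonneg p, norm_nonneg (p - q), norm_nonneg q]

theorem enorm_sub_sq_le_three (a b a' b' : ℝ) :
    ‖a - b‖ₑ ^ 2 ≤ 3 * (‖a' - b'‖ₑ ^ 2 + ‖a' - a‖ₑ ^ 2 + ‖b' - b‖ₑ ^ 2) := by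
  simp only [enorm_sq_eq_ofReal, Real.norm_eq_abs, sq_abs]
  rw [← ENNReal.ofReal_add (by positivity) (by positivity),
    ← ENNReal.ofReal_add (by positivity) (by positivity),
    show (3 : ℝ≥0∞) = ENNReal.ofReal 3 by simp, ← ENNReal.ofReal_mul (by norm_num)]
  refine ENNReal.ofReal_le_ofReal ?_
  nlinarith [sq_nonneg ((a' - b') + (a' - a)), sq_nonneg ((a' - b') - (b' - b)),
    sq_nonneg ((a' - a) + (b' - b))]

theorem lintegral_comp_fst {α : Type*} [MeasurableSpace α] (μ : Measure α) [SFinite μ]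
    {f : α → ℝ≥0∞} (hf : AEMeasurable f μ) :
    ∫⁻ z, f z.1 ∂(μ.prod μ) = μ Set.univ * ∫⁻ x, f x ∂μ := by
  have := lintegral_prod_mul (μ := μ) (ν := μ) hf (aemeasurable_const (b := (1 : ℝ≥0∞)))
  simpa [mul_comm] using this

theorem lintegral_comp_snd {α : Type*} [MeasurableSpace α] (μ : Measure α) [SFinite μ]
    {f : α → ℝ≥0∞} (hf : AEMeasurable f μ) :
    ∫⁻ z, f z.2 ∂(μ.prod μ) = μ Set.univ * ∫⁻ x, f x ∂μ := by
  have := lintegral_prod_mul (μ := μ) (ν := μ) (aemeasurable_const (b := (1 : ℝ≥0∞))) hf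
  simpa [mul_comm] using this

/-- The mean square oscillation over a convex set that is relatively compact in the domain. -/
theorem oscillation_le_of_subset_compact (hΩ : IsOpen Ω) (hb : Bornology.IsBounded Ω)
    {u : Euc d → ℝ} {g : Euc d → Euc d}
    (hu : MemLp u 2 (volume.restrict Ω)) (hg : MemLp g 2 (volume.restrict Ω))
    (hw : HasWeakGrad Ω u g) {K : Set (Euc d)} (hK : IsCompact K) (hKΩ : K ⊆ Ω)
    {C : Set (Euc d)} (hC : Convex ℝ C) (hCm : MeasurableSet C) (hCK : C ⊆ K) {h : ℝ≥0∞}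
    (hh : h ≠ ⊤) (hdiam : ∀ x ∈ C, ∀ y ∈ C, ‖x - y‖ₑ ≤ h) :
    ∫⁻ z, ‖u z.1 - u z.2‖ₑ ^ 2 ∂((volume.restrict C).prod (volume.restrict C)) ≤
      6 * (h ^ 2 * (2 ^ d * volume C * ∫⁻ x in C, ‖g x‖ₑ ^ 2)) := by
  set μ := volume.restrict C with hμ
  have hvol : volume C ≠ ⊤ := ((measure_mono hCK).trans_lt hK.measure_lt_top).ne
  have hCΩ : μ ≤ volume.restrict Ω := Measure.restrict_mono (hCK.trans hKΩ) le_rfl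
  have huC : MemLp u 2 μ := hu.mono_measure hCΩ
  have hgC : MemLp g 2 μ := hg.mono_measure hCΩ
  -- The total coefficient of the approximation error `ε ^ 2` in `hkey`; its finiteness is what lets
  -- the error tend to zero.
  set Y : ℝ≥0∞ := 6 * (h ^ 2 * (2 ^ d * volume C)) + 6 * volume C
  have hY : Y ≠ ⊤ := by
    simp only [Y]
    finiteness
  have hkey : ∀ ε : ℝ≥0∞, ε ≠ 0 →
      ∫⁻ z, ‖u z.1 - u z.2‖ₑ ^ 2 ∂(μ.prod μ) ≤
        6 * (h ^ 2 * (2 ^ d * volume C * ∫⁻ x, ‖g x‖ₑ ^ 2 ∂μ)) + ε ^ 2 * Y := by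
    intro ε hε
    obtain ⟨v, hv, -, hvu, hvg⟩ := exists_smooth_approx hΩ hb hu hg hw hK hKΩ hε
    have hCK' : μ ≤ volume.restrict K := Measure.restrict_mono hCK le_rfl
    have hvm : Measurable v := hv.continuous.measurable
    have hvgm : Measurable (gradient v) := by
      unfold gradient
      exact (LinearIsometryEquiv.continuous _).measurable.comp
        (hv.continuous_fderiv (by simp)).measurable
    have hfm : AEMeasurable (fun x => ‖v x - u x‖ₑ ^ 2) μ :=
      (hvm.aestronglyMeasurable.sub huC.1).enorm.pow_const 2
    have h1 : ∫⁻ x, ‖v x - u x‖ₑ ^ 2 ∂μ ≤ ε ^ 2 := by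
      rw [← eLpNorm_two_sq]
      gcongr
      exact (eLpNorm_mono_measure _ hCK').trans hvu
    have h2 : ∫⁻ x, ‖gradient v x - g x‖ₑ ^ 2 ∂μ ≤ ε ^ 2 := by
      rw [← eLpNorm_two_sq]
      gcongr
      exact (eLpNorm_mono_measure _ hCK').trans hvg
    have h3 : ∫⁻ x, ‖gradient v x‖ₑ ^ 2 ∂μ ≤ 2 * (ε ^ 2 + ∫⁻ x, ‖g x‖ₑ ^ 2 ∂μ) := by
      calc ∫⁻ x, ‖gradient v x‖ₑ ^ 2 ∂μ
          ≤ ∫⁻ x, 2 * (‖gradient v x - g x‖ₑ ^ 2 + ‖g x‖ₑ ^ 2) ∂μ :=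
            lintegral_mono fun x => enorm_sq_le_two _ _
        _ = 2 * (∫⁻ x, ‖gradient v x - g x‖ₑ ^ 2 ∂μ + ∫⁻ x, ‖g x‖ₑ ^ 2 ∂μ) := by
            rw [lintegral_const_mul' _ _ (by norm_num), lintegral_add_right' _
              (hgC.1.enorm.pow_const 2)]
        _ ≤ _ := by gcongr
    have hosc := oscillation_le_of_contDiff hv hC hCm hdiam
    calc ∫⁻ z, ‖u z.1 - u z.2‖ₑ ^ 2 ∂(μ.prod μ)
        ≤ ∫⁻ z, 3 * (‖v z.1 - v z.2‖ₑ ^ 2 + ‖v z.1 - u z.1‖ₑ ^ 2 + ‖v z.2 - u z.2‖ₑ ^ 2)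
            ∂(μ.prod μ) := lintegral_mono fun z => enorm_sub_sq_le_three _ _ _ _
      _ = 3 * (∫⁻ z, ‖v z.1 - v z.2‖ₑ ^ 2 ∂(μ.prod μ) + volume C * ∫⁻ x, ‖v x - u x‖ₑ ^ 2 ∂μ +
            volume C * ∫⁻ x, ‖v x - u x‖ₑ ^ 2 ∂μ) := by
          have e1 := lintegral_comp_fst μ hfm
          have e2 := lintegral_comp_snd μ hfm
          have hun : μ Set.univ = volume C := by simp [hμ]
          rw [hun] at e1 e2
          rw [lintegral_const_mul' _ _ (by norm_num), lintegral_add_right' _ hfm.comp_snd,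
            lintegral_add_right' _ hfm.comp_fst, e1, e2]
      _ ≤ 3 * (h ^ 2 * (2 ^ d * volume C * (2 * (ε ^ 2 + ∫⁻ x, ‖g x‖ₑ ^ 2 ∂μ))) +
            volume C * ε ^ 2 + volume C * ε ^ 2) := by
          gcongr
          exact hosc.trans (by gcongr)
      _ = _ := by simp only [Y]; ring
  have hlim : Tendsto (fun n : ℕ => 6 * (h ^ 2 * (2 ^ d * volume C * ∫⁻ x, ‖g x‖ₑ ^ 2 ∂μ)) +
      ((n : ℝ≥0∞)⁻¹ * (n : ℝ≥0∞)⁻¹) * Y) atTop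
      (𝓝 (6 * (h ^ 2 * (2 ^ d * volume C * ∫⁻ x, ‖g x‖ₑ ^ 2 ∂μ)) + (0 * 0) * Y)) := by
    refine tendsto_const_nhds.add (ENNReal.Tendsto.mul_const ?_ (Or.inr hY))
    exact ENNReal.Tendsto.mul ENNReal.tendsto_inv_nat_nhds_zero (Or.inr (by simp))
      ENNReal.tendsto_inv_nat_nhds_zero (Or.inr (by simp))
  rw [zero_mul, zero_mul, add_zero] at hlim
  refine ge_of_tendsto hlim (Eventually.of_forall fun n => ?_)
  rw [← sq]
  exact hkey _ (by simp)

end Oscillation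

/-! ### Compactness of the embedding of H¹ of the ball into L² -/

section BallCompactness

variable {d : ℕ}

/-- The mean square oscillation over a convex subset of the unit ball. -/
theorem oscillation_le_ball {u : Euc d → ℝ} {g : Euc d → Euc d}
    (hu : MemLp u 2 (volume.restrict (unitBall d))) (hg : MemLp g 2 (volume.restrict (unitBall d)))
    (hw : HasWeakGrad (unitBall d) u g) {C : Set (Euc d)} (hC : Convex ℝ C)
    (hCm : MeasurableSet C) (hCB : C ⊆ unitBall d) {h : ℝ≥0∞} (hh : h ≠ ⊤)
    (hdiam : ∀ x ∈ C, ∀ y ∈ C, ‖x - y‖ₑ ≤ h) :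
    ∫⁻ z, ‖u z.1 - u z.2‖ₑ ^ 2 ∂((volume.restrict C).prod (volume.restrict C)) ≤
      6 * (h ^ 2 * (2 ^ d * volume C * ∫⁻ x in C, ‖g x‖ₑ ^ 2)) := by
  -- Smooth approximation works only on compact subsets, and `C` may touch the sphere. It is
  -- exhausted by its intersections with smaller closed balls, which remain convex; the bound does
  -- not depend on `n`.
  set ρ : ℕ → ℝ := fun n => 1 - 1 / ((n : ℝ) + 1)
  have hρ1 : ∀ n, ρ n < 1 := fun n => by
    have : (0 : ℝ) < 1 / ((n : ℝ) + 1) := by positivity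
    simp only [ρ]; linarith
  have hρm : Monotone ρ := fun m n hmn => by
    simp only [ρ]
    gcongr
  set Cn : ℕ → Set (Euc d) := fun n => C ∩ Metric.closedBall 0 (ρ n)
  have hCn : Monotone Cn := fun m n hmn =>
    Set.inter_subset_inter_right _ (Metric.closedBall_subset_closedBall (hρm hmn))
  have hunion : C ×ˢ C = ⋃ n, Cn n ×ˢ Cn n := by
    refine Set.Subset.antisymm ?_ (Set.iUnion_subset fun n =>
      Set.prod_mono Set.inter_subset_left Set.inter_subset_left)
    rintro ⟨x, y⟩ ⟨hx, hy⟩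
    have hx1 : ‖x‖ < 1 := by simpa using hCB hx
    have hy1 : ‖y‖ < 1 := by simpa using hCB hy
    obtain ⟨n, hn⟩ := exists_nat_one_div_lt (sub_pos.mpr (max_lt hx1 hy1))
    refine Set.mem_iUnion.mpr ⟨n, ⟨hx, ?_⟩, ⟨hy, ?_⟩⟩ <;>
    · rw [mem_closedBall_zero_iff]
      simp only [ρ]
      have := le_max_left ‖x‖ ‖y‖
      have := le_max_right ‖x‖ ‖y‖
      linarith
  rw [Measure.prod_restrict, hunion, setLIntegral_iUnion_of_directed]
  · refine iSup_le fun n => ?_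
    rw [← Measure.prod_restrict]
    have hKB : Metric.closedBall (0 : Euc d) (ρ n) ⊆ unitBall d :=
      Metric.closedBall_subset_ball (hρ1 n)
    refine (oscillation_le_of_subset_compact Metric.isOpen_ball Metric.isBounded_ball hu hg hw
      (isCompact_closedBall 0 (ρ n)) hKB (hC.inter (convex_closedBall 0 (ρ n)))
      (hCm.inter measurableSet_closedBall) Set.inter_subset_right hh
      fun x hx y hy => hdiam x hx.1 y hy.1).trans ?_
    gcongr
    · exact Set.inter_subset_left
    · exact Set.inter_subset_left
  · exact Monotone.directed_le (f := fun n => Cn n ×ˢ Cn n) fun m n hmn =>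
      Set.prod_mono (hCn hmn) (hCn hmn)

/-- Expanding the square shows that the double integral is the variance up to normalization, which
turns an oscillation bound into a Poincaré inequality. -/
theorem integral_oscillation {α : Type*} [MeasurableSpace α] (μ : Measure α) [IsFiniteMeasure μ]
    {u : α → ℝ} (hu : MemLp u 2 μ) :
    ∫ z, ‖u z.1 - u z.2‖ ^ 2 ∂(μ.prod μ) =
      2 * (μ.real Set.univ * ∫ x, u x ^ 2 ∂μ) - 2 * (∫ x, u x ∂μ) ^ 2 := by
  have h1 : Integrable u μ := hu.integrable (by norm_num)
  have h2 : Integrable (fun x => u x ^ 2) μ := hu.integrable_sq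
  have e1 : ∀ z : α × α, ‖u z.1 - u z.2‖ ^ 2 =
      u z.1 ^ 2 * 1 + 1 * u z.2 ^ 2 - 2 * (u z.1 * u z.2) := fun z => by
    rw [Real.norm_eq_abs, sq_abs]; ring
  simp only [e1]
  have i1 : Integrable (fun z : α × α => u z.1 ^ 2 * 1) (μ.prod μ) :=
    h2.mul_prod (integrable_const (1 : ℝ))
  have i2 : Integrable (fun z : α × α => 1 * u z.2 ^ 2) (μ.prod μ) :=
    (integrable_const (1 : ℝ)).mul_prod h2
  have i3 : Integrable (fun z : α × α => u z.1 * u z.2) (μ.prod μ) := h1.mul_prod h1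
  have i12 : Integrable (fun z : α × α => u z.1 ^ 2 * 1 + 1 * u z.2 ^ 2) (μ.prod μ) := i1.add i2
  rw [integral_sub i12 (i3.const_mul 2), integral_add i1 i2,
    integral_prod_mul (fun x => u x ^ 2) (fun _ => (1 : ℝ)),
    integral_prod_mul (fun _ => (1 : ℝ)) (fun x => u x ^ 2), integral_const_mul,
    integral_prod_mul u u]
  simp only [integral_const, smul_eq_mul, mul_one]
  ring

theorem ofReal_integral_norm_sq {α V : Type*} [MeasurableSpace α] {μ : Measure α}
    [NormedAddCommGroup V] {f : α → V} (hf : MemLp f 2 μ) :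
    ENNReal.ofReal (∫ x, ‖f x‖ ^ 2 ∂μ) = ∫⁻ x, ‖f x‖ₑ ^ 2 ∂μ := by
  rw [ofReal_integral_eq_lintegral_ofReal (hf.integrable_norm_pow (by norm_num))
    (Eventually.of_forall fun x => by positivity)]
  simp only [enorm_sq_eq_ofReal]

/-- A Poincaré inequality on convex subsets of the ball. -/
theorem integral_sq_le_of_convex {u : Euc d → ℝ} {g : Euc d → Euc d}
    (hu : MemLp u 2 (volume.restrict (unitBall d))) (hg : MemLp g 2 (volume.restrict (unitBall d)))
    (hw : HasWeakGrad (unitBall d) u g) {C : Set (Euc d)} (hC : Convex ℝ C)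
    (hCm : MeasurableSet C) (hCB : C ⊆ unitBall d) {h : ℝ} (hh : 0 ≤ h)
    (hdiam : ∀ x ∈ C, ∀ y ∈ C, ‖x - y‖ ≤ h) :
    ∫ x in C, u x ^ 2 ≤ 3 * 2 ^ d * h ^ 2 * (∫ x in C, ‖g x‖ ^ 2) +
      ((√(volume.real C))⁻¹ * ∫ x in C, u x) ^ 2 := by
  have hfin : volume C ≠ ⊤ := ((measure_mono hCB).trans_lt measure_ball_lt_top).ne
  have hCΩ : volume.restrict C ≤ volume.restrict (unitBall d) := Measure.restrict_mono hCB le_rfl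
  have huC := hu.mono_measure hCΩ
  have hgC := hg.mono_measure hCΩ
  have hg0 : 0 ≤ ∫ x in C, ‖g x‖ ^ 2 := integral_nonneg fun x => by positivity
  -- Grid pieces may be null; then all integrals over `C` vanish and the inverse square root of the
  -- volume is 0 by convention.
  rcases eq_or_ne (volume C) 0 with h0 | h0
  · rw [Measure.restrict_eq_zero.mpr h0]; simp
  have hfinm : IsFiniteMeasure (volume.restrict C) := ⟨by simpa using hfin.lt_top⟩
  have hvpos : 0 < volume.real C := ENNReal.toReal_pos h0 hfin
  have hosc := oscillation_le_ball hu hg hw hC hCm hCB (h := ENNReal.ofReal h)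
    ENNReal.ofReal_ne_top fun x hx y hy => by
      rw [← ofReal_norm]; exact ENNReal.ofReal_le_ofReal (hdiam x hx y hy)
  have hdiff : MemLp (fun z : Euc d × Euc d => u z.1 - u z.2) 2
      ((volume.restrict C).prod (volume.restrict C)) := (huC.comp_fst _).sub (huC.comp_snd _)
  have hreal : ∫ z, ‖u z.1 - u z.2‖ ^ 2 ∂((volume.restrict C).prod (volume.restrict C)) ≤
      6 * (h ^ 2 * (2 ^ d * volume.real C * ∫ x in C, ‖g x‖ ^ 2)) := by
    have h2d : (2 : ℝ≥0∞) ^ d = ENNReal.ofReal (2 ^ d) := by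
      rw [ENNReal.ofReal_pow (by norm_num)]; simp
    have hv : volume C = ENNReal.ofReal (volume.real C) := (ENNReal.ofReal_toReal hfin).symm
    rw [← ofReal_integral_norm_sq hdiff, ← ofReal_integral_norm_sq hgC, hv,
      show (6 : ℝ≥0∞) = ENNReal.ofReal 6 by simp, h2d, ← ENNReal.ofReal_pow hh,
      ← ENNReal.ofReal_mul (by positivity), ← ENNReal.ofReal_mul (by positivity),
      ← ENNReal.ofReal_mul (by positivity), ← ENNReal.ofReal_mul (by positivity)] at hosc
    exact (ENNReal.ofReal_le_ofReal_iff (by positivity)).mp hosc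
  rw [integral_oscillation _ huC, measureReal_restrict_apply_univ] at hreal
  rw [mul_pow, inv_pow, Real.sq_sqrt hvpos.le]
  rw [← mul_le_mul_iff_right₀ hvpos]
  have : volume.real C * (3 * 2 ^ d * h ^ 2 * (∫ x in C, ‖g x‖ ^ 2) +
      (volume.real C)⁻¹ * (∫ x in C, u x) ^ 2) =
      3 * (h ^ 2 * (2 ^ d * volume.real C * ∫ x in C, ‖g x‖ ^ 2)) + (∫ x in C, u x) ^ 2 := by
    field_simp
  rw [this]
  linarith

/-- The pieces of a partition of the unit ball by a grid of mesh `1 / N`. -/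
def gridPiece (d N : ℕ) (z : Fin d → ℤ) : Set (Euc d) :=
  {x | x ∈ unitBall d ∧ ∀ k, ⌊(N : ℝ) * x k⌋ = z k}

theorem convex_gridPiece (N : ℕ) (z : Fin d → ℤ) : Convex ℝ (gridPiece d N z) := by
  have : gridPiece d N z = unitBall d ∩ ⋂ k, {x : Euc d | (N : ℝ) * x k ∈
      Set.Ico (z k : ℝ) (z k + 1)} := by
    ext x
    simp [gridPiece, Int.floor_eq_iff]
  rw [this]
  refine (convex_ball 0 1).inter (convex_iInter fun k => ?_)
  exact (convex_Ico (z k : ℝ) (z k + 1)).is_linear_preimage (f := fun x : Euc d => (N : ℝ) * x k)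
    ⟨fun x y => by simp [mul_add], fun c x => by simp; ring⟩

theorem measurableSet_gridPiece (N : ℕ) (z : Fin d → ℤ) : MeasurableSet (gridPiece d N z) := by
  have : gridPiece d N z = unitBall d ∩ ⋂ k, {x : Euc d | ⌊(N : ℝ) * x k⌋ = z k} := by
    ext x
    simp [gridPiece]
  rw [this]
  refine measurableSet_ball.inter (MeasurableSet.iInter fun k => ?_)
  exact (Int.measurable_floor.comp (by fun_prop : Measurable fun x : Euc d => (N : ℝ) * x k))
    (measurableSet_singleton (z k))

theorem gridPiece_subset (N : ℕ) (z : Fin d → ℤ) : gridPiece d N z ⊆ unitBall d := fun _ h => h.1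

theorem norm_sub_le_of_mem_gridPiece {N : ℕ} (hN : 0 < N) {z : Fin d → ℤ} {x y : Euc d}
    (hx : x ∈ gridPiece d N z) (hy : y ∈ gridPiece d N z) : ‖x - y‖ ≤ √d / N := by
  have hN' : (0 : ℝ) < N := by exact_mod_cast hN
  have hk : ∀ k, |x k - y k| ≤ 1 / N := by
    intro k
    have h1 := Int.abs_sub_lt_one_of_floor_eq_floor ((hx.2 k).trans (hy.2 k).symm)
    rw [← mul_sub, abs_mul, abs_of_pos hN'] at h1
    rw [le_div_iff₀ hN']
    linarith
  rw [EuclideanSpace.norm_eq]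
  calc √(∑ i, ‖(x - y) i‖ ^ 2) ≤ √(∑ _i : Fin d, (1 / (N : ℝ)) ^ 2) := by
        refine Real.sqrt_le_sqrt (Finset.sum_le_sum fun i _ => ?_)
        have := hk i
        rw [PiLp.sub_apply, Real.norm_eq_abs]
        gcongr
    _ = √d / N := by
        rw [Finset.sum_const, Finset.card_univ, Fintype.card_fin, nsmul_eq_mul,
          Real.sqrt_mul (by positivity), Real.sqrt_sq (by positivity)]
        ring

/-- The index set of the grid partition. -/
def gridIndex (d N : ℕ) : Finset (Fin d → ℤ) :=
  Fintype.piFinset fun _ => Finset.Icc (-(N : ℤ)) N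

theorem iUnion_gridPiece (N : ℕ) : ⋃ z ∈ gridIndex d N, gridPiece d N z = unitBall d := by
  refine Set.Subset.antisymm (Set.iUnion₂_subset fun z _ => gridPiece_subset N z) fun x hx => ?_
  refine Set.mem_iUnion₂.mpr ⟨fun k => ⌊(N : ℝ) * x k⌋, ?_, hx, fun k => rfl⟩
  rw [gridIndex, Fintype.mem_piFinset]
  intro k
  have hx1 : ‖x‖ < 1 := by simpa using hx
  have hk : |x k| ≤ 1 := by
    have := PiLp.norm_apply_le x k
    rw [Real.norm_eq_abs] at this
    linarith
  obtain ⟨h1, h2⟩ := abs_le.mp hk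
  have hN : (0 : ℝ) ≤ N := by positivity
  rw [Finset.mem_Icc]
  constructor
  · rw [Int.le_floor]; push_cast; nlinarith
  · have : ((⌊(N : ℝ) * x k⌋ : ℤ) : ℝ) ≤ N := (Int.floor_le _).trans (by nlinarith)
    exact_mod_cast this

theorem pairwiseDisjoint_gridPiece (N : ℕ) (s : Set (Fin d → ℤ)) :
    s.PairwiseDisjoint (gridPiece d N) := by
  intro z _ z' _ hzz
  refine Set.disjoint_left.mpr fun x hx hx' => hzz ?_
  funext k
  exact (hx.2 k).symm.trans (hx'.2 k)

theorem integral_ball_eq_sum (N : ℕ) {f : Euc d → ℝ}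
    (hf : Integrable f (volume.restrict (unitBall d))) :
    ∫ x in unitBall d, f x = ∑ z ∈ gridIndex d N, ∫ x in gridPiece d N z, f x := by
  rw [← iUnion_gridPiece N]
  refine integral_biUnion_finset _ (fun z _ => measurableSet_gridPiece N z)
    (pairwiseDisjoint_gridPiece N _) fun z _ => ?_
  exact IntegrableOn.mono_set hf (gridPiece_subset N z)

/-- The embedding of `H¹` of the unit ball into `L²` is compact. -/
theorem compactFst_H1_ball : CompactFst (H1 (unitBall d)) := by
  rw [← coe_H1Sub]
  refine compactFst_of_functionals _ fun ε hε => ?_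
  -- Pieces of mesh `1 / N` have diameter at most `√d / N`; this choice makes the Poincaré constant
  -- at most `ε`.
  obtain ⟨N, hN⟩ := exists_nat_gt (3 * 2 ^ d * d / ε)
  have hN0 : (0 : ℝ) < N := lt_of_le_of_lt (by positivity) hN
  have hN1 : 1 ≤ N := by exact_mod_cast hN0
  have hsmall : 3 * 2 ^ d * (√d / N) ^ 2 ≤ ε := by
    rw [div_pow, Real.sq_sqrt (by positivity), ← mul_div_assoc, div_le_iff₀ (by positivity)]
    rw [div_lt_iff₀ hε] at hN
    have h1 : (1 : ℝ) ≤ N := by exact_mod_cast hN1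
    have : (N : ℝ) * ε ≤ ε * N ^ 2 := by nlinarith [mul_nonneg hε.le (sub_nonneg.mpr h1)]
    linarith
  have hfin : ∀ z, (volume.restrict (unitBall d)) (gridPiece d N z) ≠ ⊤ := fun z =>
    ((Measure.restrict_le_self _).trans_lt ((measure_mono (gridPiece_subset N z)).trans_lt
      measure_ball_lt_top)).ne
  -- The functionals are normalized indicators of the pieces, so their squares are exactly the
  -- mean-value terms of the Poincaré inequality.
  refine ⟨gridIndex d N, inferInstance, fun z => (√(volume.real (gridPiece d N z)))⁻¹ •
    indicatorConstLp 2 (measurableSet_gridPiece N z) (hfin z) (1 : ℝ), fun p hp => ?_⟩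
  have hu := Lp.memLp p.1
  have hg := Lp.memLp p.2
  have hpiece : ∀ z, ∫ x in gridPiece d N z, p.1 x ^ 2 ≤
      ε * (∫ x in gridPiece d N z, ‖p.2 x‖ ^ 2) +
        ((√(volume.real (gridPiece d N z)))⁻¹ * ∫ x in gridPiece d N z, p.1 x) ^ 2 := by
    intro z
    refine (integral_sq_le_of_convex hu hg hp (convex_gridPiece N z) (measurableSet_gridPiece N z)
      (gridPiece_subset N z) (h := √d / N) (by positivity)
      fun x hx y hy => norm_sub_le_of_mem_gridPiece hN1 hx hy).trans ?_
    have : 0 ≤ ∫ x in gridPiece d N z, ‖p.2 x‖ ^ 2 := integral_nonneg fun x => by positivity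
    gcongr
  rw [norm_sq_Lp, norm_sq_Lp, integral_ball_eq_sum N (hu.integrable_norm_pow (by norm_num)),
    integral_ball_eq_sum N (hg.integrable_norm_pow (by norm_num)), Finset.mul_sum,
    Finset.sum_coe_sort (gridIndex d N) (fun z => (inner ℝ
      ((√(volume.real (gridPiece d N z)))⁻¹ •
        indicatorConstLp 2 (measurableSet_gridPiece N z) (hfin z) (1 : ℝ)) p.1) ^ 2),
    ← Finset.sum_add_distrib]
  refine Finset.sum_le_sum fun z _ => ?_
  rw [real_inner_smul_left, L2.inner_indicatorConstLp_one,
    Measure.restrict_restrict (measurableSet_gridPiece N z),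
    Set.inter_eq_left.mpr (gridPiece_subset N z)]
  simpa only [Real.norm_eq_abs, sq_abs] using hpiece z

end BallCompactness

/-! ### Pullback by bi-Lipschitz maps with constant Jacobian -/

section Pullback

variable {d : ℕ}

theorem ennreal_le_of_sq_le {a b : ℝ≥0∞} (h : a ^ 2 ≤ b ^ 2) : a ≤ b := by
  rw [← ENNReal.rpow_natCast, ← ENNReal.rpow_natCast (n := 2) (x := b)] at h
  exact (ENNReal.rpow_le_rpow_iff (by norm_num)).mp h

/-- A bi-Lipschitz homeomorphism that multiplies volumes by a constant. -/
structure IsBiLip (F : Euc d ≃ₜ Euc d) (m : ℝ≥0) : Prop where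
  lip : ∃ K, LipschitzWith K F
  lip_symm : ∃ K, LipschitzWith K F.symm
  map_eq : Measure.map F volume = m • (volume : Measure (Euc d))
  ne_zero : m ≠ 0

namespace IsBiLip

variable {F : Euc d ≃ₜ Euc d} {m : ℝ≥0} {Ω Ω' : Set (Euc d)}

theorem symm (hF : IsBiLip F m) : IsBiLip F.symm m⁻¹ where
  lip := hF.lip_symm
  lip_symm := hF.lip
  map_eq := by
    have h : Measure.map F.symm (Measure.map F volume) = (volume : Measure (Euc d)) := by
      rw [Measure.map_map F.symm.measurable F.measurable]
      simp
    rw [hF.map_eq, Measure.map_smul] at h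
    rw [← h, smul_smul, h, inv_mul_cancel₀ hF.ne_zero, one_smul]
  ne_zero := inv_ne_zero hF.ne_zero

theorem map_restrict (hF : IsBiLip F m) (hΩ : F ⁻¹' Ω' = Ω) (hΩ' : MeasurableSet Ω') :
    Measure.map F (volume.restrict Ω) = m • volume.restrict Ω' := by
  rw [← hΩ, ← Measure.restrict_map F.measurable hΩ', hF.map_eq, Measure.restrict_smul]

theorem lintegral_comp (hF : IsBiLip F m) (hΩ : F ⁻¹' Ω' = Ω) (hΩ' : MeasurableSet Ω')
    (f : Euc d → ℝ≥0∞) : ∫⁻ x in Ω, f (F x) = m * ∫⁻ y in Ω', f y := by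
  rw [← F.measurableEmbedding.lintegral_map, hF.map_restrict hΩ hΩ', lintegral_smul_measure]
  rfl

theorem integral_comp (hF : IsBiLip F m) (hΩ : F ⁻¹' Ω' = Ω) (hΩ' : MeasurableSet Ω')
    (f : Euc d → ℝ) : ∫ x in Ω, f (F x) = m * ∫ y in Ω', f y := by
  rw [← F.measurableEmbedding.integral_map, hF.map_restrict hΩ hΩ',
    integral_smul_nnreal_measure]
  rfl

theorem quasiMeasurePreserving (hF : IsBiLip F m) (hΩ : F ⁻¹' Ω' = Ω) (hΩ' : MeasurableSet Ω') :
    Measure.QuasiMeasurePreserving F (volume.restrict Ω) (volume.restrict Ω') :=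
  ⟨F.measurable, by
    rw [hF.map_restrict hΩ hΩ']
    exact Measure.smul_absolutelyContinuous⟩

theorem memLp_comp {V : Type*} [NormedAddCommGroup V] (hF : IsBiLip F m) (hΩ : F ⁻¹' Ω' = Ω)
    (hΩ' : MeasurableSet Ω') {u : Euc d → V} (hu : MemLp u 2 (volume.restrict Ω')) :
    MemLp (fun x => u (F x)) 2 (volume.restrict Ω) := by
  have h : MemLp u 2 (Measure.map F (volume.restrict Ω)) := by
    rw [hF.map_restrict hΩ hΩ']
    exact hu.smul_measure (c := (m : ℝ≥0∞)) ENNReal.coe_ne_top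
  exact h.comp_of_map F.measurable.aemeasurable

end IsBiLip

/-- The pulled back vector field `DFᵀ (g ∘ F)`. -/
def pullField (F : Euc d → Euc d) (g : Euc d → Euc d) (x : Euc d) : Euc d :=
  ContinuousLinearMap.adjoint (fderiv ℝ F x) (g (F x))

theorem measurable_adjoint_fderiv (F : Euc d → Euc d) :
    Measurable fun x => ContinuousLinearMap.adjoint (fderiv ℝ F x) :=
  (LinearIsometryEquiv.continuous ContinuousLinearMap.adjoint).measurable.comp
    (measurable_fderiv ℝ F)

theorem enorm_pullField_le {F : Euc d → Euc d} {K : ℝ≥0} (hK : LipschitzWith K F)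
    (g : Euc d → Euc d) (x : Euc d) : ‖pullField F g x‖ₑ ≤ K * ‖g (F x)‖ₑ := by
  have h1 : ‖pullField F g x‖ ≤ K * ‖g (F x)‖ := by
    refine (ContinuousLinearMap.le_opNorm _ _).trans ?_
    gcongr
    rw [LinearIsometryEquiv.norm_map]
    exact norm_fderiv_le_of_lipschitz ℝ hK
  rw [← ofReal_norm, ← ofReal_norm]
  refine (ENNReal.ofReal_le_ofReal h1).trans (le_of_eq ?_)
  rw [ENNReal.ofReal_mul (by positivity), ENNReal.ofReal_coe_nnreal]

theorem pullField_sub (F : Euc d → Euc d) (g h : Euc d → Euc d) (x : Euc d) :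
    pullField F g x - pullField F h x = pullField F (fun y => g y - h y) x := by
  simp [pullField]

namespace IsBiLip

variable {F : Euc d ≃ₜ Euc d} {m : ℝ≥0} {Ω Ω' : Set (Euc d)}

theorem aestronglyMeasurable_pullField (hF : IsBiLip F m) (hΩ : F ⁻¹' Ω' = Ω)
    (hΩ' : MeasurableSet Ω') {g : Euc d → Euc d}
    (hg : AEStronglyMeasurable g (volume.restrict Ω')) :
    AEStronglyMeasurable (pullField F g) (volume.restrict Ω) :=
  ContinuousLinearMap.aestronglyMeasurable_comp₂ (ContinuousLinearMap.id ℝ (Euc d →L[ℝ] Euc d))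
    (measurable_adjoint_fderiv F).aestronglyMeasurable
    (hg.comp_quasiMeasurePreserving (hF.quasiMeasurePreserving hΩ hΩ'))

theorem memLp_pullField (hF : IsBiLip F m) (hΩ : F ⁻¹' Ω' = Ω) (hΩ' : MeasurableSet Ω')
    {g : Euc d → Euc d} (hg : MemLp g 2 (volume.restrict Ω')) :
    MemLp (pullField F g) 2 (volume.restrict Ω) := by
  obtain ⟨K, hK⟩ := hF.lip
  refine MemLp.of_le_mul (c := K) (hF.memLp_comp hΩ hΩ' hg)
    (hF.aestronglyMeasurable_pullField hΩ hΩ' hg.1) (Eventually.of_forall fun x => ?_)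
  have h := enorm_pullField_le hK g x
  rw [← ofReal_norm, ← ofReal_norm, ← ENNReal.ofReal_coe_nnreal,
    ← ENNReal.ofReal_mul (by positivity)] at h
  exact (ENNReal.ofReal_le_ofReal_iff (by positivity)).mp h

/-- Pullback of functions. -/
def pullFun (hF : IsBiLip F m) (hΩ : F ⁻¹' Ω' = Ω) (hΩ' : MeasurableSet Ω') (u : L2 Ω') : L2 Ω :=
  (hF.memLp_comp hΩ hΩ' (Lp.memLp u)).toLp _

/-- Pullback of gradients. -/
def pullVec (hF : IsBiLip F m) (hΩ : F ⁻¹' Ω' = Ω) (hΩ' : MeasurableSet Ω') (g : L2vec Ω') :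
    L2vec Ω :=
  (hF.memLp_pullField hΩ hΩ' (Lp.memLp g)).toLp _

theorem coeFn_pullFun (hF : IsBiLip F m) (hΩ : F ⁻¹' Ω' = Ω) (hΩ' : MeasurableSet Ω')
    (u : L2 Ω') : hF.pullFun hΩ hΩ' u =ᵐ[volume.restrict Ω] fun x => u (F x) :=
  MemLp.coeFn_toLp _

theorem coeFn_pullVec (hF : IsBiLip F m) (hΩ : F ⁻¹' Ω' = Ω) (hΩ' : MeasurableSet Ω')
    (g : L2vec Ω') : hF.pullVec hΩ hΩ' g =ᵐ[volume.restrict Ω] pullField F g :=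
  MemLp.coeFn_toLp _

/-- This is where the constant Jacobian matters: orthogonality survives transplantation, with one
common factor for all functions. -/
theorem inner_pullFun (hF : IsBiLip F m) (hΩ : F ⁻¹' Ω' = Ω) (hΩ' : MeasurableSet Ω')
    (u v : L2 Ω') : inner ℝ (hF.pullFun hΩ hΩ' u) (hF.pullFun hΩ hΩ' v) = m * inner ℝ u v := by
  rw [L2.inner_def, L2.inner_def, ← hF.integral_comp hΩ hΩ']
  refine integral_congr_ae ?_
  filter_upwards [hF.coeFn_pullFun hΩ hΩ' u, hF.coeFn_pullFun hΩ hΩ' v] with x h1 h2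
  rw [h1, h2]

theorem enorm_sq_Lp {α V : Type*} [MeasurableSpace α] {μ : Measure α} [NormedAddCommGroup V]
    (f : Lp V 2 μ) : ‖f‖ₑ ^ 2 = ∫⁻ x, ‖f x‖ₑ ^ 2 ∂μ := by
  rw [Lp.enorm_def, eLpNorm_two_sq]

/-- Up to the factor `√m` the pullback is an isometry; its continuity is what allows passing from
test functions to their closure. -/
theorem lipschitzWith_pullFun (hF : IsBiLip F m) (hΩ : F ⁻¹' Ω' = Ω) (hΩ' : MeasurableSet Ω') :
    LipschitzWith (NNReal.sqrt m) (hF.pullFun hΩ hΩ') := by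
  intro u v
  refine ennreal_le_of_sq_le (le_of_eq ?_)
  rw [mul_pow, edist_eq_enorm_sub, edist_eq_enorm_sub, enorm_sq_Lp, enorm_sq_Lp,
    ← ENNReal.coe_pow, NNReal.sq_sqrt, ← hF.lintegral_comp hΩ hΩ']
  refine lintegral_congr_ae ?_
  filter_upwards [hF.coeFn_pullFun hΩ hΩ' u, hF.coeFn_pullFun hΩ hΩ' v, Lp.coeFn_sub
    (hF.pullFun hΩ hΩ' u) (hF.pullFun hΩ hΩ' v),
    (hF.quasiMeasurePreserving hΩ hΩ').ae (Lp.coeFn_sub u v)] with x h1 h2 h3 h4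
  rw [h3, h4, Pi.sub_apply, Pi.sub_apply, h1, h2]

theorem enorm_pullVec_sub_le (hF : IsBiLip F m) (hΩ : F ⁻¹' Ω' = Ω) (hΩ' : MeasurableSet Ω')
    {K : ℝ≥0} (hK : LipschitzWith K F) :
    LipschitzWith (K * NNReal.sqrt m) (hF.pullVec hΩ hΩ') := by
  intro u v
  refine ennreal_le_of_sq_le ?_
  rw [mul_pow, edist_eq_enorm_sub, edist_eq_enorm_sub, enorm_sq_Lp, enorm_sq_Lp,
    ← ENNReal.coe_pow, mul_pow, NNReal.sq_sqrt, ENNReal.coe_mul, mul_assoc,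
    ← hF.lintegral_comp hΩ hΩ', ← lintegral_const_mul' _ _ ENNReal.coe_ne_top]
  refine lintegral_mono_ae ?_
  filter_upwards [hF.coeFn_pullVec hΩ hΩ' u, hF.coeFn_pullVec hΩ hΩ' v, Lp.coeFn_sub
    (hF.pullVec hΩ hΩ' u) (hF.pullVec hΩ hΩ' v),
    (hF.quasiMeasurePreserving hΩ hΩ').ae (Lp.coeFn_sub u v)] with x h1 h2 h3 h4
  rw [h3, h4, Pi.sub_apply, Pi.sub_apply, h1, h2, pullField_sub, ENNReal.coe_pow, ← mul_pow]
  gcongr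
  exact enorm_pullField_le hK _ _

end IsBiLip

/-- The gradient of a composition with a Lipschitz map. -/
theorem gradient_comp_ae {F : Euc d → Euc d} {K : ℝ≥0} (hK : LipschitzWith K F) {v : Euc d → ℝ}
    (hv : Differentiable ℝ v) :
    ∀ᵐ x, gradient (fun x => v (F x)) x = pullField F (gradient v) x := by
  filter_upwards [hK.ae_differentiableAt (μ := volume)] with x hx
  refine ext_inner_right ℝ fun e => ?_
  have h : HasFDerivAt (fun x => v (F x)) ((fderiv ℝ v (F x)).comp (fderiv ℝ F x)) x :=
    (hv (F x)).hasFDerivAt.comp x hx.hasFDerivAt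
  rw [inner_gradient, h.fderiv, pullField, ContinuousLinearMap.adjoint_inner_left,
    inner_gradient]
  rfl

/-- The L² approximation with Cauchy–Schwarz on `K`. The chain rule is tested against bounded
functions, for which L¹ errors suffice. -/
theorem exists_smooth_approx_L1 {Ω : Set (Euc d)} (hΩ : IsOpen Ω) (hb : Bornology.IsBounded Ω)
    {u : Euc d → ℝ} {g : Euc d → Euc d}
    (hu : MemLp u 2 (volume.restrict Ω)) (hg : MemLp g 2 (volume.restrict Ω))
    (h : HasWeakGrad Ω u g) {K : Set (Euc d)} (hK : IsCompact K) (hKΩ : K ⊆ Ω) {ε : ℝ≥0∞}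
    (hε : ε ≠ 0) :
    ∃ v : Euc d → ℝ, ContDiff ℝ ∞ v ∧ HasCompactSupport v ∧
      ∫⁻ x in K, ‖v x - u x‖ₑ ≤ ε ∧ ∫⁻ x in K, ‖gradient v x - g x‖ₑ ≤ ε := by
  set c : ℝ≥0∞ := volume K ^ (1 / 2 : ℝ)
  have hc : c ≠ ⊤ := ENNReal.rpow_ne_top_of_nonneg (by norm_num) hK.measure_lt_top.ne
  have hε' : ε / (c + 1) ≠ 0 := ENNReal.div_ne_zero.mpr ⟨hε, by finiteness⟩
  have hεc : ε / (c + 1) * c ≤ ε := by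
    calc ε / (c + 1) * c ≤ ε / (c + 1) * (c + 1) := by gcongr; exact le_self_add
      _ = ε := ENNReal.div_mul_cancel (by simp) (by finiteness)
  obtain ⟨v, hv, hvc, h1, h2⟩ := exists_smooth_approx hΩ hb hu hg h hK hKΩ hε'
  have hKμ : volume.restrict K ≤ volume.restrict Ω := Measure.restrict_mono hKΩ le_rfl
  have hvgm : Measurable (gradient v) := by
    unfold gradient
    exact (LinearIsometryEquiv.continuous _).measurable.comp
      (hv.continuous_fderiv (by simp)).measurable
  have hgen : ∀ {V : Type} [NormedAddCommGroup V] (f : Euc d → V),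
      AEStronglyMeasurable f (volume.restrict K) →
      eLpNorm f 2 (volume.restrict K) ≤ ε / (c + 1) → ∫⁻ x in K, ‖f x‖ₑ ≤ ε := by
    intro V _ f hf hle
    have h3 := eLpNorm_le_eLpNorm_mul_rpow_measure_univ (p := 1) (q := 2) (by norm_num) hf
    rw [eLpNorm_one_eq_lintegral_enorm] at h3
    refine h3.trans (le_trans ?_ hεc)
    have h4 : (volume.restrict K) Set.univ ^ (1 / ENNReal.toReal 1 - 1 / ENNReal.toReal 2) = c := by
      simp only [c, Measure.restrict_apply_univ]
      norm_num
    rw [h4]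
    gcongr
  exact ⟨v, hv, hvc,
    hgen _ (hv.continuous.aestronglyMeasurable.sub (hu.mono_measure hKμ).1) h1,
    hgen _ (hvgm.aestronglyMeasurable.sub (hg.mono_measure hKμ).1) h2⟩

namespace IsBiLip

variable {F : Euc d ≃ₜ Euc d} {m : ℝ≥0} {Ω Ω' : Set (Euc d)}

/-- The chain rule for weak gradients. -/
theorem hasWeakGrad_comp (hF : IsBiLip F m) (hΩ : F ⁻¹' Ω' = Ω) (hΩ' : IsOpen Ω')
    (hb : Bornology.IsBounded Ω') {u : Euc d → ℝ} {g : Euc d → Euc d}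
    (hu : MemLp u 2 (volume.restrict Ω')) (hg : MemLp g 2 (volume.restrict Ω'))
    (h : HasWeakGrad Ω' u g) : HasWeakGrad Ω (fun x => u (F x)) (pullField F g) := by
  intro φ hφ e
  obtain ⟨K, hK⟩ := hF.lip
  set T := tsupport φ
  have hTm : MeasurableSet T := (isClosed_tsupport φ).measurableSet
  have hTc : IsCompact T := hφ.2.1
  have hKc : IsCompact (F '' T) := hTc.image F.continuous
  have hKΩ : F '' T ⊆ Ω' := by
    rintro _ ⟨x, hx, rfl⟩
    have : x ∈ F ⁻¹' Ω' := hΩ ▸ hφ.2.2 hx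
    exact this
  have hpre : F ⁻¹' (F '' T) = T := F.injective.preimage_image T
  have hTΩ : volume.restrict T ≤ volume.restrict Ω := Measure.restrict_mono hφ.2.2 le_rfl
  have hlin : ∀ f : Euc d → ℝ≥0∞, ∫⁻ x in T, f (F x) = m * ∫⁻ y in F '' T, f y :=
    hF.lintegral_comp hpre hKc.measurableSet
  have hred : ∀ (G : Euc d → ℝ), (∀ x, x ∉ T → G x = 0) → ∫ x in Ω, G x = ∫ x in T, G x := by
    intro G hG
    rw [hφ.setIntegral_eq hG, setIntegral_eq_integral_of_forall_compl_eq_zero hG]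
  have hφ1 : ∀ x, x ∉ T → fderiv ℝ φ x e = 0 := fun x hx => by
    rw [fderiv_eq_zero_of_notMem_tsupport hx]; rfl
  have hφ0 : ∀ x, x ∉ T → φ x = 0 := fun x hx => image_eq_zero_of_notMem_tsupport hx
  rw [hred _ fun x hx => by rw [hφ1 x hx, mul_zero], hred _ fun x hx => by rw [hφ0 x hx, mul_zero],
    eq_neg_iff_add_eq_zero]
  obtain ⟨M0, hM0⟩ := (hφ.1.continuous).bounded_above_of_compact_support hφ.2.1
  obtain ⟨M1, hM1⟩ := ((hφ.1.continuous_fderiv (by simp)).clm_apply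
    (continuous_const (y := e))).bounded_above_of_compact_support (hφ.2.1.fderiv_apply (𝕜 := ℝ) e)
  have hμ0 : MemLp φ 2 (volume.restrict T) :=
    hφ.1.continuous.memLp_of_hasCompactSupport hφ.2.1
  have hμ1 : MemLp (fun x => fderiv ℝ φ x e) 2 (volume.restrict T) := hφ.memLp_fderiv e _
  have hu1 : MemLp (fun x => u (F x)) 2 (volume.restrict T) :=
    (hF.memLp_comp hΩ hΩ'.measurableSet hu).mono_measure hTΩ
  have hg1 : MemLp (fun x => inner ℝ (pullField F g x) e) 2 (volume.restrict T) :=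
    ((hF.memLp_pullField hΩ hΩ'.measurableSet hg).mono_measure hTΩ).inner_const e
  have hi1 : Integrable (fun x => u (F x) * fderiv ℝ φ x e) (volume.restrict T) :=
    hu1.integrable_mul hμ1
  have hi2 : Integrable (fun x => inner ℝ (pullField F g x) e * φ x) (volume.restrict T) :=
    hg1.integrable_mul hμ0
  -- For smooth `v` with compact support, `v ∘ F` is Lipschitz and satisfies the identity exactly.
  -- The defect for `u` is therefore bounded by the L¹ distance from `v` and its gradient,
  -- multiplied by this constant.
  set Cst : ℝ≥0∞ := m * ENNReal.ofReal M1 + m * (K * ‖e‖ₑ * ENNReal.ofReal M0)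
  have hCst : Cst ≠ ⊤ := by simp only [Cst]; finiteness
  have hbound : ∀ ε : ℝ≥0∞, ε ≠ 0 →
      ‖(∫ x in T, u (F x) * fderiv ℝ φ x e) + ∫ x in T, inner ℝ (pullField F g x) e * φ x‖ₑ ≤
        Cst * ε := by
    intro ε hε
    obtain ⟨v, hv, hvc, hvu, hvg⟩ := exists_smooth_approx_L1 hΩ' hb hu hg h hKc hKΩ hε
    obtain ⟨L, hL⟩ := ContDiff.lipschitzWith_of_hasCompactSupport hvc hv (by simp)
    have hvF := hasWeakGrad_of_lipschitz (Ω := Ω) (hL.comp hK) φ hφ e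
    rw [hred _ fun x hx => by rw [hφ1 x hx, mul_zero],
      hred _ fun x hx => by rw [hφ0 x hx, mul_zero], eq_neg_iff_add_eq_zero] at hvF
    have hgr : ∫ x in T, inner ℝ (gradient (v ∘ F) x) e * φ x =
        ∫ x in T, inner ℝ (pullField F (gradient v) x) e * φ x := by
      refine integral_congr_ae (ae_restrict_of_ae ?_)
      filter_upwards [gradient_comp_ae hK (hv.differentiable (by simp))] with x hx
      rw [← hx]; rfl
    rw [hgr] at hvF
    have hv1 : MemLp v 2 (volume.restrict Ω') :=
      hv.continuous.memLp_of_hasCompactSupport hvc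
    have hvg1 : MemLp (gradient v) 2 (volume.restrict Ω') := by
      refine Continuous.memLp_of_hasCompactSupport ?_ ?_
      · exact (LinearIsometryEquiv.continuous _).comp (hv.continuous_fderiv (by simp))
      · exact (hvc.fderiv ℝ).comp_left (map_zero _)
    have hi3 : Integrable (fun x => v (F x) * fderiv ℝ φ x e) (volume.restrict T) :=
      ((hF.memLp_comp hΩ hΩ'.measurableSet hv1).mono_measure hTΩ).integrable_mul hμ1
    have hi4 : Integrable (fun x => inner ℝ (pullField F (gradient v) x) e * φ x)
        (volume.restrict T) :=
      (((hF.memLp_pullField hΩ hΩ'.measurableSet hvg1).mono_measure hTΩ).inner_const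
        e).integrable_mul hμ0
    have hX : (∫ x in T, u (F x) * fderiv ℝ φ x e) +
        ∫ x in T, inner ℝ (pullField F g x) e * φ x =
        -((∫ x in T, (v (F x) - u (F x)) * fderiv ℝ φ x e) +
          ∫ x in T, inner ℝ (pullField F (fun y => gradient v y - g y) x) e * φ x) := by
      have e1 : ∫ x in T, (v (F x) - u (F x)) * fderiv ℝ φ x e =
          (∫ x in T, v (F x) * fderiv ℝ φ x e) - ∫ x in T, u (F x) * fderiv ℝ φ x e := by
        rw [← integral_sub hi3 hi1]
        simp only [sub_mul]
      have e2 : ∫ x in T, inner ℝ (pullField F (fun y => gradient v y - g y) x) e * φ x =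
          (∫ x in T, inner ℝ (pullField F (gradient v) x) e * φ x) -
            ∫ x in T, inner ℝ (pullField F g x) e * φ x := by
        rw [← integral_sub hi4 hi2]
        simp only [← pullField_sub, inner_sub_left, sub_mul]
      have e3 : (∫ x in T, v (F x) * fderiv ℝ φ x e) +
        ∫ x in T, inner ℝ (pullField F (gradient v) x) e * φ x = 0 := hvF
      rw [e1, e2]
      linarith
    rw [hX, enorm_neg]
    refine (enorm_add_le _ _).trans ?_
    rw [add_mul]
    gcongr
    · calc _ ≤ ∫⁻ x in T, ‖(v (F x) - u (F x)) * fderiv ℝ φ x e‖ₑ :=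
            enorm_integral_le_lintegral_enorm _
        _ ≤ ∫⁻ x in T, ‖v (F x) - u (F x)‖ₑ * ENNReal.ofReal M1 := by
            refine lintegral_mono fun x => ?_
            rw [enorm_mul]
            gcongr
            rw [← ofReal_norm]
            exact ENNReal.ofReal_le_ofReal (hM1 x)
        _ = m * (∫⁻ y in F '' T, ‖v y - u y‖ₑ) * ENNReal.ofReal M1 := by
            rw [lintegral_mul_const' _ _ ENNReal.ofReal_ne_top, hlin fun y => ‖v y - u y‖ₑ]
        _ ≤ m * ε * ENNReal.ofReal M1 := by gcongr
        _ = _ := by ring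
    · calc _ ≤ ∫⁻ x in T, ‖inner ℝ (pullField F (fun y => gradient v y - g y) x) e * φ x‖ₑ :=
            enorm_integral_le_lintegral_enorm _
        _ ≤ ∫⁻ x in T, ‖gradient v (F x) - g (F x)‖ₑ * (K * ‖e‖ₑ * ENNReal.ofReal M0) := by
            refine lintegral_mono fun x => ?_
            rw [enorm_mul]
            calc _ ≤ (‖pullField F (fun y => gradient v y - g y) x‖ₑ * ‖e‖ₑ) *
                  ENNReal.ofReal M0 := by
                  gcongr
                  · rw [← ofReal_norm, ← ofReal_norm, ← ofReal_norm,
                      ← ENNReal.ofReal_mul (norm_nonneg _)]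
                    exact ENNReal.ofReal_le_ofReal (norm_inner_le_norm _ _)
                  · rw [← ofReal_norm]
                    exact ENNReal.ofReal_le_ofReal (hM0 x)
              _ ≤ (K * ‖gradient v (F x) - g (F x)‖ₑ * ‖e‖ₑ) * ENNReal.ofReal M0 := by
                  gcongr
                  exact enorm_pullField_le hK _ _
              _ = _ := by ring
        _ = m * (∫⁻ y in F '' T, ‖gradient v y - g y‖ₑ) * (K * ‖e‖ₑ * ENNReal.ofReal M0) := by
            rw [lintegral_mul_const' _ _ (by finiteness), hlin fun y => ‖gradient v y - g y‖ₑ]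
        _ ≤ m * ε * (K * ‖e‖ₑ * ENNReal.ofReal M0) := by gcongr
        _ = _ := by ring
  have hlim : Tendsto (fun n : ℕ => Cst * (n : ℝ≥0∞)⁻¹) atTop (𝓝 (Cst * 0)) :=
    ENNReal.Tendsto.const_mul ENNReal.tendsto_inv_nat_nhds_zero (Or.inr hCst)
  rw [mul_zero] at hlim
  have := ge_of_tendsto hlim (Eventually.of_forall fun n => hbound (n : ℝ≥0∞)⁻¹ (by simp))
  simpa using this

theorem pull_mem_H1 (hF : IsBiLip F m) (hΩ : F ⁻¹' Ω' = Ω) (hΩ' : IsOpen Ω')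
    (hb : Bornology.IsBounded Ω') {p : L2 Ω' × L2vec Ω'} (hp : p ∈ H1 Ω') :
    (hF.pullFun hΩ hΩ'.measurableSet p.1, hF.pullVec hΩ hΩ'.measurableSet p.2) ∈ H1 Ω := by
  intro φ hφ e
  have h := hF.hasWeakGrad_comp hΩ hΩ' hb (Lp.memLp p.1) (Lp.memLp p.2) hp φ hφ e
  calc _ = ∫ x in Ω, p.1 (F x) * fderiv ℝ φ x e := by
        refine integral_congr_ae ?_
        filter_upwards [hF.coeFn_pullFun hΩ hΩ'.measurableSet p.1] with x hx
        rw [hx]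
    _ = _ := h
    _ = _ := by
        congr 1
        refine integral_congr_ae ?_
        filter_upwards [hF.coeFn_pullVec hΩ hΩ'.measurableSet p.2] with x hx
        rw [hx]

/-- By continuity it suffices to treat a test function `φ`. Its pullback `φ ∘ F` is only Lipschitz,
but it has compact support in `Ω`, so mollifications of it are test functions converging in H¹. -/
theorem pull_mem_H10 (hF : IsBiLip F m) (hΩ : F ⁻¹' Ω' = Ω) (hΩ' : IsOpen Ω')
    {p : L2 Ω' × L2vec Ω'} (hp : p ∈ H10 Ω') :
    (hF.pullFun hΩ hΩ'.measurableSet p.1, hF.pullVec hΩ hΩ'.measurableSet p.2) ∈ H10 Ω := by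
  obtain ⟨K, hK⟩ := hF.lip
  have hcont : Continuous fun p : L2 Ω' × L2vec Ω' =>
      (hF.pullFun hΩ hΩ'.measurableSet p.1, hF.pullVec hΩ hΩ'.measurableSet p.2) :=
    ((hF.lipschitzWith_pullFun hΩ hΩ'.measurableSet).continuous.comp continuous_fst).prodMk
      ((hF.enorm_pullVec_sub_le hΩ hΩ'.measurableSet hK).continuous.comp continuous_snd)
  have hcl : IsClosed (H10 Ω) := isClosed_closure
  rw [← hcl.closure_eq]
  suffices hmaps : Set.MapsTo (fun p : L2 Ω' × L2vec Ω' =>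
      (hF.pullFun hΩ hΩ'.measurableSet p.1, hF.pullVec hΩ hΩ'.measurableSet p.2))
      {p | ∃ φ, IsTest Ω' φ ∧ p.1 =ᵐ[volume.restrict Ω'] φ ∧
        p.2 =ᵐ[volume.restrict Ω'] gradient φ} (H10 Ω) from
    map_mem_closure (f := fun p : L2 Ω' × L2vec Ω' =>
      (hF.pullFun hΩ hΩ'.measurableSet p.1, hF.pullVec hΩ hΩ'.measurableSet p.2)) hcont hp hmaps
  rintro q ⟨φ, hφ, h1, h2⟩
  have hΩo : IsOpen Ω := hΩ ▸ hΩ'.preimage F.continuous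
  obtain ⟨L, hL⟩ := ContDiff.lipschitzWith_of_hasCompactSupport hφ.2.1 hφ.1 (by simp)
  set f : Euc d → ℝ := φ ∘ F
  have hfL : LipschitzWith (L * K) f := hL.comp hK
  have hfc : HasCompactSupport f := hφ.2.1.comp_homeomorph F
  have hfs : tsupport f ⊆ Ω := by
    refine (tsupport_comp_subset_preimage φ F.continuous).trans ?_
    rw [← hΩ]
    exact Set.preimage_mono hφ.2.2
  have hf2 : MemLp f 2 volume := hfL.continuous.memLp_of_hasCompactSupport hfc
  have hgm : Measurable (gradient f) := by
    unfold gradient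
    exact (LinearIsometryEquiv.continuous _).measurable.comp (measurable_fderiv ℝ f)
  have hg2 : MemLp (gradient f) 2 volume := by
    have hfin : IsFiniteMeasure (volume.restrict (tsupport f)) :=
      ⟨by simpa using hfc.isCompact.measure_lt_top⟩
    have hb : MemLp (gradient f) 2 (volume.restrict (tsupport f)) := by
      refine MemLp.of_bound hgm.aestronglyMeasurable ((L * K : ℝ≥0) : ℝ)
        (Eventually.of_forall fun x => ?_)
      rw [gradient, LinearIsometryEquiv.norm_map]
      exact norm_fderiv_le_of_lipschitz ℝ hfL
    have hind : (tsupport f).indicator (gradient f) = gradient f := by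
      rw [Set.indicator_eq_self]
      intro x hx
      by_contra hxs
      apply hx
      rw [gradient, fderiv_eq_zero_of_notMem_tsupport hxs, map_zero]
    rwa [← memLp_indicator_iff_restrict (isClosed_tsupport f).measurableSet, hind] at hb
  have e1 : hF.pullFun hΩ hΩ'.measurableSet q.1 =ᵐ[volume.restrict Ω] f := by
    filter_upwards [hF.coeFn_pullFun hΩ hΩ'.measurableSet q.1,
      (hF.quasiMeasurePreserving hΩ hΩ'.measurableSet).ae h1] with x hx hx'
    rw [hx, hx']; rfl
  have e2 : hF.pullVec hΩ hΩ'.measurableSet q.2 =ᵐ[volume.restrict Ω] gradient f := by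
    filter_upwards [hF.coeFn_pullVec hΩ hΩ'.measurableSet q.2,
      (hF.quasiMeasurePreserving hΩ hΩ'.measurableSet).ae h2,
      ae_restrict_of_ae (gradient_comp_ae hK (hφ.1.differentiable (by simp)))] with x hx hx' hx2
    rw [hx, show gradient f x = _ from hx2, pullField, pullField, hx']
  refine EMetric.mem_closure_iff.mpr fun ε hε => ?_
  obtain ⟨ε', hε'0, hε'⟩ := exists_between hε
  obtain ⟨v, hv, hv1, hv2⟩ := exists_test_approx hΩo hf2 hg2 (hasWeakGrad_of_lipschitz hfL) hfc hfs
    hε'0.ne'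
  have hvL2 : MemLp v 2 (volume.restrict Ω) :=
    hv.1.continuous.memLp_of_hasCompactSupport hv.2.1
  have hvg2 : MemLp (gradient v) 2 (volume.restrict Ω) := by
    refine Continuous.memLp_of_hasCompactSupport ?_ ?_
    · exact (LinearIsometryEquiv.continuous _).comp (hv.1.continuous_fderiv (by simp))
    · exact (hv.2.1.fderiv ℝ).comp_left (map_zero _)
  refine ⟨(hvL2.toLp v, hvg2.toLp _), ⟨v, hv, hvL2.coeFn_toLp, hvg2.coeFn_toLp⟩, ?_⟩
  refine lt_of_le_of_lt ?_ hε'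
  rw [edist_comm, Prod.edist_eq]
  refine max_le ?_ ?_
  · rw [Lp.edist_def]
    refine le_trans (le_of_eq (eLpNorm_congr_ae ?_))
      ((eLpNorm_mono_measure _ Measure.restrict_le_self).trans hv1)
    filter_upwards [e1, hvL2.coeFn_toLp] with x hx hx'
    rw [Pi.sub_apply, hx, hx']
  · rw [Lp.edist_def]
    refine le_trans (le_of_eq (eLpNorm_congr_ae ?_))
      ((eLpNorm_mono_measure _ Measure.restrict_le_self).trans hv2)
    filter_upwards [e2, hvg2.coeFn_toLp] with x hx hx'
    rw [Pi.sub_apply, hx, hx']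

/-- Compactness of the Sobolev embedding is transported by bi-Lipschitz maps. -/
theorem compactFst_H1 (hF : IsBiLip F m) (hΩ : F ⁻¹' Ω' = Ω) (hΩ' : IsOpen Ω')
    (hb : Bornology.IsBounded Ω') (hc : CompactFst (H1 Ω')) : CompactFst (H1 Ω) := by
  intro C p hp hC
  have hΩo : IsOpen Ω := hΩ ▸ hΩ'.preimage F.continuous
  have hsymm : F.symm ⁻¹' Ω = Ω' := by
    rw [← hΩ, ← Set.preimage_comp]
    simp
  obtain ⟨K', hK'⟩ := hF.lip_symm
  have hbΩ : Bornology.IsBounded Ω := by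
    have : Ω = F.symm '' Ω' := by rw [F.symm.image_eq_preimage_symm]; exact hΩ.symm
    rw [this]
    exact hK'.isBounded_image hb
  -- The bounded sequence is moved to `Ω'` by the inverse map, a convergent subsequence is chosen
  -- there, and its limit is pulled back.
  set q : ℕ → L2 Ω' × L2vec Ω' := fun k =>
    (hF.symm.pullFun hsymm hΩo.measurableSet (p k).1,
      hF.symm.pullVec hsymm hΩo.measurableSet (p k).2)
  have hq : ∀ k, q k ∈ H1 Ω' := fun k => hF.symm.pull_mem_H1 hsymm hΩo hbΩ (hp k)
  have h1 := hF.symm.lipschitzWith_pullFun hsymm hΩo.measurableSet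
  have h2 := hF.symm.enorm_pullVec_sub_le hsymm hΩo.measurableSet hK'
  have hz1 : hF.symm.pullFun hsymm hΩo.measurableSet 0 = 0 := by
    rw [← norm_eq_zero, ← sq_eq_zero_iff, ← real_inner_self_eq_norm_sq, hF.symm.inner_pullFun]
    simp
  have hz2 : hF.symm.pullVec hsymm hΩo.measurableSet 0 = 0 := by
    rw [Lp.ext_iff]
    filter_upwards [hF.symm.coeFn_pullVec hsymm hΩo.measurableSet 0,
      (hF.symm.quasiMeasurePreserving hsymm hΩo.measurableSet).ae
        (Lp.coeFn_zero (Euc d) 2 (volume.restrict Ω)),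
      Lp.coeFn_zero (Euc d) 2 (volume.restrict Ω')] with x hx hx' hx2
    rw [hx, hx2, pullField, hx']
    simp
  have hqb : ∀ k, ‖q k‖ ≤ NNReal.sqrt m⁻¹ * C + (K' * NNReal.sqrt m⁻¹ : ℝ≥0) * C := by
    intro k
    have b1 := h1.dist_le_mul (p k).1 0
    have b2 := h2.dist_le_mul (p k).2 0
    rw [hz1, dist_zero_right, dist_zero_right] at b1
    rw [hz2, dist_zero_right, dist_zero_right] at b2
    have hC0 : 0 ≤ C := (norm_nonneg _).trans (hC k)
    have c1 : ‖(p k).1‖ ≤ C := (norm_fst_le _).trans (hC k)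
    have c2 : ‖(p k).2‖ ≤ C := (norm_snd_le _).trans (hC k)
    rw [Prod.norm_def]
    refine max_le ?_ ?_
    · refine b1.trans (le_trans ?_ (le_add_of_nonneg_right (by positivity)))
      gcongr
    · refine b2.trans (le_trans ?_ (le_add_of_nonneg_left (by positivity)))
      gcongr
  obtain ⟨φ, hφ, w, hw⟩ := hc _ q hq hqb
  refine ⟨φ, hφ, hF.pullFun hΩ hΩ'.measurableSet w, ?_⟩
  have hback : ∀ k, hF.pullFun hΩ hΩ'.measurableSet (q k).1 = (p k).1 := by
    intro k
    rw [Lp.ext_iff]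
    filter_upwards [hF.coeFn_pullFun hΩ hΩ'.measurableSet (q k).1,
      (hF.quasiMeasurePreserving hΩ hΩ'.measurableSet).ae
        (hF.symm.coeFn_pullFun hsymm hΩo.measurableSet (p k).1)] with x hx hx'
    rw [hx, hx', F.symm_apply_apply]
  have := ((hF.lipschitzWith_pullFun hΩ hΩ'.measurableSet).continuous.tendsto w).comp hw
  refine this.congr fun k => ?_
  exact hback (φ k)

end IsBiLip

end Pullback

/-! ### Averaging vector fields over the orthogonal group -/

section Rotations

variable {d : ℕ}

instance : ContinuousStar (Euc d →L[ℝ] Euc d) :=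
  ⟨(LinearIsometryEquiv.continuous (ContinuousLinearMap.adjoint (𝕜 := ℝ) (E := Euc d)
    (F := Euc d)))⟩

/-- The orthogonal group of `ℝ^d`. -/
abbrev Rot (d : ℕ) := unitary (Euc d →L[ℝ] Euc d)

/-- The linear isometry given by an element of the orthogonal group. -/
def rotEquiv (U : Rot d) : Euc d ≃ₗᵢ[ℝ] Euc d := Unitary.linearIsometryEquiv U

theorem rotEquiv_mul (U W : Rot d) (x : Euc d) :
    rotEquiv (U * W) x = rotEquiv U (rotEquiv W x) := rfl

theorem adjoint_rot (U : Rot d) :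
    ContinuousLinearMap.adjoint (((star U : Rot d) : Euc d →L[ℝ] Euc d)) =
      (U : Euc d →L[ℝ] Euc d) :=
  ContinuousLinearMap.adjoint_adjoint _

/-- The group is closed, being cut out by two continuous equations, and bounded, since its elements
are isometries. Compactness makes a normalized Haar measure possible. -/
instance : CompactSpace (Rot d) := by
  refine isCompact_iff_compactSpace.mp ?_
  refine Metric.isCompact_of_isClosed_isBounded ?_ ?_
  · have : ((unitary (Euc d →L[ℝ] Euc d) : Submonoid _) : Set (Euc d →L[ℝ] Euc d)) =
        {U | star U * U = 1} ∩ {U | U * star U = 1} := by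
      ext U
      exact Unitary.mem_iff
    rw [this]
    exact (isClosed_eq (by fun_prop) continuous_const).inter
      (isClosed_eq (by fun_prop) continuous_const)
  · rw [isBounded_iff_forall_norm_le]
    refine ⟨1, fun U hU => ContinuousLinearMap.opNorm_le_bound _ zero_le_one fun x => ?_⟩
    rw [one_mul]
    exact le_of_eq ((rotEquiv ⟨U, hU⟩).norm_map x)

/-- Normalized Haar measure on the orthogonal group. -/
def rotMeasure (d : ℕ) : Measure (Rot d) := Measure.haarMeasure ⊤

instance : (rotMeasure d).IsMulLeftInvariant :=
  inferInstanceAs (Measure.haarMeasure ⊤).IsMulLeftInvariant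

instance : IsProbabilityMeasure (rotMeasure d) :=
  ⟨by simpa [rotMeasure] using Measure.haarMeasure_self (G := Rot d) (K₀ := ⊤)⟩

/-- The reflection that maps `v` to `-v`. -/
def reflRot (v : Euc d) : Rot d :=
  Unitary.linearIsometryEquiv.symm (Submodule.reflection (Submodule.span ℝ {v})ᗮ)

theorem rotEquiv_reflRot (v : Euc d) :
    rotEquiv (reflRot v) = Submodule.reflection (Submodule.span ℝ {v})ᗮ :=
  Unitary.linearIsometryEquiv.apply_symm_apply _

theorem reflRot_self (v : Euc d) : rotEquiv (reflRot v) v = -v := by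
  rw [rotEquiv_reflRot]
  exact Submodule.reflection_orthogonalComplement_singleton_eq_neg v

/-- Reflections already provide every orthogonal map needed: one carrying a vector to another of the
same length while fixing everything orthogonal to their difference. -/
theorem reflRot_sub {v w : Euc d} (h : ‖v‖ = ‖w‖) : rotEquiv (reflRot (v - w)) v = w := by
  rw [rotEquiv_reflRot]
  exact Submodule.reflection_sub h

theorem reflRot_of_inner_eq_zero {v w : Euc d} (h : inner ℝ v w = 0) :
    rotEquiv (reflRot v) w = w := by
  rw [rotEquiv_reflRot]
  refine Submodule.reflection_mem_subspace_eq_self ?_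
  rw [Submodule.mem_orthogonal_singleton_iff_inner_right]
  exact h

theorem lintegral_rot_mul_left (W : Rot d) (f : Rot d → ℝ≥0∞) :
    ∫⁻ U, f (W * U) ∂(rotMeasure d) = ∫⁻ U, f U ∂(rotMeasure d) :=
  lintegral_mul_left_eq_self f W

/-- The averaged quadratic form `z ↦ ∫ ⟨w(U), z⟩² dU`. -/
def rotQuad (w : Rot d → Euc d) (z : Euc d) : ℝ≥0∞ :=
  ∫⁻ U, ‖inner ℝ (w U) z‖ₑ ^ 2 ∂(rotMeasure d)

theorem rotQuad_rot {w : Rot d → Euc d} {W : Rot d} (hw : ∀ U, w (W * U) = rotEquiv W (w U))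
    (z : Euc d) : rotQuad w (rotEquiv W z) = rotQuad w z := by
  rw [rotQuad, ← lintegral_rot_mul_left W]
  simp only [hw, LinearIsometryEquiv.inner_map_map]
  rfl

theorem rotQuad_smul (w : Rot d → Euc d) (c : ℝ) (z : Euc d) :
    rotQuad w (c • z) = ENNReal.ofReal (c ^ 2) * rotQuad w z := by
  rw [rotQuad, rotQuad, ← lintegral_const_mul' _ _ ENNReal.ofReal_ne_top]
  refine lintegral_congr fun U => ?_
  rw [inner_smul_right, enorm_mul, mul_pow, enorm_sq_eq_ofReal, Real.norm_eq_abs, sq_abs]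

/-- Averages over the orthogonal group of quadratic forms of fields that are equivariant under the
stabilizer of `η`. -/
theorem rotQuad_eq {w : Rot d → Euc d} (hwm : Measurable w) {η f : Euc d} (hη : ‖η‖ = 1)
    (hf : ‖f‖ = 1) (hηf : inner ℝ η f = 0)
    (hw : ∀ W U, rotEquiv W η = η → w (W * U) = rotEquiv W (w U)) (z : Euc d) :
    rotQuad w z = ENNReal.ofReal (inner ℝ η z ^ 2) * rotQuad w η +
      ENNReal.ofReal (‖z‖ ^ 2 - inner ℝ η z ^ 2) * rotQuad w f := by
  set α := inner ℝ η z
  set y := z - α • η with hy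
  have hηη : inner ℝ η η = (1 : ℝ) := by rw [real_inner_self_eq_norm_sq, hη, one_pow]
  have hηy : inner ℝ η y = 0 := by
    rw [hy, inner_sub_right, inner_smul_right, hηη]; simp [α]
  have hyη : inner ℝ y η = 0 := by rw [real_inner_comm]; exact hηy
  have hz : z = α • η + y := by simp [hy]
  have hyn : ‖y‖ ^ 2 = ‖z‖ ^ 2 - α ^ 2 := by
    have : ‖z‖ ^ 2 = ‖α • η + y‖ ^ 2 := by rw [← hz]
    rw [this, norm_add_sq_real, real_inner_smul_left, hηy, norm_smul, hη, Real.norm_eq_abs,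
      mul_one, sq_abs]
    ring
  -- The reflection that reverses `y` fixes `η`, so the form cannot distinguish `α • η + y` from `α
  -- • η - y`. The parallelogram law then removes the cross term without leaving `ℝ≥0∞`.
  have hsymm : rotQuad w (α • η - y) = rotQuad w (α • η + y) := by
    have h1 := rotQuad_rot (w := w) (W := reflRot y)
      (fun U => hw _ U (reflRot_of_inner_eq_zero hyη)) (α • η + y)
    rwa [map_add, map_smul, reflRot_of_inner_eq_zero hyη, reflRot_self, ← sub_eq_add_neg] at h1
  have hpar : rotQuad w (α • η + y) + rotQuad w (α • η - y) =
      2 * (rotQuad w (α • η) + rotQuad w y) := by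
    have hm : ∀ v : Euc d, Measurable fun U => ‖inner ℝ (w U) v‖ₑ ^ 2 := fun v =>
      (hwm.inner_const (c := v)).enorm.pow_const 2
    simp only [rotQuad]
    rw [← lintegral_add_left (hm _), ← lintegral_add_left (hm _),
      ← lintegral_const_mul' _ _ (by norm_num)]
    refine lintegral_congr fun U => ?_
    simp only [enorm_sq_eq_ofReal, Real.norm_eq_abs, sq_abs]
    rw [← ENNReal.ofReal_add (by positivity) (by positivity),
      ← ENNReal.ofReal_add (by positivity) (by positivity)]
    rw [two_mul, ← ENNReal.ofReal_add (by positivity) (by positivity),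
      inner_add_right (w U) (α • η) y, inner_sub_right (w U) (α • η) y]
    congr 1
    ring
  rw [hsymm, ← two_mul] at hpar
  have hsum : rotQuad w (α • η + y) = rotQuad w (α • η) + rotQuad w y :=
    (ENNReal.mul_right_inj (by norm_num) (by norm_num)).mp hpar
  -- The stabilizer of `η` contains a reflection taking `y` to `‖y‖ • f`, so all tangential
  -- directions have the same average.
  have hyf : rotQuad w y = rotQuad w (‖y‖ • f) := by
    have hn : ‖y‖ = ‖‖y‖ • f‖ := by rw [norm_smul, norm_norm, hf, mul_one]
    have h0 : inner ℝ (y - ‖y‖ • f) η = 0 := by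
      rw [inner_sub_left, hyη, real_inner_smul_left, real_inner_comm, hηf, mul_zero, sub_zero]
    have h1 := rotQuad_rot (w := w) (W := reflRot (y - ‖y‖ • f))
      (fun U => hw _ U (reflRot_of_inner_eq_zero h0)) y
    rw [reflRot_sub hn] at h1
    exact h1.symm
  conv_lhs => rw [hz]
  rw [hsum, hyf, rotQuad_smul, rotQuad_smul, hyn]

theorem enorm_sq_eq_sum (v : Euc d) :
    ‖v‖ₑ ^ 2 = ∑ i : Fin d, ‖inner ℝ v (EuclideanSpace.single i (1 : ℝ))‖ₑ ^ 2 := by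
  rw [enorm_sq_eq_ofReal, EuclideanSpace.real_norm_sq_eq, ENNReal.ofReal_sum_of_nonneg
    fun i _ => by positivity]
  refine Finset.sum_congr rfl fun i _ => ?_
  rw [EuclideanSpace.inner_single_right, enorm_sq_eq_ofReal]
  simp

/-- In coordinates `‖Bᵀ w‖²` is the sum of `⟨w, B e_i⟩²`. `rotQuad_eq` applies to each `B e_i`, and
the squares `⟨η, B e_i⟩²` add up to `‖Bᵀ η‖²`. -/
theorem lintegral_rot_adjoint {w : Rot d → Euc d} (hwm : Measurable w) {η f : Euc d}
    (hη : ‖η‖ = 1) (hf : ‖f‖ = 1) (hηf : inner ℝ η f = 0)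
    (hw : ∀ W U, rotEquiv W η = η → w (W * U) = rotEquiv W (w U)) (B : Euc d →L[ℝ] Euc d) :
    ∫⁻ U, ‖ContinuousLinearMap.adjoint B (w U)‖ₑ ^ 2 ∂(rotMeasure d) =
      ENNReal.ofReal (‖ContinuousLinearMap.adjoint B η‖ ^ 2) * rotQuad w η +
      ENNReal.ofReal ((∑ i, ‖B (EuclideanSpace.single i 1)‖ ^ 2) -
        ‖ContinuousLinearMap.adjoint B η‖ ^ 2) * rotQuad w f := by
  have h1 : ∫⁻ U, ‖ContinuousLinearMap.adjoint B (w U)‖ₑ ^ 2 ∂(rotMeasure d) =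
      ∑ i, rotQuad w (B (EuclideanSpace.single i 1)) := by
    simp only [rotQuad]
    rw [← lintegral_finsetSum]
    · refine lintegral_congr fun U => ?_
      rw [enorm_sq_eq_sum]
      simp only [ContinuousLinearMap.adjoint_inner_left]
    · intro i _
      exact (hwm.inner_const).enorm.pow_const 2
  have hle : ∀ i, (inner ℝ η (B (EuclideanSpace.single i 1))) ^ 2 ≤
      ‖B (EuclideanSpace.single i 1)‖ ^ 2 := by
    intro i
    have := abs_real_inner_le_norm η (B (EuclideanSpace.single i 1))
    rw [hη, one_mul] at this
    rw [← sq_abs]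
    gcongr
  have h2 : ‖ContinuousLinearMap.adjoint B η‖ ^ 2 =
      ∑ i, (inner ℝ η (B (EuclideanSpace.single i 1))) ^ 2 := by
    rw [EuclideanSpace.real_norm_sq_eq]
    refine Finset.sum_congr rfl fun i _ => ?_
    rw [← ContinuousLinearMap.adjoint_inner_left, EuclideanSpace.inner_single_right]
    simp
  rw [h1, Finset.sum_congr rfl fun i _ => rotQuad_eq hwm hη hf hηf hw _, Finset.sum_add_distrib,
    ← Finset.sum_mul, ← Finset.sum_mul, ← ENNReal.ofReal_sum_of_nonneg fun i _ => by positivity,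
    ← ENNReal.ofReal_sum_of_nonneg fun i _ => sub_nonneg.mpr (hle i), h2, Finset.sum_sub_distrib]

/-- The rotated field `U g(Uᵀ y)`. -/
def rotField (g : Euc d → Euc d) (U : Rot d) (y : Euc d) : Euc d :=
  rotEquiv U (g ((rotEquiv U).symm y))

theorem measurable_rotField {g : Euc d → Euc d} (hg : Measurable g) :
    Measurable fun p : Rot d × Euc d => rotField g p.1 p.2 := by
  have happ : Measurable fun q : (Euc d →L[ℝ] Euc d) × Euc d => q.1 q.2 :=
    isBoundedBilinearMap_apply.continuous.measurable
  have hinv : Measurable fun p : Rot d × Euc d => (rotEquiv p.1).symm p.2 := by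
    refine happ.comp (Measurable.prodMk ?_ measurable_snd)
    exact (by fun_prop : Continuous fun p : Rot d × Euc d =>
      ((star p.1 : Rot d) : Euc d →L[ℝ] Euc d)).measurable
  exact happ.comp (Measurable.prodMk (measurable_subtype_coe.comp measurable_fst) (hg.comp hinv))

/-- The equivariance behind both uses of invariance: for `W` fixing the direction of `y` it is the
hypothesis of `rotQuad_eq`, and for general `W` it moves averages between points of the same sphere.
-/
theorem rotField_mul (g : Euc d → Euc d) (W U : Rot d) (y : Euc d) :
    rotField g (W * U) (rotEquiv W y) = rotEquiv W (rotField g U y) := by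
  have : (rotEquiv (W * U)).symm (rotEquiv W y) = (rotEquiv U).symm y := by
    rw [LinearIsometryEquiv.symm_apply_eq, rotEquiv_mul, LinearIsometryEquiv.apply_symm_apply]
  rw [rotField, this, rotEquiv_mul, rotField]

/-- The square of the radial component of `g`, averaged over the sphere of radius `s`. -/
def radAvg [NeZero d] (g : Euc d → Euc d) (s : ℝ) : ℝ≥0∞ :=
  rotQuad (fun U => rotField g U (s • EuclideanSpace.single 0 1)) (EuclideanSpace.single 0 1)

/-- The square of a tangential component of `g`, averaged over the sphere of radius `s`. -/
def tanAvg [NeZero d] (g : Euc d → Euc d) (s : ℝ) : ℝ≥0∞ :=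
  rotQuad (fun U => rotField g U (s • EuclideanSpace.single 0 1))
    (EuclideanSpace.single (Fin.ofNat d 1) 1)

theorem rotQuad_rotField_rot (g : Euc d → Euc d) (W : Rot d) (y z : Euc d) :
    rotQuad (fun U => rotField g U (rotEquiv W y)) (rotEquiv W z) =
      rotQuad (fun U => rotField g U y) z := by
  simp only [rotQuad]
  rw [← lintegral_rot_mul_left W]
  simp only [rotField_mul, LinearIsometryEquiv.inner_map_map]

/-- A reflection carries `η` to the first basis vector, so the averages depend on the point only
through its radius; the rest is `lintegral_rot_adjoint`. -/
theorem lintegral_rotField [NeZero d] (hd : 2 ≤ d) {g : Euc d → Euc d} (hg : Measurable g) {η : Euc d}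
    (hη : ‖η‖ = 1) (s : ℝ) (B : Euc d →L[ℝ] Euc d) :
    ∫⁻ U, ‖ContinuousLinearMap.adjoint B (rotField g U (s • η))‖ₑ ^ 2 ∂(rotMeasure d) =
      ENNReal.ofReal (‖ContinuousLinearMap.adjoint B η‖ ^ 2) * radAvg g s +
      ENNReal.ofReal ((∑ i, ‖B (EuclideanSpace.single i 1)‖ ^ 2) -
        ‖ContinuousLinearMap.adjoint B η‖ ^ 2) * tanAvg g s := by
  set e : Euc d := EuclideanSpace.single 0 1
  set f : Euc d := EuclideanSpace.single (Fin.ofNat d 1) 1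
  have he : ‖e‖ = 1 := by simp [e]
  have hf : ‖f‖ = 1 := by simp [f]
  have hef : inner ℝ e f = 0 := by
    -- The index 1 is read modulo `d`; it differs from 0 because `d ≥ 2`.
    have h01 : (0 : Fin d) ≠ Fin.ofNat d 1 := by
      intro h
      have := congrArg Fin.val h
      simp only [Fin.val_zero, Fin.val_ofNat] at this
      rw [Nat.mod_eq_of_lt (by omega)] at this
      omega
    rw [EuclideanSpace.inner_single_left, PiLp.single_apply, if_neg h01, mul_zero]
  set W := reflRot (e - η)
  have hWe : rotEquiv W e = η := reflRot_sub (by rw [he, hη])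
  have h1 : radAvg g s = rotQuad (fun U => rotField g U (s • η)) η := by
    rw [← hWe, ← map_smul, rotQuad_rotField_rot]; rfl
  have h2 : tanAvg g s = rotQuad (fun U => rotField g U (s • η)) (rotEquiv W f) := by
    rw [← hWe, ← map_smul, rotQuad_rotField_rot]; rfl
  rw [h1, h2]
  refine lintegral_rot_adjoint ?_ hη ?_ ?_ ?_ B
  · exact (measurable_rotField hg).comp (measurable_id.prodMk measurable_const)
  · rw [LinearIsometryEquiv.norm_map, hf]
  · rw [← hWe, LinearIsometryEquiv.inner_map_map, hef]
  · intro W' U hW'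
    have := rotField_mul g W' U (s • η)
    rwa [map_smul, hW'] at this

theorem lintegral_norm_rotField [NeZero d] (hd : 2 ≤ d) {g : Euc d → Euc d} (hg : Measurable g)
    {η : Euc d} (hη : ‖η‖ = 1) (s : ℝ) :
    ∫⁻ U, ‖rotField g U (s • η)‖ₑ ^ 2 ∂(rotMeasure d) =
      radAvg g s + ENNReal.ofReal ((d : ℝ) - 1) * tanAvg g s := by
  have h := lintegral_rotField hd hg hη s (ContinuousLinearMap.id ℝ (Euc d))
  have hid : ContinuousLinearMap.adjoint (ContinuousLinearMap.id ℝ (Euc d)) =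
      ContinuousLinearMap.id ℝ (Euc d) := ContinuousLinearMap.adjoint_id
  rw [hid] at h
  simpa [hη] using h

theorem measurable_rotQuad_rotField {g : Euc d → Euc d} (hg : Measurable g) (y z : Euc d) :
    Measurable fun s : ℝ => rotQuad (fun U => rotField g U (s • y)) z := by
  have hm : Measurable fun p : ℝ × Rot d => ‖inner ℝ (rotField g p.2 (p.1 • y)) z‖ₑ ^ 2 := by
    refine (Measurable.inner_const (c := z) ?_).enorm.pow_const 2
    exact (measurable_rotField hg).comp
      (measurable_snd.prodMk (measurable_fst.smul_const y))
  exact hm.lintegral_prod_right'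

theorem lintegral_rot_ball (f : Euc d → ℝ≥0∞) (U : Rot d) :
    ∫⁻ y in unitBall d, f ((rotEquiv U).symm y) = ∫⁻ y in unitBall d, f y := by
  have hmp : MeasurePreserving (rotEquiv U).symm (volume.restrict (unitBall d))
      (volume.restrict (unitBall d)) := by
    have h := ((rotEquiv U).symm.measurePreserving).restrict_preimage
      (s := unitBall d) measurableSet_ball
    have hpre : (rotEquiv U).symm ⁻¹' unitBall d = unitBall d := by
      ext x; simp
    rwa [hpre] at h
  exact hmp.lintegral_comp_emb (rotEquiv U).symm.toHomeomorph.measurableEmbedding f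

/-- Integrating the spherical averages over the ball. -/
theorem lintegral_radAvg [NeZero d] {g : Euc d → Euc d} (hg : Measurable g) :
    ∫⁻ y in unitBall d, radAvg g ‖y‖ =
      ∫⁻ y in unitBall d, ‖inner ℝ (g y) (‖y‖⁻¹ • y)‖ₑ ^ 2 := by
  have hm : Measurable fun p : Euc d × Rot d =>
      ‖inner ℝ (rotField g p.2 p.1) (‖p.1‖⁻¹ • p.1)‖ₑ ^ 2 := by
    refine (Measurable.inner ?_ ?_).enorm.pow_const 2
    · exact (measurable_rotField hg).comp (measurable_snd.prodMk measurable_fst)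
    · fun_prop
  calc ∫⁻ y in unitBall d, radAvg g ‖y‖
      = ∫⁻ y in unitBall d, (∫⁻ U, ‖inner ℝ (rotField g U y) (‖y‖⁻¹ • y)‖ₑ ^ 2
          ∂(rotMeasure d)) := by
        refine lintegral_congr_ae (ae_restrict_of_ae ?_)
        have h0 : ∀ᵐ y : Euc d, y ≠ 0 := Measure.ae_ne volume 0
        filter_upwards [h0] with y hy
        have hn : ‖y‖ ≠ 0 := norm_ne_zero_iff.mpr hy
        set η : Euc d := ‖y‖⁻¹ • y
        have hη : ‖η‖ = 1 := by simp [η, norm_smul, hn]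
        have hyη : y = ‖y‖ • η := by simp [η, smul_smul, hn]
        set W : Rot d := reflRot (EuclideanSpace.single 0 1 - η)
        have hW : rotEquiv W (EuclideanSpace.single 0 1) = η := reflRot_sub (by simp [hη])
        have := rotQuad_rotField_rot g W (‖y‖ • EuclideanSpace.single 0 1)
          (EuclideanSpace.single 0 1)
        rw [map_smul, hW, ← hyη] at this
        exact this.symm
    _ = ∫⁻ U, (∫⁻ y in unitBall d, ‖inner ℝ (rotField g U y) (‖y‖⁻¹ • y)‖ₑ ^ 2)
          ∂(rotMeasure d) := lintegral_lintegral_swap hm.aemeasurable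
    _ = ∫⁻ U : Rot d, (∫⁻ y in unitBall d, ‖inner ℝ (g y) (‖y‖⁻¹ • y)‖ₑ ^ 2)
          ∂(rotMeasure d) := by
        refine lintegral_congr fun U => ?_
        rw [← lintegral_rot_ball (fun y => ‖inner ℝ (g y) (‖y‖⁻¹ • y)‖ₑ ^ 2) U]
        refine lintegral_congr fun y => ?_
        rw [rotField, LinearIsometryEquiv.norm_map, ← map_smul,
          ← LinearIsometryEquiv.inner_map_map (rotEquiv U) (g _) ((rotEquiv U).symm _),
          LinearIsometryEquiv.apply_symm_apply]
    _ = _ := by simp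

/-- The case of the identity matrix, integrated: rotations preserve the ball and the norm, so
averaging does not change the total energy. -/
theorem lintegral_radAvg_add_tanAvg [NeZero d] (hd : 2 ≤ d) {g : Euc d → Euc d}
    (hg : Measurable g) :
    ∫⁻ y in unitBall d, (radAvg g ‖y‖ + ENNReal.ofReal ((d : ℝ) - 1) * tanAvg g ‖y‖) =
      ∫⁻ y in unitBall d, ‖g y‖ₑ ^ 2 := by
  have hm : Measurable fun p : Euc d × Rot d => ‖rotField g p.2 p.1‖ₑ ^ 2 :=
    ((measurable_rotField hg).comp (measurable_snd.prodMk measurable_fst)).enorm.pow_const 2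
  calc _ = ∫⁻ y in unitBall d, (∫⁻ U, ‖rotField g U y‖ₑ ^ 2 ∂(rotMeasure d)) := by
        refine lintegral_congr_ae (ae_restrict_of_ae ?_)
        have h0 : ∀ᵐ y : Euc d, y ≠ 0 := Measure.ae_ne volume 0
        filter_upwards [h0] with y hy
        have hn : ‖y‖ ≠ 0 := norm_ne_zero_iff.mpr hy
        have hη : ‖‖y‖⁻¹ • y‖ = 1 := by simp [norm_smul, hn]
        rw [← lintegral_norm_rotField hd hg hη, smul_smul, mul_inv_cancel₀ hn, one_smul]
    _ = ∫⁻ U, (∫⁻ y in unitBall d, ‖rotField g U y‖ₑ ^ 2) ∂(rotMeasure d) :=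
        lintegral_lintegral_swap hm.aemeasurable
    _ = ∫⁻ U : Rot d, (∫⁻ y in unitBall d, ‖g y‖ₑ ^ 2) ∂(rotMeasure d) := by
        refine lintegral_congr fun U => ?_
        rw [← lintegral_rot_ball (fun y => ‖g y‖ₑ ^ 2) U]
        refine lintegral_congr fun y => ?_
        rw [rotField, ← ofReal_norm, LinearIsometryEquiv.norm_map, ofReal_norm]
    _ = _ := by simp

end Rotations

/-! ### Functions on the sphere extended homogeneously of degree zero and one -/

section Homogeneous

variable {d : ℕ}

theorem norm_sph (ξ : Sph d) : ‖(ξ : Euc d)‖ = 1 := mem_sphere_zero_iff_norm.mp ξ.2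

theorem sph_ne_zero (ξ : Sph d) : (ξ : Euc d) ≠ 0 := by
  rw [← norm_ne_zero_iff, norm_sph]; exact one_ne_zero

theorem norm_smul_sph {r : ℝ} (hr : 0 ≤ r) (ξ : Sph d) : ‖r • (ξ : Euc d)‖ = r := by
  rw [norm_smul, norm_sph, mul_one, Real.norm_of_nonneg hr]

theorem exists_polar {x : Euc d} (hx : x ≠ 0) :
    ∃ r : ℝ, 0 < r ∧ ∃ ξ : Sph d, x = r • (ξ : Euc d) := by
  have hn : ‖x‖ ≠ 0 := norm_ne_zero_iff.mpr hx
  refine ⟨‖x‖, norm_pos_iff.mpr hx, ⟨‖x‖⁻¹ • x, ?_⟩, ?_⟩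
  · simp [norm_smul, hn]
  · simp [smul_smul, hn]

theorem smul_sph_injective {r s : ℝ} (hr : 0 < r) (hs : 0 ≤ s) {ξ η : Sph d}
    (h : r • (ξ : Euc d) = s • (η : Euc d)) : r = s ∧ ξ = η := by
  have hrs : r = s := by rw [← norm_smul_sph hr.le ξ, h, norm_smul_sph hs]
  subst hrs
  exact ⟨rfl, Subtype.ext (smul_right_injective _ hr.ne' h)⟩

theorem homExt_smul_sph {V : Type*} [Zero V] (f : Sph d → V) {r : ℝ} (hr : 0 < r) (ξ : Sph d) :
    homExt f (r • (ξ : Euc d)) = f ξ := by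
  rw [homExt, dif_neg (smul_ne_zero hr.ne' (sph_ne_zero ξ))]
  congr 1
  apply Subtype.ext
  simp only [norm_smul_sph hr.le, smul_smul, inv_mul_cancel₀ hr.ne', one_smul]

theorem homExt_sph {V : Type*} [Zero V] (f : Sph d → V) (ξ : Sph d) :
    homExt f (ξ : Euc d) = f ξ := by
  simpa using homExt_smul_sph f one_pos ξ

theorem homExt_smul {V : Type*} [Zero V] (f : Sph d → V) {r : ℝ} (hr : 0 < r) (x : Euc d) :
    homExt f (r • x) = homExt f x := by
  rcases eq_or_ne x 0 with rfl | hx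
  · simp
  obtain ⟨s, hs, ξ, rfl⟩ := exists_polar hx
  rw [smul_smul, homExt_smul_sph f (mul_pos hr hs), homExt_smul_sph f hs]

/-- The extension of a function on the sphere that is homogeneous of degree one. -/
def homOne {V : Type*} [AddCommGroup V] [Module ℝ V] (f : Sph d → V) (x : Euc d) : V :=
  ‖x‖ • homExt f x

theorem homOne_smul_sph {V : Type*} [AddCommGroup V] [Module ℝ V] (f : Sph d → V) {r : ℝ}
    (hr : 0 ≤ r) (ξ : Sph d) : homOne f (r • (ξ : Euc d)) = r • f ξ := by
  rcases hr.eq_or_lt with rfl | hr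
  · simp [homOne]
  · rw [homOne, homExt_smul_sph f hr, norm_smul_sph hr.le]

theorem homOne_zero {V : Type*} [AddCommGroup V] [Module ℝ V] (f : Sph d → V) :
    homOne f 0 = 0 := by simp [homOne]

theorem homOne_smul {V : Type*} [AddCommGroup V] [Module ℝ V] (f : Sph d → V) {r : ℝ}
    (hr : 0 < r) (x : Euc d) : homOne f (r • x) = r • homOne f x := by
  rw [homOne, homOne, homExt_smul f hr, norm_smul, Real.norm_of_nonneg hr.le, mul_smul]

/-- In polar form, `|s - r|` and `r * ‖ξ - η‖` are bounded by one and two times `‖r ξ - s η‖`. The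
origin, which has no polar form, is treated separately. -/
theorem lipschitzWith_homOne {V : Type*} [NormedAddCommGroup V] [NormedSpace ℝ V]
    {f : Sph d → V} {K M : ℝ≥0} (hf : LipschitzWith K f) (hM : ∀ ξ, ‖f ξ‖ ≤ M) :
    LipschitzWith (2 * K + M) (homOne f) := by
  refine LipschitzWith.of_dist_le_mul fun x y => ?_
  rw [dist_eq_norm, dist_eq_norm, NNReal.coe_add, NNReal.coe_mul, NNReal.coe_ofNat]
  have hzero : ∀ z : Euc d, ‖homOne f z‖ ≤ M * ‖z‖ := by
    intro z
    rcases eq_or_ne z 0 with rfl | hz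
    · simp [homOne_zero]
    obtain ⟨r, hr, ξ, rfl⟩ := exists_polar hz
    rw [homOne_smul_sph f hr.le, norm_smul_sph hr.le, norm_smul, Real.norm_of_nonneg hr.le,
      mul_comm]
    gcongr
    exact hM ξ
  rcases eq_or_ne x 0 with rfl | hx
  · rw [homOne_zero, zero_sub, zero_sub, norm_neg, norm_neg]
    refine (hzero y).trans ?_
    gcongr
    have := K.coe_nonneg
    linarith
  rcases eq_or_ne y 0 with rfl | hy
  · rw [homOne_zero, sub_zero, sub_zero]
    refine (hzero x).trans ?_
    gcongr
    have := K.coe_nonneg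
    linarith
  obtain ⟨r, hr, ξ, rfl⟩ := exists_polar hx
  obtain ⟨s, hs, η, rfl⟩ := exists_polar hy
  rw [homOne_smul_sph f hr.le, homOne_smul_sph f hs.le]
  set D := ‖r • (ξ : Euc d) - s • (η : Euc d)‖
  have hrs : |s - r| ≤ D := by
    have := abs_norm_sub_norm_le (r • (ξ : Euc d)) (s • (η : Euc d))
    rwa [norm_smul_sph hr.le, norm_smul_sph hs.le, abs_sub_comm] at this
  have hdir : r * ‖(ξ : Euc d) - η‖ ≤ 2 * D := by
    have e : r • ((ξ : Euc d) - η) = (r • (ξ : Euc d) - s • (η : Euc d)) +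
        (s - r) • (η : Euc d) := by module
    calc r * ‖(ξ : Euc d) - η‖ = ‖r • ((ξ : Euc d) - η)‖ := by
          rw [norm_smul, Real.norm_of_nonneg hr.le]
      _ ≤ D + ‖(s - r) • (η : Euc d)‖ := by rw [e]; exact norm_add_le _ _
      _ ≤ 2 * D := by rw [norm_smul, norm_sph, mul_one, Real.norm_eq_abs]; linarith
  have hff : ‖f ξ - f η‖ ≤ K * ‖(ξ : Euc d) - η‖ := by
    have := hf.dist_le_mul ξ η
    rwa [dist_eq_norm, Subtype.dist_eq, dist_eq_norm] at this
  have e : r • f ξ - s • f η = r • (f ξ - f η) - (s - r) • f η := by module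
  calc ‖r • f ξ - s • f η‖ ≤ ‖r • (f ξ - f η)‖ + ‖(s - r) • f η‖ := by
        rw [e]; exact norm_sub_le _ _
    _ ≤ r * (K * ‖(ξ : Euc d) - η‖) + D * M := by
        rw [norm_smul, norm_smul, Real.norm_of_nonneg hr.le, Real.norm_eq_abs]
        gcongr
        exact hM η
    _ = K * (r * ‖(ξ : Euc d) - η‖) + M * D := by ring
    _ ≤ K * (2 * D) + M * D := by gcongr
    _ = _ := by ring

theorem homExt_eq_smul_homOne {V : Type*} [AddCommGroup V] [Module ℝ V] (f : Sph d → V)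
    {x : Euc d} (hx : x ≠ 0) : homExt f x = ‖x‖⁻¹ • homOne f x := by
  rw [homOne, smul_smul, inv_mul_cancel₀ (norm_ne_zero_iff.mpr hx), one_smul]

/-- The radial extension of a Lipschitz function is differentiable almost everywhere. -/
theorem ae_differentiableAt_homExt {V : Type*} [NormedAddCommGroup V] [NormedSpace ℝ V]
    [FiniteDimensional ℝ V] {f : Sph d → V} {K M : ℝ≥0} (hf : LipschitzWith K f)
    (hM : ∀ ξ, ‖f ξ‖ ≤ M) : ∀ᵐ x : Euc d, DifferentiableAt ℝ (homExt f) x := by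
  rcases Nat.eq_zero_or_pos d with rfl | hd
  · refine Eventually.of_forall fun x => ?_
    exact (hasFDerivAt_of_subsingleton _ _).differentiableAt
  have : Nonempty (Fin d) := ⟨⟨0, hd⟩⟩
  filter_upwards [(lipschitzWith_homOne hf hM).ae_differentiableAt (μ := volume),
    Measure.ae_ne volume (0 : Euc d)] with x hx hx0
  have h1 : DifferentiableAt ℝ (fun y : Euc d => ‖y‖⁻¹ • homOne f y) x :=
    ((differentiableAt_id.norm ℝ hx0).inv (norm_ne_zero_iff.mpr hx0)).smul hx
  refine h1.congr_of_eventuallyEq ?_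
  filter_upwards [isOpen_ne.mem_nhds hx0] with y hy
  exact homExt_eq_smul_homOne f hy

/-- The sphere is null, so almost everywhere statements say nothing on it directly.
Differentiability is constant along rays, which carries it to the sphere. -/
theorem differentiableAt_homExt_of_smul {V : Type*} [NormedAddCommGroup V] [NormedSpace ℝ V]
    {f : Sph d → V} {r : ℝ} (hr : 0 < r) {x : Euc d}
    (h : DifferentiableAt ℝ (homExt f) (r • x)) : DifferentiableAt ℝ (homExt f) x := by
  have h1 : DifferentiableAt ℝ (fun y : Euc d => homExt f (r • y)) x :=
    DifferentiableAt.comp x h (differentiableAt_id.const_smul r)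
  simpa only [homExt_smul f hr] using h1

/-- The derivative of the radial extension is bounded on the sphere. -/
theorem norm_fderiv_homExt_le {V : Type*} [NormedAddCommGroup V] [NormedSpace ℝ V]
    {f : Sph d → V} {K : ℝ≥0} (hf : LipschitzWith K f) (ξ : Sph d) :
    ‖fderiv ℝ (homExt f) (ξ : Euc d)‖ ≤ 2 * K := by
  refine norm_fderiv_le_of_lip' ℝ (by positivity) ?_
  filter_upwards [isOpen_ne.mem_nhds (sph_ne_zero ξ)] with x hx
  obtain ⟨r, hr, η, rfl⟩ := exists_polar hx
  rw [homExt_smul_sph f hr, homExt_sph]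
  have hff : ‖f η - f ξ‖ ≤ K * ‖(η : Euc d) - ξ‖ := by
    have := hf.dist_le_mul η ξ
    rwa [dist_eq_norm, Subtype.dist_eq, dist_eq_norm] at this
  refine hff.trans ?_
  rw [mul_comm (2 : ℝ), mul_assoc]
  gcongr
  have h1 : |1 - r| ≤ ‖r • (η : Euc d) - ξ‖ := by
    have := abs_norm_sub_norm_le (r • (η : Euc d)) (ξ : Euc d)
    rwa [norm_smul_sph hr.le, norm_sph, abs_sub_comm] at this
  have e : (η : Euc d) - ξ = (r • (η : Euc d) - ξ) + (1 - r) • (η : Euc d) := by module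
  calc ‖(η : Euc d) - ξ‖ ≤ ‖r • (η : Euc d) - ξ‖ + ‖(1 - r) • (η : Euc d)‖ := by
        rw [e]; exact norm_add_le _ _
    _ ≤ _ := by rw [norm_smul, norm_sph, mul_one, Real.norm_eq_abs]; linarith

end Homogeneous

/-! ### Polar coordinates adapted to a starlike domain -/

section Polar

variable {d : ℕ}

/-- The radial measure `r^(d-1) dr`. -/
abbrev radMeasure (d : ℕ) : Measure (Set.Ioi (0 : ℝ)) := Measure.volumeIoiPow (d - 1)

theorem measurePreserving_polar :
    MeasurePreserving (homeomorphUnitSphereProd (Euc d)) (volume.comap Subtype.val)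
      ((surf d).prod (radMeasure d)) := by
  have h := Measure.measurePreserving_homeomorphUnitSphereProd (volume : Measure (Euc d))
  rwa [finrank_euclideanSpace_fin] at h

theorem lintegral_polar [NeZero d] (f : Euc d → ℝ≥0∞) :
    ∫⁻ x, f x = ∫⁻ p, f ((p.2 : ℝ) • (p.1 : Euc d)) ∂((surf d).prod (radMeasure d)) := by
  have h0 : ∀ᵐ x : Euc d, x ∈ ({0}ᶜ : Set (Euc d)) := Measure.ae_ne volume 0
  rw [← Measure.restrict_eq_self_of_ae_mem h0,
    ← lintegral_subtype_comap (measurableSet_singleton _).compl,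
    ← measurePreserving_polar.lintegral_comp_emb (Homeomorph.measurableEmbedding _)]
  refine lintegral_congr fun x => ?_
  rw [← homeomorphUnitSphereProd_symm_apply_coe, Homeomorph.symm_apply_apply]

/-- The exceptional set is a cone over a null set of directions, hence null because volume is a
product measure in polar coordinates. -/
theorem ae_of_ae_surf [NeZero d] {P : Sph d → Prop} (h : ∀ᵐ ξ ∂(surf d), P ξ) :
    ∀ᵐ x : Euc d, ∀ r : ℝ, 0 < r → ∀ ξ : Sph d, x = r • (ξ : Euc d) → P ξ := by
  have h1 : ∀ᵐ p ∂((surf d).prod (radMeasure d)), P p.1 :=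
    Measure.quasiMeasurePreserving_fst.ae h
  have h2 := measurePreserving_polar.quasiMeasurePreserving.ae h1
  have h3 : ∀ᵐ x ∂(volume.restrict ({0}ᶜ : Set (Euc d))),
      ∀ r : ℝ, 0 < r → ∀ ξ : Sph d, x = r • (ξ : Euc d) → P ξ := by
    rw [← map_comap_subtype_coe (measurableSet_singleton _).compl,
      (MeasurableEmbedding.subtype_coe (measurableSet_singleton _).compl).ae_map_iff]
    filter_upwards [h2] with x hx r hr ξ hxξ
    have : ((homeomorphUnitSphereProd (Euc d)) x).1 = ξ := by
      apply Subtype.ext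
      rw [homeomorphUnitSphereProd_apply_fst_coe, hxξ, norm_smul_sph hr.le, smul_smul,
        inv_mul_cancel₀ hr.ne', one_smul]
    rwa [this] at hx
  have h0 : ∀ᵐ x : Euc d, x ∈ ({0}ᶜ : Set (Euc d)) := Measure.ae_ne volume 0
  rwa [Measure.restrict_eq_self_of_ae_mem h0] at h3

theorem lintegral_radMeasure (h : ℝ → ℝ≥0∞) :
    ∫⁻ r, h r ∂(radMeasure d) = ∫⁻ r in Set.Ioi (0 : ℝ), ENNReal.ofReal (r ^ (d - 1)) * h r := by
  rw [radMeasure, Measure.volumeIoiPow, lintegral_withDensity_eq_lintegral_mul_non_measurable,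
    ← lintegral_subtype_comap measurableSet_Ioi]
  · rfl
  · fun_prop
  · simp

/-- Rescaling `r ^ (d - 1) dr` by `ρ` produces `ρ ^ d`. With `ρ = R ξ` this is the source of the
weight `R ^ d` in the angular integrals. -/
theorem lintegral_radMeasure_scale (hd : d ≠ 0) {ρ : ℝ} (hρ : 0 < ρ) (h : ℝ → ℝ≥0∞) :
    ∫⁻ r, h (r * ρ⁻¹) ∂(radMeasure d) = ENNReal.ofReal (ρ ^ d) * ∫⁻ r, h r ∂(radMeasure d) := by
  rw [lintegral_radMeasure (fun r => h (r * ρ⁻¹)), lintegral_radMeasure h,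
    ← lintegral_const_mul' _ _ ENNReal.ofReal_ne_top]
  have himg : (fun r : ℝ => ρ * r) '' Set.Ioi 0 = Set.Ioi 0 := by
    rw [Set.image_mul_left_Ioi hρ, mul_zero]
  rw [← himg, lintegral_image_eq_lintegral_abs_deriv_mul (f' := fun _ => ρ) measurableSet_Ioi
    (fun x _ => by simpa using ((hasDerivAt_id x).const_mul ρ).hasDerivWithinAt)
    ((mul_right_injective₀ hρ.ne').injOn), himg]
  refine setLIntegral_congr_fun measurableSet_Ioi fun r hr => ?_
  have e1 : ρ * r * ρ⁻¹ = r := by field_simp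
  simp only [e1]
  rw [← mul_assoc, ← mul_assoc, abs_of_pos hρ, ← ENNReal.ofReal_mul hρ.le,
    ← ENNReal.ofReal_mul (by positivity)]
  congr 2
  rw [mul_pow, ← mul_assoc, mul_pow_sub_one hd]

theorem smul_mem_starDomain {R : Sph d → ℝ} {r : ℝ} (hr : 0 < r) (ξ : Sph d) :
    r • (ξ : Euc d) ∈ starDomain R ↔ r < R ξ := by
  constructor
  · rintro ⟨η, s, hs, hsR, h⟩
    obtain ⟨rfl, rfl⟩ := smul_sph_injective hr hs h
    exact hsR
  · intro h
    exact ⟨ξ, r, hr.le, h, rfl⟩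

/-- Integration over a starlike domain in the coordinates adapted to it. -/
theorem lintegral_starDomain [NeZero d] {R : Sph d → ℝ} (hR : ∀ ξ, 0 < R ξ) (hRc : Continuous R)
    (hΩ : MeasurableSet (starDomain R))
    {a : ℝ → ℝ≥0∞} (ha : Measurable a) {φ : Sph d → ℝ≥0∞} (hφ : Measurable φ) :
    ∫⁻ x in starDomain R, a (‖x‖ * (homExt R x)⁻¹) * homExt φ x =
      (∫⁻ ξ, φ ξ * ENNReal.ofReal (R ξ ^ d) ∂(surf d)) *
        ∫⁻ r, (Set.Iio (1 : ℝ)).indicator a r ∂(radMeasure d) := by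
  have hd : d ≠ 0 := NeZero.ne d
  rw [← lintegral_indicator hΩ, lintegral_polar]
  have hf : ∀ p : Sph d × Set.Ioi (0 : ℝ), (starDomain R).indicator
      (fun x => a (‖x‖ * (homExt R x)⁻¹) * homExt φ x) ((p.2 : ℝ) • (p.1 : Euc d)) =
      φ p.1 * (Set.Iio (1 : ℝ)).indicator a (p.2 * (R p.1)⁻¹) := by
    rintro ⟨ξ, r, hr⟩
    have hr' : 0 < r := hr
    have hlt : r * (R ξ)⁻¹ ∈ Set.Iio (1 : ℝ) ↔ r < R ξ := by
      rw [Set.mem_Iio, ← div_eq_mul_inv, div_lt_one (hR ξ)]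
    change (starDomain R).indicator _ (r • (ξ : Euc d)) =
      φ ξ * (Set.Iio (1 : ℝ)).indicator a (r * (R ξ)⁻¹)
    by_cases h : r < R ξ
    · rw [Set.indicator_of_mem ((smul_mem_starDomain hr' ξ).mpr h),
        Set.indicator_of_mem (hlt.mpr h), homExt_smul_sph _ hr', homExt_smul_sph _ hr',
        norm_smul_sph hr'.le, mul_comm]
    · rw [Set.indicator_of_notMem (mt (smul_mem_starDomain hr' ξ).mp h),
        Set.indicator_of_notMem (mt hlt.mp h), mul_zero]
  simp only [hf]
  have hm : Measurable fun p : Sph d × Set.Ioi (0 : ℝ) =>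
      φ p.1 * (Set.Iio (1 : ℝ)).indicator a (p.2 * (R p.1)⁻¹) := by
    refine (hφ.comp measurable_fst).mul ((ha.indicator measurableSet_Iio).comp ?_)
    exact (measurable_subtype_coe.comp measurable_snd).mul
      (hRc.measurable.comp measurable_fst).inv
  rw [lintegral_prod _ hm.aemeasurable, ← lintegral_mul_const'']
  · refine lintegral_congr fun ξ => ?_
    change ∫⁻ r : Set.Ioi (0 : ℝ), φ ξ * (Set.Iio (1 : ℝ)).indicator a (r * (R ξ)⁻¹)
      ∂(radMeasure d) = _
    rw [lintegral_const_mul, lintegral_radMeasure_scale hd (hR ξ), mul_assoc]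
    exact (ha.indicator measurableSet_Iio).comp (measurable_subtype_coe.mul_const _)
  · exact (hφ.mul (hRc.measurable.pow_const d).ennreal_ofReal).aemeasurable

theorem unitBall_eq_starDomain [NeZero d] : unitBall d = starDomain (fun _ : Sph d => 1) := by
  ext x
  rcases eq_or_ne x 0 with rfl | hx
  · simp only [Metric.mem_ball, dist_self, zero_lt_one, true_iff]
    exact ⟨⟨EuclideanSpace.single 0 1, by simp⟩, 0, le_rfl, one_pos, by simp⟩
  · obtain ⟨r, hr, ξ, rfl⟩ := exists_polar hx
    rw [smul_mem_starDomain hr, mem_ball_zero_iff, norm_smul_sph hr.le]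

theorem lintegral_ball_radial [NeZero d] {a : ℝ → ℝ≥0∞} (ha : Measurable a) :
    ∫⁻ y in unitBall d, a ‖y‖ =
      surf d Set.univ * ∫⁻ r, (Set.Iio (1 : ℝ)).indicator a r ∂(radMeasure d) := by
  have h := lintegral_starDomain (d := d) (R := fun _ => 1) (fun _ => one_pos) continuous_const
    (by rw [← unitBall_eq_starDomain]; exact measurableSet_ball) ha
    (φ := fun _ => 1) measurable_const
  rw [← unitBall_eq_starDomain] at h
  simp only [one_pow, ENNReal.ofReal_one, mul_one, lintegral_one] at h
  rw [← h]
  refine lintegral_congr_ae (ae_restrict_of_ae ?_)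
  filter_upwards [Measure.ae_ne volume (0 : Euc d)] with x hx
  obtain ⟨r, hr, ξ, rfl⟩ := exists_polar hx
  simp only [homExt_smul_sph _ hr, inv_one, mul_one]

/-- The integral over the starlike domain in terms of the integral over the ball. -/
theorem lintegral_starDomain_ball [NeZero d] {R : Sph d → ℝ} (hR : ∀ ξ, 0 < R ξ)
    (hRc : Continuous R) (hΩ : MeasurableSet (starDomain R))
    {a : ℝ → ℝ≥0∞} (ha : Measurable a) {φ : Sph d → ℝ≥0∞} (hφ : Measurable φ) :
    surf d Set.univ * ∫⁻ x in starDomain R, a (‖x‖ * (homExt R x)⁻¹) * homExt φ x =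
      (∫⁻ ξ, φ ξ * ENNReal.ofReal (R ξ ^ d) ∂(surf d)) * ∫⁻ y in unitBall d, a ‖y‖ := by
  rw [lintegral_starDomain hR hRc hΩ ha hφ, lintegral_ball_radial ha, mul_left_comm]

end Polar

/-! ### Volume under Lipschitz homeomorphisms with constant Jacobian -/

section ChangeOfVariables

variable {d : ℕ}

/-- Volume and `d`-dimensional Hausdorff measure are both Haar measures and have the same null sets,
while Lipschitz maps enlarge Hausdorff measure by at most a constant factor. -/
theorem volume_image_null_of_lipschitz {F : Euc d → Euc d} {K : ℝ≥0} (hF : LipschitzWith K F)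
    {N : Set (Euc d)} (hN : volume N = 0) : volume (F '' N) = 0 := by
  set s : ℝ := (Module.finrank ℝ (Euc d) : ℝ)
  have hHaar : (Measure.hausdorffMeasure s : Measure (Euc d)).IsAddHaarMeasure :=
    isAddHaarMeasure_hausdorffMeasure
  have h1 : Measure.hausdorffMeasure s N = 0 :=
    Measure.absolutelyContinuous_isAddHaarMeasure (Measure.hausdorffMeasure s) volume hN
  have h2 : Measure.hausdorffMeasure s (F '' N) = 0 := by
    have := hF.hausdorffMeasure_image_le (d := s) (by positivity) N
    rw [h1, mul_zero] at this
    exact le_antisymm this zero_le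
  exact Measure.absolutelyContinuous_isAddHaarMeasure volume (Measure.hausdorffMeasure s) h2

/-- A Lipschitz homeomorphism with constant Jacobian multiplies volumes by a constant. -/
theorem map_volume_of_abs_det {F : Euc d ≃ₜ Euc d} {K : ℝ≥0} (hF : LipschitzWith K F) {c : ℝ≥0}
    (hc : c ≠ 0)
    (h : ∀ᵐ x, ∃ L : Euc d →L[ℝ] Euc d, HasFDerivAt F L x ∧ |L.det| = c) :
    Measure.map F volume = c⁻¹ • (volume : Measure (Euc d)) := by
  -- A measurable null set containing all bad points: the area formula applies off `N`, and the
  -- image of `N` is null.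
  set N : Set (Euc d) :=
    toMeasurable volume {x | ¬∃ L : Euc d →L[ℝ] Euc d, HasFDerivAt F L x ∧ |L.det| = c}
  have hN0 : volume N = 0 := by rw [measure_toMeasurable]; exact h
  have hNm : MeasurableSet N := measurableSet_toMeasurable _ _
  have hgood : ∀ x, x ∉ N → HasFDerivAt F (fderiv ℝ F x) x ∧ |(fderiv ℝ F x).det| = c := by
    intro x hx
    have : ∃ L : Euc d →L[ℝ] Euc d, HasFDerivAt F L x ∧ |L.det| = c := by
      by_contra hcon
      exact hx (subset_toMeasurable _ _ hcon)
    obtain ⟨L, hL, hdet⟩ := this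
    rw [hL.fderiv]
    exact ⟨hL, hdet⟩
  have himg : ∀ A : Set (Euc d), MeasurableSet A → volume (F '' A) = c * volume A := by
    intro A hA
    have h1 := lintegral_abs_det_fderiv_eq_addHaar_image volume (hA.diff hNm)
      (fun x hx => (hgood x hx.2).1.hasFDerivWithinAt) (F.injective.injOn)
    have h2 : ∫⁻ x in A \ N, ENNReal.ofReal |(fderiv ℝ F x).det| = c * volume A := by
      rw [setLIntegral_congr_fun (hA.diff hNm) (g := fun _ => (c : ℝ≥0∞)) fun x hx => by
        rw [(hgood x hx.2).2, ENNReal.ofReal_coe_nnreal], setLIntegral_const,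
        measure_sdiff_null hN0]
    rw [h2] at h1
    rw [h1]
    refine le_antisymm ?_ (measure_mono (Set.image_mono Set.sdiff_subset))
    calc volume (F '' A) ≤ volume (F '' (A \ N) ∪ F '' N) := by
          refine measure_mono ?_
          rw [← Set.image_union, Set.sdiff_union_self]
          exact Set.image_mono Set.subset_union_left
      _ ≤ volume (F '' (A \ N)) + volume (F '' N) := measure_union_le _ _
      _ = _ := by rw [volume_image_null_of_lipschitz hF hN0, add_zero]
  ext s hs
  have h1 := himg (F ⁻¹' s) (F.measurable hs)
  rw [F.surjective.image_preimage] at h1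
  rw [Measure.map_apply F.measurable hs, Measure.smul_apply, h1, ENNReal.smul_def, smul_eq_mul,
    ENNReal.coe_inv hc, ← mul_assoc, ENNReal.inv_mul_cancel (by simpa using hc) ENNReal.coe_ne_top,
    one_mul]

end ChangeOfVariables

/-! ### The bi-Lipschitz homogeneous map from the starlike domain to the ball -/

section StarMap

variable {d : ℕ} {R : Sph d → ℝ} {H : Sph d ≃ₜ Sph d}

theorem exists_bounds [NeZero d] (hR : ∀ ξ, 0 < R ξ) (hRc : Continuous R) :
    ∃ ρ M : ℝ≥0, 0 < ρ ∧ ∀ ξ, ρ ≤ R ξ ∧ R ξ ≤ M := by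
  have hne : (Set.univ : Set (Sph d)).Nonempty :=
    ⟨⟨EuclideanSpace.single 0 1, by simp⟩, trivial⟩
  obtain ⟨ξ₀, -, h₀⟩ := isCompact_univ.exists_isMinOn hne hRc.continuousOn
  obtain ⟨ξ₁, -, h₁⟩ := isCompact_univ.exists_isMaxOn hne hRc.continuousOn
  exact ⟨⟨R ξ₀, (hR _).le⟩, ⟨R ξ₁, (hR _).le⟩, hR ξ₀, fun ξ =>
    ⟨h₀ (Set.mem_univ ξ), h₁ (Set.mem_univ ξ)⟩⟩

theorem lipschitzWith_smul_of_bounded {a : Sph d → ℝ} {f : Sph d → Euc d} {Ka Kf A : ℝ≥0}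
    (ha : LipschitzWith Ka a) (hf : LipschitzWith Kf f) (hA : ∀ ξ, |a ξ| ≤ A)
    (hf1 : ∀ ξ, ‖f ξ‖ = 1) : LipschitzWith (Ka + A * Kf) fun ξ => a ξ • f ξ := by
  refine LipschitzWith.of_dist_le_mul fun ξ η => ?_
  have h1 := ha.dist_le_mul ξ η
  have h2 := hf.dist_le_mul ξ η
  rw [Real.dist_eq] at h1
  rw [dist_eq_norm] at h2
  have e : a ξ • f ξ - a η • f η = a ξ • (f ξ - f η) + (a ξ - a η) • f η := by module
  rw [dist_eq_norm, e]
  calc _ ≤ |a ξ| * ‖f ξ - f η‖ + |a ξ - a η| * ‖f η‖ := by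
        refine (norm_add_le _ _).trans ?_
        rw [norm_smul, norm_smul, Real.norm_eq_abs, Real.norm_eq_abs]
    _ ≤ A * (Kf * dist ξ η) + Ka * dist ξ η := by
        rw [hf1, mul_one]
        gcongr
        exact hA ξ
    _ = _ := by push_cast; ring

theorem lipschitzWith_inv_of_le {K ρ : ℝ≥0} (hρ : 0 < ρ) (hR : LipschitzWith K R)
    (hle : ∀ ξ, ρ ≤ R ξ) : LipschitzWith (K / ρ ^ 2) fun ξ => (R ξ)⁻¹ := by
  refine LipschitzWith.of_dist_le_mul fun ξ η => ?_
  have hρ' : (0 : ℝ) < ρ := hρ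
  have h1 : 0 < R ξ := hρ'.trans_le (hle ξ)
  have h2 : 0 < R η := hρ'.trans_le (hle η)
  have h := hR.dist_le_mul ξ η
  rw [Real.dist_eq] at h
  rw [Real.dist_eq, inv_sub_inv h1.ne' h2.ne', abs_div, abs_of_pos (mul_pos h1 h2),
    abs_sub_comm, div_le_iff₀ (mul_pos h1 h2), NNReal.coe_div, NNReal.coe_pow]
  calc |R ξ - R η| ≤ K * dist ξ η := h
    _ = K / ρ ^ 2 * dist ξ η * (ρ * ρ) := by field_simp
    _ ≤ _ := by
      gcongr
      · exact hle ξ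
      · exact hle η

/-- The boundary values of the map from the starlike domain to the ball. -/
def starBdry (R : Sph d → ℝ) (H : Sph d ≃ₜ Sph d) (ξ : Sph d) : Euc d := (R ξ)⁻¹ • (H ξ : Euc d)

/-- The boundary values of the map from the ball to the starlike domain. -/
def starBdryInv (R : Sph d → ℝ) (H : Sph d ≃ₜ Sph d) (η : Sph d) : Euc d :=
  R (H.symm η) • (H.symm η : Euc d)

theorem homOne_starBdryInv_starBdry (hR : ∀ ξ, 0 < R ξ) (x : Euc d) :
    homOne (starBdryInv R H) (homOne (starBdry R H) x) = x := by
  rcases eq_or_ne x 0 with rfl | hx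
  · simp [homOne_zero]
  obtain ⟨r, hr, ξ, rfl⟩ := exists_polar hx
  have := hR ξ
  rw [homOne_smul_sph _ hr.le, starBdry, smul_smul, homOne_smul_sph _ (by positivity),
    starBdryInv, H.symm_apply_apply, smul_smul, mul_assoc, inv_mul_cancel₀ this.ne', mul_one]

theorem homOne_starBdry_starBdryInv (hR : ∀ ξ, 0 < R ξ) (x : Euc d) :
    homOne (starBdry R H) (homOne (starBdryInv R H) x) = x := by
  rcases eq_or_ne x 0 with rfl | hx
  · simp [homOne_zero]
  obtain ⟨r, hr, ξ, rfl⟩ := exists_polar hx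
  have := hR (H.symm ξ)
  rw [homOne_smul_sph _ hr.le, starBdryInv, smul_smul, homOne_smul_sph _ (by positivity),
    starBdry, H.apply_symm_apply, smul_smul, mul_assoc, mul_inv_cancel₀ this.ne', mul_one]

theorem exists_lipschitz_starBdry [NeZero d] (hR : ∀ ξ, 0 < R ξ) (hRl : ∃ K, LipschitzWith K R)
    (hH : ∃ K, LipschitzWith K H) : ∃ K, LipschitzWith K (homOne (starBdry R H)) := by
  obtain ⟨KR, hKR⟩ := hRl
  obtain ⟨KH, hKH⟩ := hH
  obtain ⟨ρ, M, hρ, hb⟩ := exists_bounds hR hKR.continuous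
  have hρ' : (0 : ℝ) < ρ := hρ
  have hinv : ∀ ξ, |(R ξ)⁻¹| ≤ (ρ⁻¹ : ℝ≥0) := fun ξ => by
    rw [abs_of_pos (inv_pos.mpr (hR ξ)), NNReal.coe_inv]
    gcongr
    exact (hb ξ).1
  refine ⟨_, lipschitzWith_homOne (M := ρ⁻¹) (lipschitzWith_smul_of_bounded
    (lipschitzWith_inv_of_le hρ hKR fun ξ => (hb ξ).1)
    (LipschitzWith.subtype_val _ |>.comp hKH) hinv fun ξ => norm_sph _) fun ξ => ?_⟩
  rw [starBdry, norm_smul]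
  exact (mul_le_of_le_one_right (norm_nonneg _) (norm_sph _).le).trans (hinv ξ)

theorem exists_lipschitz_starBdryInv [NeZero d] (hR : ∀ ξ, 0 < R ξ)
    (hRl : ∃ K, LipschitzWith K R) (hH : ∃ K, LipschitzWith K H.symm) :
    ∃ K, LipschitzWith K (homOne (starBdryInv R H)) := by
  obtain ⟨KR, hKR⟩ := hRl
  obtain ⟨KH, hKH⟩ := hH
  obtain ⟨ρ, M, hρ, hb⟩ := exists_bounds hR hKR.continuous
  have hle : ∀ η, |R (H.symm η)| ≤ M := fun η => by
    rw [abs_of_pos (hR _)]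
    exact (hb _).2
  refine ⟨_, lipschitzWith_homOne (M := M) (lipschitzWith_smul_of_bounded (hKR.comp hKH)
    (LipschitzWith.subtype_val _ |>.comp hKH) hle fun ξ => norm_sph _) fun ξ => ?_⟩
  rw [starBdryInv, norm_smul]
  exact (mul_le_of_le_one_right (norm_nonneg _) (norm_sph _).le).trans (hle ξ)

/-- The homogeneous map that sends the starlike domain with radius function `R` to the unit ball
and acts as `H` on directions. -/
def starMap [NeZero d] (hR : ∀ ξ, 0 < R ξ) (hRl : ∃ K, LipschitzWith K R)
    (hH : ∃ K, LipschitzWith K H) (hH' : ∃ K, LipschitzWith K H.symm) : Euc d ≃ₜ Euc d where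
  toFun := homOne (starBdry R H)
  invFun := homOne (starBdryInv R H)
  left_inv := homOne_starBdryInv_starBdry hR
  right_inv := homOne_starBdry_starBdryInv hR
  continuous_toFun := (exists_lipschitz_starBdry hR hRl hH).choose_spec.continuous
  continuous_invFun := (exists_lipschitz_starBdryInv hR hRl hH').choose_spec.continuous

theorem preimage_homOne_starBdry [NeZero d] (hR : ∀ ξ, 0 < R ξ) :
    homOne (starBdry R H) ⁻¹' unitBall d = starDomain R := by
  ext x
  rcases eq_or_ne x 0 with rfl | hx
  · refine iff_of_true (by simp [homOne_zero]) ?_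
    exact ⟨⟨EuclideanSpace.single 0 1, by simp⟩, 0, le_rfl, hR _, by simp⟩
  obtain ⟨r, hr, ξ, rfl⟩ := exists_polar hx
  have := hR ξ
  rw [Set.mem_preimage, homOne_smul_sph _ hr.le, starBdry, smul_smul, mem_ball_zero_iff,
    norm_smul_sph (by positivity), ← div_eq_mul_inv, div_lt_one this, smul_mem_starDomain hr]

end StarMap

/-! ### The derivative of that map, its determinant and its adjoint -/

section Derivative

variable {d : ℕ} {R : Sph d → ℝ} {H : Sph d → Sph d} {ξ : Sph d}

/-- The extension is constant along rays. Where it is not differentiable, `fderiv` is 0 by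
convention and the claim still holds. -/
theorem fderiv_homExt_self {V : Type*} [NormedAddCommGroup V] [NormedSpace ℝ V] (f : Sph d → V)
    (ξ : Sph d) : fderiv ℝ (homExt f) (ξ : Euc d) (ξ : Euc d) = 0 := by
  by_cases h : DifferentiableAt ℝ (homExt f) (ξ : Euc d)
  · have h1 : HasDerivAt (fun t : ℝ => t • (ξ : Euc d)) (ξ : Euc d) 1 := by
      simpa using (hasDerivAt_id (1 : ℝ)).smul_const (ξ : Euc d)
    have h2 : HasDerivAt (fun t : ℝ => homExt f (t • (ξ : Euc d)))
        (fderiv ℝ (homExt f) (ξ : Euc d) (ξ : Euc d)) 1 := by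
      have h3 : HasFDerivAt (homExt f) (fderiv ℝ (homExt f) (ξ : Euc d)) ((1 : ℝ) • (ξ : Euc d)) := by
        rw [one_smul]
        exact h.hasFDerivAt
      exact h3.comp_hasDerivAt (1 : ℝ) h1
    have h3 : HasDerivAt (fun t : ℝ => homExt f (t • (ξ : Euc d))) 0 1 := by
      refine (hasDerivAt_const (1 : ℝ) (f ξ)).congr_of_eventuallyEq ?_
      filter_upwards [lt_mem_nhds (zero_lt_one' ℝ)] with t ht
      exact homExt_smul_sph f ht ξ
    exact h2.unique h3
  · rw [fderiv_zero_of_not_differentiableAt h]; rfl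

theorem inner_gradR_self (R : Sph d → ℝ) (ξ : Sph d) : inner ℝ (gradR R ξ) (ξ : Euc d) = 0 := by
  rw [gradR, inner_gradient, fderiv_homExt_self]

theorem derivH_self (H : Sph d → Sph d) (ξ : Sph d) : derivH H ξ (ξ : Euc d) = 0 :=
  fderiv_homExt_self _ ξ

/-- Differentiate the constant function `‖H‖ ^ 2 = 1`. -/
theorem inner_derivH (hH : DifferentiableAt ℝ (homExt fun η => (H η : Euc d)) (ξ : Euc d))
    (y : Euc d) : inner ℝ (H ξ : Euc d) (derivH H ξ y) = 0 := by
  have h1 := hH.hasFDerivAt.norm_sq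
  have h2 : HasFDerivAt (fun x : Euc d => ‖homExt (fun η => (H η : Euc d)) x‖ ^ 2)
      (0 : Euc d →L[ℝ] ℝ) (ξ : Euc d) := by
    refine (hasFDerivAt_const (1 : ℝ) (ξ : Euc d)).congr_of_eventuallyEq ?_
    filter_upwards [isOpen_ne.mem_nhds (sph_ne_zero ξ)] with x hx
    obtain ⟨r, hr, η, rfl⟩ := exists_polar hx
    rw [homExt_smul_sph _ hr, norm_sph, one_pow]
  have h3 := congrArg (fun L : Euc d →L[ℝ] ℝ => L y) (h1.unique h2)
  simp only [homExt_sph] at h3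
  simpa [derivH] using h3

/-- The derivative of the map to the ball, on the sphere. -/
def starDeriv (R : Sph d → ℝ) (H : Sph d → Sph d) (ξ : Sph d) : Euc d →L[ℝ] Euc d :=
  (R ξ)⁻¹ • (derivH H ξ +
    (innerSL ℝ ((ξ : Euc d) - (R ξ)⁻¹ • gradR R ξ)).smulRight (H ξ : Euc d))

theorem starDeriv_apply (y : Euc d) : starDeriv R H ξ y =
    (R ξ)⁻¹ • (derivH H ξ y + inner ℝ ((ξ : Euc d) - (R ξ)⁻¹ • gradR R ξ) y • (H ξ : Euc d)) := rfl

theorem hasFDerivAt_norm_sph (ξ : Sph d) :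
    HasFDerivAt (fun x : Euc d => ‖x‖) (innerSL ℝ (ξ : Euc d)) (ξ : Euc d) := by
  have h1 : HasFDerivAt (fun x : Euc d => √(‖x‖ ^ 2)) _ (ξ : Euc d) :=
    (hasStrictFDerivAt_norm_sq (ξ : Euc d)).hasFDerivAt.sqrt (by simp)
  simp only [Real.sqrt_sq (norm_nonneg _), norm_sph] at h1
  refine h1.congr_fderiv ?_
  ext y
  simp

theorem hasFDerivAt_homOne_sph (hRξ : 0 < R ξ)
    (hR : DifferentiableAt ℝ (homExt R) (ξ : Euc d))
    (hH : DifferentiableAt ℝ (homExt fun η => (H η : Euc d)) (ξ : Euc d)) :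
    HasFDerivAt (homOne fun η => (R η)⁻¹ • (H η : Euc d)) (starDeriv R H ξ) (ξ : Euc d) := by
  have hinv : HasFDerivAt (fun x => (homExt R x)⁻¹) _ (ξ : Euc d) :=
    HasDerivAt.comp_hasFDerivAt (ξ : Euc d)
      (hasDerivAt_inv (x := homExt R (ξ : Euc d)) (by rw [homExt_sph]; exact hRξ.ne')) hR.hasFDerivAt
  have h1 := (hasFDerivAt_norm_sph ξ).fun_smul (hinv.fun_smul hH.hasFDerivAt)
  have hfun : (homOne fun η => (R η)⁻¹ • (H η : Euc d)) =
      fun x : Euc d => ‖x‖ • (homExt R x)⁻¹ • homExt (fun η => (H η : Euc d)) x := by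
    funext x
    rcases eq_or_ne x 0 with rfl | hx
    · simp [homOne_zero]
    obtain ⟨r, hr, η, rfl⟩ := exists_polar hx
    rw [homOne_smul_sph _ hr.le, homExt_smul_sph _ hr, homExt_smul_sph _ hr, norm_smul_sph hr.le]
  rw [hfun]
  refine h1.congr_fderiv ?_
  ext1 y
  have hgr : fderiv ℝ (homExt R) (ξ : Euc d) y = inner ℝ (gradR R ξ) y := by
    rw [gradR, inner_gradient]
  simp only [homExt_sph, norm_sph, starDeriv_apply, inner_sub_left, real_inner_smul_left]
  simp only [one_smul, _root_.add_apply, _root_.smul_apply,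
    ContinuousLinearMap.smulRight_apply, hgr, innerSL_apply_apply]
  have : fderiv ℝ (homExt fun η => (H η : Euc d)) (ξ : Euc d) y = derivH H ξ y := rfl
  rw [this, smul_eq_mul]
  module

/-- The derivative of a function homogeneous of degree one is homogeneous of degree zero, so
computing it on the sphere is enough. -/
theorem hasFDerivAt_homOne_smul {V : Type*} [NormedAddCommGroup V] [NormedSpace ℝ V]
    {f : Sph d → V} {L : Euc d →L[ℝ] V} {x : Euc d} (h : HasFDerivAt (homOne f) L x) {r : ℝ}
    (hr : 0 < r) : HasFDerivAt (homOne f) L (r • x) := by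
  have h0 : HasFDerivAt (fun y : Euc d => r⁻¹ • y) (r⁻¹ • ContinuousLinearMap.id ℝ (Euc d))
      (r • x) := (hasFDerivAt_id _).const_smul r⁻¹
  have h1 : HasFDerivAt (fun y : Euc d => r • homOne f (r⁻¹ • y))
      (r • L.comp (r⁻¹ • ContinuousLinearMap.id ℝ (Euc d))) (r • x) := by
    have h2 : HasFDerivAt (homOne f) L (r⁻¹ • r • x) := by
      rwa [smul_smul, inv_mul_cancel₀ hr.ne', one_smul]
    exact (h2.comp (r • x) h0).const_smul r
  have hfun : (fun y : Euc d => r • homOne f (r⁻¹ • y)) = homOne f := by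
    funext y
    rw [homOne_smul f (inv_pos.mpr hr), smul_smul, mul_inv_cancel₀ hr.ne', one_smul]
  rw [hfun] at h1
  refine h1.congr_fderiv ?_
  ext y
  simp [smul_smul, hr.ne']

/-- Since ∇R is orthogonal to `ξ`, the gradient term is a transvection along `ξ`, of determinant
one. Only the Jacobian of `H` and the factor `(1 / R) ^ d` remain. -/
theorem abs_det_starDeriv (hRξ : 0 < R ξ) :
    |(starDeriv R H ξ).det| = sphereJac H ξ / R ξ ^ d := by
  set A := derivH H ξ + (innerSL ℝ (ξ : Euc d)).smulRight (H ξ : Euc d)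
  set f : Module.Dual ℝ (Euc d) := -((R ξ)⁻¹ • (innerSL ℝ (gradR R ξ) : Euc d →ₗ[ℝ] ℝ))
  have hfv : f (ξ : Euc d) = 0 := by simp [f, inner_gradR_self]
  have hAξ : A (ξ : Euc d) = H ξ := by
    simp only [A, _root_.add_apply, derivH_self, ContinuousLinearMap.smulRight_apply,
      innerSL_apply_apply, real_inner_self_eq_norm_sq, norm_sph]
    simp
  have hL : (starDeriv R H ξ : Euc d →ₗ[ℝ] Euc d) =
      (R ξ)⁻¹ • ((A : Euc d →ₗ[ℝ] Euc d) ∘ₗ LinearMap.transvection f (ξ : Euc d)) := by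
    ext1 y
    have hA : A y = derivH H ξ y + inner ℝ (ξ : Euc d) y • (H ξ : Euc d) := by simp [A]
    have hf : f y = -((R ξ)⁻¹ * inner ℝ (gradR R ξ) y) := by simp [f]
    simp only [LinearMap.smul_apply, LinearMap.comp_apply, ContinuousLinearMap.coe_coe,
      LinearMap.transvection.apply, map_add, map_smul, hAξ, hA, hf, starDeriv_apply,
      inner_sub_left, real_inner_smul_left]
    module
  rw [ContinuousLinearMap.det, hL, LinearMap.det_smul, LinearMap.det_comp,
    LinearMap.transvection.det, hfv, add_zero, mul_one, finrank_euclideanSpace_fin, abs_mul,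
    sphereJac, abs_of_pos (by positivity), inv_pow, div_eq_inv_mul]

theorem adjoint_starDeriv (hH : DifferentiableAt ℝ (homExt fun η => (H η : Euc d)) (ξ : Euc d)) :
    ContinuousLinearMap.adjoint (starDeriv R H ξ) (H ξ : Euc d) =
      (R ξ)⁻¹ • ((ξ : Euc d) - (R ξ)⁻¹ • gradR R ξ) := by
  refine ext_inner_right ℝ fun y => ?_
  rw [ContinuousLinearMap.adjoint_inner_left, starDeriv_apply, inner_smul_right, inner_add_right,
    inner_derivH hH, inner_smul_right, real_inner_self_eq_norm_sq, norm_sph, real_inner_smul_left]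
  ring

/-- The two parts of the adjoint image, along `ξ` and along ∇R, are orthogonal. Times `R ^ d` this
is the integrand of `G0`. -/
theorem norm_sq_adjoint_starDeriv
    (hH : DifferentiableAt ℝ (homExt fun η => (H η : Euc d)) (ξ : Euc d)) :
    ‖ContinuousLinearMap.adjoint (starDeriv R H ξ) (H ξ : Euc d)‖ ^ 2 =
      (R ξ)⁻¹ ^ 2 * (1 + (R ξ)⁻¹ ^ 2 * ‖gradR R ξ‖ ^ 2) := by
  rw [adjoint_starDeriv hH, norm_smul, mul_pow, norm_sub_sq_real, norm_sph, inner_smul_right,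
    real_inner_comm, inner_gradR_self, norm_smul, mul_pow, Real.norm_eq_abs, sq_abs]
  ring

theorem hsNormSq_eq (H : Sph d → Sph d) (ξ : Sph d) :
    hsNormSq H ξ = ∑ i, ‖derivH H ξ (EuclideanSpace.single i 1)‖ ^ 2 := by
  rw [hsNormSq, Finset.sum_comm]
  refine Finset.sum_congr rfl fun i _ => ?_
  rw [EuclideanSpace.real_norm_sq_eq]

/-- The derivative of `H` takes values orthogonal to `H ξ`. Removing the component along `H ξ`,
which carries the squared adjoint norm, leaves exactly the Hilbert–Schmidt norm of DH. -/
theorem sum_norm_sq_starDeriv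
    (hH : DifferentiableAt ℝ (homExt fun η => (H η : Euc d)) (ξ : Euc d)) :
    (∑ i, ‖starDeriv R H ξ (EuclideanSpace.single i 1)‖ ^ 2) -
      ‖ContinuousLinearMap.adjoint (starDeriv R H ξ) (H ξ : Euc d)‖ ^ 2 =
      (R ξ)⁻¹ ^ 2 * hsNormSq H ξ := by
  have h1 : ∀ y : Euc d, ‖starDeriv R H ξ y‖ ^ 2 = (R ξ)⁻¹ ^ 2 * (‖derivH H ξ y‖ ^ 2 +
      inner ℝ ((ξ : Euc d) - (R ξ)⁻¹ • gradR R ξ) y ^ 2) := by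
    intro y
    rw [starDeriv_apply, norm_smul, mul_pow, Real.norm_eq_abs, sq_abs, norm_add_sq_real,
      inner_smul_right, real_inner_comm (H ξ : Euc d), inner_derivH hH, norm_smul, norm_sph, Real.norm_eq_abs,
      mul_one, sq_abs]
    ring
  simp only [h1]
  rw [← Finset.mul_sum, Finset.sum_add_distrib, ← hsNormSq_eq, adjoint_starDeriv hH, norm_smul,
    mul_pow, Real.norm_eq_abs, sq_abs, EuclideanSpace.real_norm_sq_eq]
  simp only [EuclideanSpace.inner_single_right]
  simp
  ring

end Derivative

/-! ### The geometric factors as angular integrals -/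

section Factors

variable {d : ℕ} {R : Sph d → ℝ} {H : Sph d → Sph d}

/-- The numerator of `G₀`, up to normalization. -/
def numG0 (R : Sph d → ℝ) : ℝ :=
  ∫ ξ, (R ξ ^ ((d : ℤ) - 2) + ‖gradR R ξ‖ ^ 2 * R ξ ^ ((d : ℤ) - 4)) ∂(surf d)

/-- The numerator of `G₁`, up to normalization. -/
def numG1 (R : Sph d → ℝ) (H : Sph d → Sph d) : ℝ :=
  ∫ ξ, (hsNormSq H ξ / ((d : ℝ) - 1) * R ξ ^ ((d : ℤ) - 2)) ∂(surf d)

theorem measurable_homExt {V : Type*} [Zero V] [MeasurableSpace V] {f : Sph d → V}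
    (hf : Measurable f) : Measurable (homExt f) := by
  refine measurable_of_measurable_on_compl_singleton 0 ?_
  have h1 : Measurable fun x : {x : Euc d | x ≠ 0} =>
      f ⟨‖(x : Euc d)‖⁻¹ • (x : Euc d), by
        have := norm_ne_zero_iff.mpr x.2
        simp [norm_smul, this]⟩ := by
    refine hf.comp (Measurable.subtype_mk ?_)
    exact (measurable_subtype_coe.norm.inv).smul measurable_subtype_coe
  convert h1 using 2 with x
  exact dif_neg x.2

theorem measurable_fderiv_homExt {V : Type*} [NormedAddCommGroup V] [NormedSpace ℝ V]
    [CompleteSpace V] (f : Sph d → V) :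
    Measurable fun ξ : Sph d => fderiv ℝ (homExt f) (ξ : Euc d) :=
  (measurable_fderiv ℝ (homExt f)).comp measurable_subtype_coe

theorem measurable_gradR (R : Sph d → ℝ) : Measurable (gradR R) :=
  (LinearIsometryEquiv.continuous _).measurable.comp (measurable_fderiv_homExt R)

theorem measurable_hsNormSq (H : Sph d → Sph d) : Measurable (hsNormSq H) := by
  have : hsNormSq H = fun ξ => ∑ i, ‖derivH H ξ (EuclideanSpace.single i 1)‖ ^ 2 :=
    funext (hsNormSq_eq H)
  rw [this]
  refine Finset.measurable_sum _ fun i _ => Measurable.pow_const ?_ 2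
  exact ((ContinuousLinearMap.apply ℝ (Euc d) (EuclideanSpace.single i 1)).continuous.measurable.comp
    (measurable_fderiv_homExt _)).norm

theorem integrable_zpow (hR : ∀ ξ, 0 < R ξ) (hRc : Continuous R) (k : ℤ) :
    Integrable (fun ξ => R ξ ^ k) (surf d) := by
  refine Continuous.integrable_of_hasCompactSupport ?_ (HasCompactSupport.of_compactSpace _)
  exact hRc.zpow₀ k fun ξ => Or.inl (hR ξ).ne'

theorem integrable_gradR (hR : ∀ ξ, 0 < R ξ) {K : ℝ≥0} (hK : LipschitzWith K R) (k : ℤ) :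
    Integrable (fun ξ => ‖gradR R ξ‖ ^ 2 * R ξ ^ k) (surf d) := by
  refine (integrable_zpow hR hK.continuous k).bdd_mul (c := (2 * K) ^ 2)
    ((measurable_gradR R).norm.pow_const 2).aestronglyMeasurable (Eventually.of_forall fun ξ => ?_)
  rw [norm_pow, norm_norm, gradR, gradient, LinearIsometryEquiv.norm_map]
  gcongr
  exact norm_fderiv_homExt_le hK ξ

theorem integrable_hsNormSq (hR : ∀ ξ, 0 < R ξ) (hRc : Continuous R) {K : ℝ≥0}
    (hK : LipschitzWith K H) (k : ℤ) :
    Integrable (fun ξ => hsNormSq H ξ * R ξ ^ k) (surf d) := by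
  refine (integrable_zpow hR hRc k).bdd_mul (c := ∑ _i : Fin d, (2 * K) ^ 2)
    (measurable_hsNormSq H).aestronglyMeasurable (Eventually.of_forall fun ξ => ?_)
  rw [hsNormSq_eq, Real.norm_of_nonneg (by positivity)]
  refine Finset.sum_le_sum fun i _ => ?_
  gcongr
  refine (ContinuousLinearMap.le_opNorm _ _).trans ?_
  have h1 : ‖derivH H ξ‖ ≤ 2 * K := by
    have := norm_fderiv_homExt_le ((LipschitzWith.subtype_val _).comp hK) ξ
    rwa [one_mul] at this
  simpa using h1

theorem hsNormSq_nonneg (ξ : Sph d) : 0 ≤ hsNormSq H ξ := by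
  rw [hsNormSq_eq]; positivity

theorem numG0_nonneg (hR : ∀ ξ, 0 < R ξ) : 0 ≤ numG0 R :=
  integral_nonneg fun ξ => by
    have := hR ξ
    dsimp only
    positivity

theorem numG1_nonneg (hd : 2 ≤ d) (hR : ∀ ξ, 0 < R ξ) : 0 ≤ numG1 R H :=
  integral_nonneg fun ξ => by
    have := hR ξ
    have h1 := hsNormSq_nonneg (H := H) ξ
    have h2 : (0 : ℝ) ≤ (d : ℝ) - 1 := by
      have : (2 : ℝ) ≤ d := by exact_mod_cast hd
      linarith
    dsimp only
    positivity

/-- The factor of the radial energy. -/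
def radFactor (R : Sph d → ℝ) (ξ : Sph d) : ℝ≥0∞ :=
  ENNReal.ofReal ((R ξ)⁻¹ ^ 2 * (1 + (R ξ)⁻¹ ^ 2 * ‖gradR R ξ‖ ^ 2))

/-- The factor of the tangential energy. -/
def tanFactor (R : Sph d → ℝ) (H : Sph d → Sph d) (ξ : Sph d) : ℝ≥0∞ :=
  ENNReal.ofReal ((R ξ)⁻¹ ^ 2 * hsNormSq H ξ)

theorem measurable_radFactor (hRc : Continuous R) : Measurable (radFactor R) := by
  have h1 := hRc.measurable
  have h2 := (measurable_gradR R).norm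
  exact ((h1.inv.pow_const 2).mul
    (((h1.inv.pow_const 2).mul (h2.pow_const 2)).const_add 1)).ennreal_ofReal

theorem measurable_tanFactor (hRc : Continuous R) : Measurable (tanFactor R H) :=
  ((hRc.measurable.inv.pow_const 2).mul (measurable_hsNormSq H)).ennreal_ofReal

theorem lintegral_radFactor (hR : ∀ ξ, 0 < R ξ) {K : ℝ≥0} (hK : LipschitzWith K R) :
    ∫⁻ ξ, radFactor R ξ * ENNReal.ofReal (R ξ ^ d) ∂(surf d) = ENNReal.ofReal (numG0 R) := by
  have hint : Integrable (fun ξ => R ξ ^ ((d : ℤ) - 2) + ‖gradR R ξ‖ ^ 2 * R ξ ^ ((d : ℤ) - 4))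
      (surf d) := (integrable_zpow hR hK.continuous _).add (integrable_gradR hR hK _)
  rw [numG0, ofReal_integral_eq_lintegral_ofReal hint
    (Eventually.of_forall fun ξ => by have := hR ξ; dsimp only [Pi.zero_apply]; positivity)]
  refine lintegral_congr fun ξ => ?_
  have := hR ξ
  rw [radFactor, ← ENNReal.ofReal_mul (by positivity), zpow_sub₀ this.ne', zpow_sub₀ this.ne',
    zpow_natCast]
  congr 1
  norm_cast
  field_simp

/-- The factor `d - 1` undoes the division in `G1`; later it joins `tanAvg`, which measures a single
tangential direction out of `d - 1`. -/
theorem lintegral_tanFactor (hd : 2 ≤ d) (hR : ∀ ξ, 0 < R ξ) (hRc : Continuous R) {K : ℝ≥0}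
    (hK : LipschitzWith K H) :
    ∫⁻ ξ, tanFactor R H ξ * ENNReal.ofReal (R ξ ^ d) ∂(surf d) =
      ENNReal.ofReal ((d : ℝ) - 1) * ENNReal.ofReal (numG1 R H) := by
  have hd1 : (0 : ℝ) < (d : ℝ) - 1 := by
    have : (2 : ℝ) ≤ d := by exact_mod_cast hd
    linarith
  have e : ((d : ℝ) - 1) * numG1 R H = ∫ ξ, hsNormSq H ξ * R ξ ^ ((d : ℤ) - 2) ∂(surf d) := by
    rw [numG1, ← integral_const_mul]
    congr 1
    funext ξ
    field_simp
  rw [← ENNReal.ofReal_mul hd1.le, e, ofReal_integral_eq_lintegral_ofReal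
    (integrable_hsNormSq hR hRc hK _) (Eventually.of_forall fun ξ => by
      have := hR ξ
      have h1 := hsNormSq_nonneg (H := H) ξ
      dsimp only [Pi.zero_apply]
      positivity)]
  refine lintegral_congr fun ξ => ?_
  have := hR ξ
  have h1 := hsNormSq_nonneg (H := H) ξ
  rw [tanFactor, ← ENNReal.ofReal_mul (by positivity), zpow_sub₀ this.ne', zpow_natCast]
  congr 1
  norm_cast
  field_simp

theorem surf_univ_pos [NeZero d] : 0 < (surf d).real Set.univ := by
  rw [Measure.toSphere_real_apply_univ, finrank_euclideanSpace_fin]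
  have h1 : 0 < volume.real (unitBall d) :=
    ENNReal.toReal_pos (Metric.measure_ball_pos volume _ one_pos).ne' measure_ball_lt_top.ne
  have h2 : (0 : ℝ) < d := by exact_mod_cast Nat.pos_of_ne_zero (NeZero.ne d)
  exact mul_pos h2 h1

theorem Gmix_mul_denomG (hD : denomG R ≠ 0) (α : ℝ) :
    (surf d).real Set.univ * (Gmix R H α * denomG R) =
      (surf d).real Set.univ * ((surf d).real Set.univ)⁻¹ *
        ((1 - α) * numG0 R + α * numG1 R H) := by
  rw [Gmix, G0, G1, average_eq, average_eq, smul_eq_mul, smul_eq_mul, numG0, numG1]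
  field_simp

/-- The polar comparison formula with both integrands equal to 1. It identifies `denomG` with a
power of the volume ratio. -/
theorem average_pow_eq [NeZero d] (hR : ∀ ξ, 0 < R ξ) (hRc : Continuous R)
    (hΩ : MeasurableSet (starDomain R)) :
    ⨍ ξ, R ξ ^ d ∂(surf d) = volume.real (starDomain R) / volume.real (unitBall d) := by
  have h := lintegral_starDomain_ball hR hRc hΩ (a := fun _ => 1) measurable_const
    (φ := fun _ => 1) measurable_const
  have h1 : ∫⁻ x in starDomain R, (1 : ℝ≥0∞) * homExt (fun _ => (1 : ℝ≥0∞)) x =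
      volume (starDomain R) := by
    rw [← setLIntegral_one]
    refine lintegral_congr_ae (ae_restrict_of_ae ?_)
    filter_upwards [Measure.ae_ne volume (0 : Euc d)] with x hx
    rw [homExt, dif_neg hx, mul_one]
  have hint : Integrable (fun ξ => R ξ ^ d) (surf d) := by
    simpa only [zpow_natCast] using integrable_zpow hR hRc (d : ℤ)
  have h2 : ∫⁻ ξ, 1 * ENNReal.ofReal (R ξ ^ d) ∂(surf d) =
      ENNReal.ofReal (∫ ξ, R ξ ^ d ∂(surf d)) := by
    rw [ofReal_integral_eq_lintegral_ofReal hint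
      (Eventually.of_forall fun ξ => by have := hR ξ; dsimp only [Pi.zero_apply]; positivity)]
    simp only [one_mul]
  rw [h1, h2, setLIntegral_one] at h
  have h3 := congrArg ENNReal.toReal h
  rw [ENNReal.toReal_mul, ENNReal.toReal_mul, ENNReal.toReal_ofReal
    (integral_nonneg fun ξ => by have := hR ξ; dsimp only [Pi.zero_apply]; positivity)] at h3
  have hS : 0 < (surf d Set.univ).toReal := surf_univ_pos
  have hB : 0 < (volume (unitBall d)).toReal :=
    ENNReal.toReal_pos (Metric.measure_ball_pos volume _ one_pos).ne' measure_ball_lt_top.ne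
  rw [average_eq, smul_eq_mul, measureReal_def, measureReal_def, measureReal_def,
    eq_div_iff hB.ne']
  field_simp
  linarith

end Factors

/-! ### Composition with rotations of the ball -/

section RotatedMaps

variable {d : ℕ}

/-- Composition with a rotation of the target. -/
def rotComp (F : Euc d ≃ₜ Euc d) (U : Rot d) : Euc d ≃ₜ Euc d :=
  F.trans (rotEquiv U).symm.toHomeomorph

theorem IsBiLip.rotComp {F : Euc d ≃ₜ Euc d} {m : ℝ≥0} (hF : IsBiLip F m) (U : Rot d) :
    IsBiLip (rotComp F U) m where
  lip := by
    obtain ⟨K, hK⟩ := hF.lip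
    exact ⟨_, (rotEquiv U).symm.lipschitz.comp hK⟩
  lip_symm := by
    obtain ⟨K, hK⟩ := hF.lip_symm
    exact ⟨_, hK.comp (rotEquiv U).lipschitz⟩
  map_eq := by
    have h1 : Measure.map (rotEquiv U).symm (Measure.map F volume) =
        Measure.map (StarEig.rotComp F U) volume :=
      Measure.map_map (rotEquiv U).symm.continuous.measurable F.measurable
    rw [← h1, hF.map_eq, Measure.map_smul, (rotEquiv U).symm.measurePreserving.map_eq]
  ne_zero := hF.ne_zero

theorem preimage_rotComp {F : Euc d ≃ₜ Euc d} {Ω : Set (Euc d)} (hΩ : F ⁻¹' unitBall d = Ω)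
    (U : Rot d) : rotComp F U ⁻¹' unitBall d = Ω := by
  rw [← hΩ]
  ext x
  simp [rotComp]

/-- The rotation is shifted from the map to the field, so the average over `U` acts on the field
alone while the derivative of `F` stays fixed. -/
theorem pullField_rotComp (F : Euc d ≃ₜ Euc d) (U : Rot d) (g : Euc d → Euc d) (x : Euc d) :
    pullField (rotComp F U) g x =
      ContinuousLinearMap.adjoint (fderiv ℝ F x) (rotField g U (F x)) := by
  have h1 : fderiv ℝ (rotComp F U) x =
      ((star U : Rot d) : Euc d →L[ℝ] Euc d).comp (fderiv ℝ F x) :=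
    LinearIsometryEquiv.comp_fderiv (rotEquiv U).symm
  rw [pullField, h1, ContinuousLinearMap.adjoint_comp, adjoint_rot]
  rfl

theorem measurable_pull_rotField (F : Euc d ≃ₜ Euc d) {g : Euc d → Euc d} (hg : Measurable g) :
    Measurable fun p : Rot d × Euc d =>
      ‖ContinuousLinearMap.adjoint (fderiv ℝ F p.2) (rotField g p.1 (F p.2))‖ₑ ^ 2 := by
  have happ : Measurable fun q : (Euc d →L[ℝ] Euc d) × Euc d => q.1 q.2 :=
    isBoundedBilinearMap_apply.continuous.measurable
  refine (happ.comp (Measurable.prodMk ?_ ?_)).enorm.pow_const 2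
  · exact (measurable_adjoint_fderiv F).comp measurable_snd
  · exact (measurable_rotField hg).comp
      (measurable_fst.prodMk (F.measurable.comp measurable_snd))

end RotatedMaps

/-! ### The mean energy of the transplanted functions -/

section Transplantation

variable {d : ℕ} [NeZero d] {R : Sph d → ℝ} {H : Sph d ≃ₜ Sph d}

theorem ae_good (hRl : ∃ K, LipschitzWith K R) (hR : ∀ ξ, 0 < R ξ) (hH : IsBoundaryHomeo R H) :
    ∀ᵐ x : Euc d, ∃ r : ℝ, 0 < r ∧ ∃ ξ : Sph d, x = r • (ξ : Euc d) ∧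
      DifferentiableAt ℝ (homExt R) (ξ : Euc d) ∧
      DifferentiableAt ℝ (homExt fun η => (H η : Euc d)) (ξ : Euc d) ∧
      sphereJac H ξ = volume.real (unitBall d) / volume.real (starDomain R) * R ξ ^ d := by
  obtain ⟨KR, hKR⟩ := hRl
  obtain ⟨KH, hKH⟩ := hH.lipschitz
  obtain ⟨ρ, M, hρ, hb⟩ := exists_bounds hR hKR.continuous
  have h1 := ae_differentiableAt_homExt (M := M) hKR fun ξ => by
    rw [Real.norm_of_nonneg (hR ξ).le]; exact (hb ξ).2
  have h2 := ae_differentiableAt_homExt (M := 1) ((LipschitzWith.subtype_val _).comp hKH)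
    fun ξ => (norm_sph (H ξ)).le
  filter_upwards [h1, h2, ae_of_ae_surf hH.jac, Measure.ae_ne volume (0 : Euc d)]
    with x hx1 hx2 hx3 hx0
  obtain ⟨r, hr, ξ, rfl⟩ := exists_polar hx0
  exact ⟨r, hr, ξ, rfl, differentiableAt_homExt_of_smul hr hx1,
    differentiableAt_homExt_of_smul hr hx2, hx3 r hr ξ rfl⟩

/-- The weight `R ^ d` in the condition on the Jacobian of `H` cancels the one in
`abs_det_starDeriv`, leaving the constant `1 / m`. -/
theorem isBiLip_starMap (hRl : ∃ K, LipschitzWith K R) (hR : ∀ ξ, 0 < R ξ)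
    (hH : IsBoundaryHomeo R H) {m : ℝ≥0} (hm : m ≠ 0)
    (hmV : (m : ℝ) = volume.real (starDomain R) / volume.real (unitBall d)) :
    IsBiLip (starMap hR hRl hH.lipschitz hH.lipschitz_symm) m where
  lip := exists_lipschitz_starBdry hR hRl hH.lipschitz
  lip_symm := exists_lipschitz_starBdryInv hR hRl hH.lipschitz_symm
  map_eq := by
    obtain ⟨K, hK⟩ := exists_lipschitz_starBdry hR hRl hH.lipschitz
    have h := map_volume_of_abs_det (F := starMap hR hRl hH.lipschitz hH.lipschitz_symm)
      (c := m⁻¹) hK (inv_ne_zero hm) ?_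
    · rwa [inv_inv] at h
    filter_upwards [ae_good hRl hR hH] with x hx
    obtain ⟨r, hr, ξ, rfl, h1, h2, h3⟩ := hx
    refine ⟨starDeriv R H ξ,
      hasFDerivAt_homOne_smul (hasFDerivAt_homOne_sph (hR ξ) h1 h2) hr, ?_⟩
    have := hR ξ
    rw [abs_det_starDeriv this, h3, NNReal.coe_inv, hmV, inv_div]
    field_simp
  ne_zero := hm

/-- The average over all rotations of the Dirichlet energy of the transplanted function. -/
theorem lintegral_energy (hd : 2 ≤ d) (hRl : ∃ K, LipschitzWith K R) (hR : ∀ ξ, 0 < R ξ)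
    (hH : IsBoundaryHomeo R H) (hΩ : MeasurableSet (starDomain R)) {g : Euc d → Euc d}
    (hg : Measurable g) :
    surf d Set.univ * ∫⁻ U, (∫⁻ x in starDomain R,
        ‖ContinuousLinearMap.adjoint (fderiv ℝ (starMap hR hRl hH.lipschitz hH.lipschitz_symm) x)
          (rotField g U (starMap hR hRl hH.lipschitz hH.lipschitz_symm x))‖ₑ ^ 2)
        ∂(rotMeasure d) =
      ENNReal.ofReal (numG0 R) * (∫⁻ y in unitBall d, radAvg g ‖y‖) +
      ENNReal.ofReal (numG1 R H) *
        (ENNReal.ofReal ((d : ℝ) - 1) * ∫⁻ y in unitBall d, tanAvg g ‖y‖) := by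
  set F := starMap hR hRl hH.lipschitz hH.lipschitz_symm
  obtain ⟨KR, hKR⟩ := hRl
  obtain ⟨KH, hKH⟩ := hH.lipschitz
  have hra : Measurable (radAvg g) := measurable_rotQuad_rotField hg _ _
  have hta : Measurable (tanAvg g) := measurable_rotQuad_rotField hg _ _
  have hrm := measurable_radFactor hKR.continuous
  have htm := measurable_tanFactor (H := H) hKR.continuous
  have hmeas : AEMeasurable (fun x => radAvg g (‖x‖ * (homExt R x)⁻¹) * homExt (radFactor R) x)
      (volume.restrict (starDomain R)) :=
    ((hra.comp (measurable_norm.mul (measurable_homExt hKR.continuous.measurable).inv)).mul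
      (measurable_homExt hrm)).aemeasurable
  -- Averaging first over rotations at a fixed point replaces the field by its radial and tangential
  -- means, after which the integral over the domain splits into angle and radius.
  rw [lintegral_lintegral_swap (measurable_pull_rotField F hg).aemeasurable]
  have hswap : ∫⁻ x in starDomain R, (∫⁻ U, ‖ContinuousLinearMap.adjoint (fderiv ℝ F x)
        (rotField g U (F x))‖ₑ ^ 2 ∂(rotMeasure d)) =
      (∫⁻ x in starDomain R, radAvg g (‖x‖ * (homExt R x)⁻¹) * homExt (radFactor R) x) +
      ∫⁻ x in starDomain R, tanAvg g (‖x‖ * (homExt R x)⁻¹) * homExt (tanFactor R H) x := by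
    rw [← lintegral_add_left' hmeas]
    refine lintegral_congr_ae (ae_restrict_of_ae ?_)
    filter_upwards [ae_good ⟨KR, hKR⟩ hR hH] with x hx
    obtain ⟨r, hr, ξ, rfl, h1, h2, -⟩ := hx
    have hDF : fderiv ℝ F (r • (ξ : Euc d)) = starDeriv R H ξ :=
      (hasFDerivAt_homOne_smul (hasFDerivAt_homOne_sph (hR ξ) h1 h2) hr).fderiv
    have hF : F (r • (ξ : Euc d)) = (r * (R ξ)⁻¹) • (H ξ : Euc d) := by
      rw [mul_smul]
      exact homOne_smul_sph _ hr.le ξ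
    rw [hDF, hF, lintegral_rotField hd hg (norm_sph (H ξ)), sum_norm_sq_starDeriv h2,
      norm_sq_adjoint_starDeriv h2, norm_smul_sph hr.le, homExt_smul_sph _ hr,
      homExt_smul_sph _ hr, homExt_smul_sph _ hr, radFactor, tanFactor]
    ring
  rw [hswap, mul_add, lintegral_starDomain_ball hR hKR.continuous hΩ hra hrm,
    lintegral_starDomain_ball hR hKR.continuous hΩ hta htm, lintegral_radFactor hR hKR,
    lintegral_tanFactor hd hR hKR.continuous hKH]
  ring

end Transplantation

/-! ### Comparison of eigenvalue sums -/

section Comparison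

variable {d : ℕ}

theorem volume_ball_pos : 0 < volume.real (unitBall d) :=
  ENNReal.toReal_pos (Metric.measure_ball_pos volume _ one_pos).ne' measure_ball_lt_top.ne

/-- The first Neumann eigenvalue of the ball vanishes. -/
theorem eigenvalue_H1_ball_one : eigenvalue (H1 (unitBall d)) 1 = 0 := by
  refine le_antisymm (eigenvalue_le le_rfl ?_) (eigenvalue_nonneg le_rfl)
  set c : ℝ := (√(volume.real (unitBall d)))⁻¹
  have hV : 0 < volume.real (unitBall d) := volume_ball_pos
  have hfin : IsFiniteMeasure (volume.restrict (unitBall d)) :=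
    ⟨by simpa using measure_ball_lt_top⟩
  have hm : MemLp (fun _ : Euc d => c) 2 (volume.restrict (unitBall d)) := memLp_const c
  refine ⟨fun _ => hm.toLp _, ?_, fun _ => ⟨0, le_rfl, 0, ?_, fun p _ => ?_⟩⟩
  · rw [orthonormal_iff_ite]
    intro i j
    rw [if_pos (Subsingleton.elim i j), real_inner_self_eq_norm_sq, norm_sq_Lp]
    calc _ = ∫ _x in unitBall d, c ^ 2 := by
          refine integral_congr_ae ?_
          filter_upwards [hm.coeFn_toLp] with x hx
          rw [hx, Real.norm_eq_abs, sq_abs]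
      _ = 1 := by
          rw [setIntegral_const, smul_eq_mul, inv_pow, Real.sq_sqrt hV.le,
            mul_inv_cancel₀ hV.ne']
  · intro φ hφ e
    have h := hasWeakGrad_of_lipschitz (Ω := unitBall d) (LipschitzWith.const c) φ hφ e
    calc _ = ∫ x in unitBall d, c * fderiv ℝ φ x e := by
          refine integral_congr_ae ?_
          filter_upwards [hm.coeFn_toLp] with x hx
          rw [hx]
      _ = _ := h
      _ = _ := by
          congr 1
          refine integral_congr_ae ?_
          filter_upwards [Lp.coeFn_zero (Euc d) 2 (volume.restrict (unitBall d))] with x hx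
          rw [hx, inner_gradient]
          simp
  · simp

/-- The radial part of the energy of a vector field. -/
def radEnergy (g : L2vec (unitBall d)) : ℝ :=
  ∫ x in unitBall d, (inner ℝ (g x) (‖x‖⁻¹ • x)) ^ 2

theorem norm_inv_smul_le (x : Euc d) : ‖‖x‖⁻¹ • x‖ ≤ 1 := by
  rw [norm_smul, norm_inv, norm_norm]
  exact inv_mul_le_one

theorem memLp_radial (g : L2vec (unitBall d)) :
    MemLp (fun x => inner ℝ (g x) (‖x‖⁻¹ • x)) 2 (volume.restrict (unitBall d)) := by
  refine (Lp.memLp g).of_le ?_ (Eventually.of_forall fun x => ?_)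
  · refine (Lp.stronglyMeasurable g).aestronglyMeasurable.inner ?_
    exact (by fun_prop : Measurable fun x : Euc d => ‖x‖⁻¹ • x).aestronglyMeasurable
  · exact (norm_inner_le_norm _ _).trans
      (mul_le_of_le_one_right (norm_nonneg _) (norm_inv_smul_le x))

theorem ofReal_radEnergy (g : L2vec (unitBall d)) : ENNReal.ofReal (radEnergy g) =
    ∫⁻ y in unitBall d, ‖inner ℝ (g y) (‖y‖⁻¹ • y)‖ₑ ^ 2 := by
  rw [← ofReal_integral_norm_sq (memLp_radial g), radEnergy]
  simp only [Real.norm_eq_abs, sq_abs]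

theorem radEnergy_nonneg (g : L2vec (unitBall d)) : 0 ≤ radEnergy g :=
  integral_nonneg fun _ => sq_nonneg _

theorem radEnergy_le (g : L2vec (unitBall d)) : radEnergy g ≤ ‖g‖ ^ 2 := by
  rw [norm_sq_Lp, radEnergy]
  refine integral_mono ?_ ((Lp.memLp g).integrable_norm_pow (by norm_num)) fun x => ?_
  · exact (memLp_radial g).integrable_sq
  · dsimp only
    rw [← sq_abs]
    gcongr
    exact (abs_real_inner_le_norm _ _).trans
      (mul_le_of_le_one_right (norm_nonneg _) (norm_inv_smul_le x))

/-- When `g` vanishes, as for the constant Neumann eigenfunction, the energy fraction is 0/0, read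
as 0, and both sides are still equal. -/
theorem radEnergy_eq (g : L2vec (unitBall d)) :
    radEnergy g = (1 - angularFraction g) * ‖g‖ ^ 2 := by
  have h : angularFraction g = 1 - radEnergy g / ‖g‖ ^ 2 := by
    rw [angularFraction, radialFraction, radEnergy, norm_sq_Lp]
  rcases eq_or_ne (‖g‖ ^ 2) 0 with h0 | h0
  · rw [h0, mul_zero]
    exact le_antisymm (h0 ▸ radEnergy_le g) (radEnergy_nonneg g)
  · rw [h, sub_sub_cancel, div_mul_cancel₀ _ h0]

variable [NeZero d] {R : Sph d → ℝ} {H : Sph d ≃ₜ Sph d}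

/-- The domain is the preimage of the ball under the map built from the identity of the sphere, so
no `H` has to be given. -/
theorem isOpen_starDomain (hR : ∀ ξ, 0 < R ξ) (hRl : ∃ K, LipschitzWith K R) :
    IsOpen (starDomain R) := by
  have h := preimage_homOne_starBdry (H := Homeomorph.refl _) hR
  obtain ⟨K, hK⟩ := exists_lipschitz_starBdry (H := Homeomorph.refl _) hR hRl
    ⟨1, LipschitzWith.id⟩
  rw [← h]
  exact Metric.isOpen_ball.preimage hK.continuous

theorem volume_starDomain_pos (hR : ∀ ξ, 0 < R ξ) (hRl : ∃ K, LipschitzWith K R) :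
    0 < volume.real (starDomain R) := by
  refine ENNReal.toReal_pos ?_ ?_
  · refine ((isOpen_starDomain hR hRl).measure_pos volume ⟨0, ?_⟩).ne'
    exact ⟨⟨EuclideanSpace.single 0 1, by simp⟩, 0, le_rfl, hR _, by simp⟩
  · obtain ⟨K, hK⟩ := hRl
    obtain ⟨ρ, M, -, hb⟩ := exists_bounds hR hK.continuous
    refine ((measure_mono ?_).trans_lt (measure_closedBall_lt_top (x := (0 : Euc d)) (r := M))).ne
    rintro _ ⟨ξ, r, hr, hrR, rfl⟩
    rw [mem_closedBall_zero_iff, norm_smul_sph hr]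
    exact hrR.le.trans (hb ξ).2

theorem denomG_eq (hR : ∀ ξ, 0 < R ξ) (hRl : ∃ K, LipschitzWith K R) :
    denomG R = (volume.real (starDomain R) / volume.real (unitBall d)) ^
      (((d : ℝ) - 2) / (d : ℝ)) := by
  obtain ⟨K, hK⟩ := hRl
  rw [denomG, average_pow_eq hR hK.continuous (isOpen_starDomain hR ⟨K, hK⟩).measurableSet]

/-- The mean energy of the transplanted function, in terms of the geometric factors. -/
theorem lintegral_energy_eq (hd : 2 ≤ d) (hRl : ∃ K, LipschitzWith K R) (hR : ∀ ξ, 0 < R ξ)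
    (hH : IsBoundaryHomeo R H) (g : L2vec (unitBall d)) :
    0 ≤ ‖g‖ ^ 2 * (Gmix R H (angularFraction g) * denomG R) ∧
    ∫⁻ U, (∫⁻ x in starDomain R,
        ‖ContinuousLinearMap.adjoint (fderiv ℝ (starMap hR hRl hH.lipschitz hH.lipschitz_symm) x)
          (rotField g U (starMap hR hRl hH.lipschitz hH.lipschitz_symm x))‖ₑ ^ 2)
        ∂(rotMeasure d) =
      ENNReal.ofReal (‖g‖ ^ 2 * (Gmix R H (angularFraction g) * denomG R)) := by
  have hg : Measurable g := (Lp.stronglyMeasurable g).measurable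
  have hD : denomG R ≠ 0 := by
    rw [denomG_eq hR hRl]
    exact (Real.rpow_pos_of_pos (div_pos (volume_starDomain_pos hR hRl) volume_ball_pos) _).ne'
  have hS : 0 < (surf d).real Set.univ := surf_univ_pos
  have h0 := numG0_nonneg hR
  have h1 := numG1_nonneg (H := H) hd hR
  have hr0 := radEnergy_nonneg g
  have hr1 := radEnergy_le g
  have hG : (surf d).real Set.univ * (‖g‖ ^ 2 * (Gmix R H (angularFraction g) * denomG R)) =
      numG0 R * radEnergy g + numG1 R H * (‖g‖ ^ 2 - radEnergy g) := by
    have := Gmix_mul_denomG (H := H) hD (angularFraction g)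
    rw [mul_inv_cancel₀ hS.ne', one_mul] at this
    rw [mul_left_comm, this, radEnergy_eq]
    ring
  have hpos : 0 ≤ numG0 R * radEnergy g + numG1 R H * (‖g‖ ^ 2 - radEnergy g) :=
    add_nonneg (mul_nonneg h0 hr0) (mul_nonneg h1 (sub_nonneg.mpr hr1))
  refine ⟨nonneg_of_mul_nonneg_right (hG ▸ hpos) hS, ?_⟩
  have hE := lintegral_energy hd hRl hR hH (isOpen_starDomain hR hRl).measurableSet hg
  have hrad : ∫⁻ y in unitBall d, radAvg g ‖y‖ = ENNReal.ofReal (radEnergy g) := by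
    rw [lintegral_radAvg hg, ofReal_radEnergy]
  have hra : Measurable (radAvg g) := measurable_rotQuad_rotField hg _ _
  have htan : ENNReal.ofReal ((d : ℝ) - 1) * (∫⁻ y in unitBall d, tanAvg g ‖y‖) =
      ENNReal.ofReal (‖g‖ ^ 2 - radEnergy g) := by
    have h := lintegral_radAvg_add_tanAvg hd hg
    have hrm : Measurable fun y : Euc d => radAvg g ‖y‖ := hra.comp measurable_norm
    rw [lintegral_add_left hrm, lintegral_const_mul' _ _
      ENNReal.ofReal_ne_top, hrad, ← IsBiLip.enorm_sq_Lp, enorm_sq_eq_ofReal] at h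
    rw [ENNReal.ofReal_sub _ hr0, ← h]
    exact (ENNReal.add_sub_cancel_left ENNReal.ofReal_ne_top).symm
  rw [hrad, htan, ← ENNReal.ofReal_mul h0, ← ENNReal.ofReal_mul h1,
    ← ENNReal.ofReal_add (mul_nonneg h0 hr0) (mul_nonneg h1 (sub_nonneg.mpr hr1)), ← hG,
    ENNReal.ofReal_mul hS.le, ofReal_measureReal] at hE
  refine (ENNReal.mul_right_inj ?_ (measure_ne_top _ _)).mp hE
  intro h
  rw [measureReal_def, h] at hS
  exact lt_irrefl _ hS

theorem starMap_preimage (hRl : ∃ K, LipschitzWith K R) (hR : ∀ ξ, 0 < R ξ)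
    (hH : IsBoundaryHomeo R H) :
    starMap hR hRl hH.lipschitz hH.lipschitz_symm ⁻¹' unitBall d = starDomain R :=
  preimage_homOne_starBdry hR

/-- Comparison of the eigenvalue sums of the starlike domain and of the ball, for form domains
that are preserved by bi-Lipschitz changes of variables. -/
theorem sum_eigenvalue_starDomain_le (hd : 2 ≤ d) (hRl : ∃ K, LipschitzWith K R)
    (hR : ∀ ξ, 0 < R ξ) (hH : IsBoundaryHomeo R H)
    (D : Submodule ℝ (L2 (starDomain R) × L2vec (starDomain R)))
    (hD : IsClosed (D : Set (L2 (starDomain R) × L2vec (starDomain R))))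
    (hDH : (D : Set (L2 (starDomain R) × L2vec (starDomain R))) ⊆ H1 (starDomain R))
    {D' : Set (L2 (unitBall d) × L2vec (unitBall d))}
    (hpull : ∀ (F : Euc d ≃ₜ Euc d) (m : ℝ≥0) (hF : IsBiLip F m)
      (hΩ : F ⁻¹' unitBall d = starDomain R), ∀ p ∈ D',
        (hF.pullFun hΩ measurableSet_ball p.1, hF.pullVec hΩ measurableSet_ball p.2) ∈ D)
    {u : ℕ → L2 (unitBall d)} {g : ℕ → L2vec (unitBall d)} (hu : IsEigenSeq D' u g) (n : ℕ) :
    ∑ j ∈ Finset.Icc 1 n, eigenvalue (D : Set (L2 (starDomain R) × L2vec (starDomain R))) j *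
        volume.real (starDomain R) ^ ((2 : ℝ) / d) ≤
      ∑ j ∈ Finset.Icc 1 n, eigenvalue D' j * volume.real (unitBall d) ^ ((2 : ℝ) / d) *
        Gmix R H (angularFraction (g j)) := by
  have hVΩ := volume_starDomain_pos hR hRl
  have hVB : 0 < volume.real (unitBall d) := volume_ball_pos
  set q : ℝ := volume.real (starDomain R) / volume.real (unitBall d) with hq
  have hqpos : 0 < q := div_pos hVΩ hVB
  set m : ℝ≥0 := ⟨q, hqpos.le⟩
  have hmq : (m : ℝ) = q := rfl
  have hm0 : m ≠ 0 := by
    rw [← NNReal.coe_ne_zero, hmq]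
    exact hqpos.ne'
  set F := starMap hR hRl hH.lipschitz hH.lipschitz_symm
  have hF : IsBiLip F m := isBiLip_starMap hRl hR hH hm0 rfl
  have hFΩ : F ⁻¹' unitBall d = starDomain R := starMap_preimage hRl hR hH
  have hcomp : CompactFst (D : Set (L2 (starDomain R) × L2vec (starDomain R))) :=
    (hF.compactFst_H1 hFΩ Metric.isOpen_ball Metric.isBounded_ball compactFst_H1_ball).mono hDH
  set E : ℕ → Rot d → ℝ≥0∞ := fun j U => ∫⁻ x in starDomain R,
    ‖ContinuousLinearMap.adjoint (fderiv ℝ F x) (rotField (g j) U (F x))‖ₑ ^ 2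
  have hEm : ∀ j, Measurable (E j) := fun j =>
    (measurable_pull_rotField F (Lp.stronglyMeasurable (g j)).measurable).lintegral_prod_right'
  -- One rotation is chosen for the whole sum, since the orthogonality of the trial functions
  -- requires the same `U` for every `j`.
  obtain ⟨U, hU⟩ := exists_le_lintegral (μ := rotMeasure d)
    (f := fun U => ∑ j ∈ Finset.Icc 1 n, E j U)
    (Finset.measurable_sum _ fun j _ => hEm j).aemeasurable
  rw [lintegral_finsetSum _ fun j _ => hEm j, Finset.sum_congr rfl fun j _ =>
    (lintegral_energy_eq hd hRl hR hH (g j)).2, ← ENNReal.ofReal_sum_of_nonneg fun j _ =>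
    (lintegral_energy_eq hd hRl hR hH (g j)).1] at hU
  have hFU := hF.rotComp U
  have hFUΩ : rotComp F U ⁻¹' unitBall d = starDomain R := preimage_rotComp hFΩ U
  have hnorm : ∀ j, ENNReal.ofReal (‖hFU.pullVec hFUΩ measurableSet_ball (g j)‖ ^ 2) = E j U := by
    intro j
    rw [← enorm_sq_eq_ofReal, IsBiLip.enorm_sq_Lp]
    refine lintegral_congr_ae ?_
    filter_upwards [hFU.coeFn_pullVec hFUΩ measurableSet_ball (g j)] with x hx
    rw [hx, pullField_rotComp]
  have hnonneg : 0 ≤ ∑ j ∈ Finset.Icc 1 n,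
      ‖g j‖ ^ 2 * (Gmix R H (angularFraction (g j)) * denomG R) :=
    Finset.sum_nonneg fun j _ => (lintegral_energy_eq hd hRl hR hH (g j)).1
  simp only [← hnorm] at hU
  rw [← ENNReal.ofReal_sum_of_nonneg fun j _ => by positivity,
    ENNReal.ofReal_le_ofReal_iff hnonneg] at hU
  have hray := sum_eigenvalue_le D hD hcomp
    (fun j => (hFU.pullFun hFUΩ measurableSet_ball (u j),
      hFU.pullVec hFUΩ measurableSet_ball (g j)))
    (fun j hj => hpull _ _ hFU hFUΩ _ (hu.eigen j hj).1) hqpos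
    (fun i j hi hj => by
      have ho := orthonormal_iff_ite.mp hu.orthonormal ⟨i, hi⟩ ⟨j, hj⟩
      have ho' : inner ℝ (u i) (u j) = if i = j then (1 : ℝ) else 0 := by
        rw [ho]
        exact if_congr Subtype.mk_eq_mk rfl rfl
      simp only [hFU.inner_pullFun, ho', hmq, mul_ite, mul_one, mul_zero]) n
  have hen : ∀ j ∈ Finset.Icc 1 n, ‖g j‖ ^ 2 = eigenvalue D' j := by
    intro j hj
    have hj1 : 1 ≤ j := (Finset.mem_Icc.mp hj).1
    have h1 : ‖u j‖ = 1 := hu.orthonormal.1 ⟨j, hj1⟩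
    rw [(hu.eigen j hj1).energy, h1, one_pow, mul_one]
  have hsum : ∑ j ∈ Finset.Icc 1 n, ‖g j‖ ^ 2 * (Gmix R H (angularFraction (g j)) * denomG R) =
      (∑ j ∈ Finset.Icc 1 n, eigenvalue D' j * Gmix R H (angularFraction (g j))) *
        q ^ (((d : ℝ) - 2) / (d : ℝ)) := by
    rw [Finset.sum_mul, hq, ← denomG_eq hR hRl]
    exact Finset.sum_congr rfl fun j hj => by rw [hen j hj, mul_assoc]
  rw [← Finset.sum_mul]
  have hrhs : ∑ j ∈ Finset.Icc 1 n, eigenvalue D' j * volume.real (unitBall d) ^ ((2 : ℝ) / d) *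
        Gmix R H (angularFraction (g j)) =
      (∑ j ∈ Finset.Icc 1 n, eigenvalue D' j * Gmix R H (angularFraction (g j))) *
        volume.real (unitBall d) ^ ((2 : ℝ) / d) := by
    rw [Finset.sum_mul]
    exact Finset.sum_congr rfl fun j _ => by ring
  rw [hrhs]
  have hd0 : (d : ℝ) ≠ 0 := by exact_mod_cast NeZero.ne d
  -- Rayleigh's principle carries the factor `q` and the mean energy carries `q ^ ((d - 2) / d)`;
  -- the quotient `q ^ (2 / d)` exchanges the volume normalization of the ball for that of the
  -- domain.
  have hqd : q ^ (((d : ℝ) - 2) / (d : ℝ)) * q ^ ((2 : ℝ) / d) = q := by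
    rw [← Real.rpow_add hqpos, ← add_div, sub_add_cancel, div_self hd0, Real.rpow_one]
  have hΩq : volume.real (starDomain R) ^ ((2 : ℝ) / d) =
      q ^ ((2 : ℝ) / d) * volume.real (unitBall d) ^ ((2 : ℝ) / d) := by
    rw [← Real.mul_rpow hqpos.le hVB.le, hq, div_mul_cancel₀ _ hVB.ne']
  have hpw : 0 < q ^ (((d : ℝ) - 2) / (d : ℝ)) := Real.rpow_pos_of_pos hqpos _
  rw [hΩq, ← mul_assoc]
  refine mul_le_mul_of_nonneg_right ?_ (Real.rpow_nonneg hVB.le _)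
  refine le_of_mul_le_mul_right ?_ hpw
  calc _ = q * ∑ j ∈ Finset.Icc 1 n,
        eigenvalue (D : Set (L2 (starDomain R) × L2vec (starDomain R))) j := by
        rw [mul_assoc, mul_comm (q ^ _), hqd, mul_comm]
    _ ≤ _ := hsum ▸ hray.trans hU

end Comparison

end StarEig

end

/-! ### The Dirichlet and Neumann inequalities -/

open MeasureTheory StarEig in
theorem theorem8p1 (d : ℕ) (hd : 2 ≤ d)
    (R : Sph d → ℝ) (hRpos : ∀ ξ, 0 < R ξ) (hRlip : ∃ K, LipschitzWith K R)
    (H : Sph d ≃ₜ Sph d) (hH : IsBoundaryHomeo R H) :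
    (∀ (u : ℕ → L2 (unitBall d)) (g : ℕ → L2vec (unitBall d)),
      IsEigenSeq (H10 (unitBall d)) u g → ∀ n : ℕ, 1 ≤ n →
        ∑ j ∈ Finset.Icc 1 n, dirichletEigenvalue (starDomain R) j *
            volume.real (starDomain R) ^ ((2 : ℝ) / d) ≤
          ∑ j ∈ Finset.Icc 1 n, dirichletEigenvalue (unitBall d) j *
            volume.real (unitBall d) ^ ((2 : ℝ) / d) * Gmix R H (angularFraction (g j))) ∧
    (∀ (u : ℕ → L2 (unitBall d)) (g : ℕ → L2vec (unitBall d)),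
      IsEigenSeq (H1 (unitBall d)) u g → ∀ n : ℕ, 2 ≤ n →
        ∑ j ∈ Finset.Icc 2 n, neumannEigenvalue (starDomain R) j *
            volume.real (starDomain R) ^ ((2 : ℝ) / d) ≤
          ∑ j ∈ Finset.Icc 2 n, neumannEigenvalue (unitBall d) j *
            volume.real (unitBall d) ^ ((2 : ℝ) / d) * Gmix R H (angularFraction (g j))) := by
  have : NeZero d := ⟨by omega⟩
  constructor
  · intro u g hu n _
    have h := sum_eigenvalue_starDomain_le hd hRlip hRpos hH (H10Sub (starDomain R))
      (by rw [coe_H10Sub]; exact isClosed_closure)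
      (by rw [coe_H10Sub]; exact H10_subset_H1 _)
      (fun F m hF hΩ p hp => by
        rw [← SetLike.mem_coe, coe_H10Sub]
        exact hF.pull_mem_H10 hΩ Metric.isOpen_ball hp) hu n
    rw [coe_H10Sub] at h
    exact h
  · intro u g hu n hn
    have h := sum_eigenvalue_starDomain_le hd hRlip hRpos hH (H1Sub (starDomain R))
      (isClosed_H1 _) subset_rfl
      (fun F m hF hΩ p hp => hF.pull_mem_H1 hΩ Metric.isOpen_ball Metric.isBounded_ball hp) hu n
    -- The comparison starts at `j = 1`. For the ball that term is zero whatever its energy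
    -- fraction, and for the domain it is nonnegative and can be dropped.
    have hIcc : Finset.Icc 1 n = insert 1 (Finset.Icc 2 n) :=
      (Finset.insert_Icc_add_one_left_eq_Icc (by omega)).symm
    have h1 : (1 : ℕ) ∉ Finset.Icc 2 n := by simp
    rw [hIcc, Finset.sum_insert h1, Finset.sum_insert h1, eigenvalue_H1_ball_one, zero_mul,
      zero_mul, zero_add] at h
    refine le_trans ?_ h
    exact le_add_of_nonneg_left (mul_nonneg (eigenvalue_nonneg le_rfl)
      (Real.rpow_nonneg measureReal_nonneg _))
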